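/- Let $k\ge 0$ and $n\ge 2$ be integers and let $\Lambda\subset \mathrm{SL}(k,\mathbb Z)$ be an arbitrary subgroup. Define the following subgroups of $\mathrm{SL}(k+n+1,\mathbb Z)$, in block form: $$G=\begin{pmatrix}\Lambda&M_{k,n}(\mathbb Z)&\mathbb Z^k\\0&\mathrm{SL}(n,\mathbb Z)&\mathbb Z^n\\0&0&1\end{pmatrix},\quad \Gamma=\begin{pmatrix}\Lambda&M_{k,n}(\mathbb Z)&0\\0&\mathrm{SL}(n,\mathbb Z)&0\\0&0&1\end{pmatrix},\quad H=\begin{pmatrix}I_k&0&\mathbb Z^k\\0&I_n&\mathbb Z^n\\0&0&1\end{pmatrix},$$ $$H_1=\begin{pmatrix}I_k&M_{k,n}(\mathbb Z)&\mathbb Z^k\\0&I_n&\mathbb Z^n\\0&0&1\end{pmatrix},\quad H_2=\begin{pmatrix}I_k&M_{k,n}(\mathbb Z)&\mathbb Z^k\\0&\mathrm{SL}(n,\mathbb Z)&\mathbb Z^n\\0&0&1\end{pmatrix}.$$ Thus $G=H\rtimes\Gamma$. Let $\Gamma$ act on the dual group $\widehat H\cong\mathbb T^{k+n}$, equipped with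 its Haar (Lebesgue) probability measure, by the action dual to conjugation on $H\cong\mathbb Z^{k+n}$, and let $\Lambda$ act on $\widehat{\mathbb Z^k}=\mathbb T^k$ by the action dual to its linear action on $\mathbb Z^k$. A probability measure preserving (pmp) action $\Gamma\curvearrowright(X,\mu)$ is called *rigid* if the inclusion $A=L^\infty(X)\subset M=L^\infty(X)\rtimes\Gamma$ is rigid with respect to the canonical trace $\tau$ of $M$ (the one with $\tau(au_g)=\int_X a\,d\mu$ if $g=e$ and $\tau(au_g)=0$ otherwise): whenever $\mathcal H$ is a Hilbert $M$-$M$-bimodule and $\xi_i\in\mathcal H$ is a sequence of unit vectors with $\langle x\xi_i,\xi_i\rangle=\tau(x)=\langle\xi_i x,\xi_i\rangle$ for all $x\in M$ and all $i$, and $\|x\xi_i-\xi_i x\|\to0$ for all $x\in M$, then $\|\xi_i-P_A(\xi_i)\|\to0$, where $P_A$ is the orthogonal projection onto the closed subspace of the $A$-central vectors $\{\xi : a\xi=\xi a \text{ for all } a\in A\}$. It is called *strongly ergodic* if $\mu(X_i)(1-\mu(X_i))\to0$ for every sequence of measurable sets $X_i\subset X$ with $\mu(g\cdot X_i\,\triangle\,X_i)\to0$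 for all $g\in\Gamma$, and *essentially free* if almost every point has a trivial stabilizer. A pair $H<G$ of a discrete group and a subgroup has the *relative property (T)* if for every $\varepsilon>0$ there are a finite set $F\subset G$ and $\delta>0$ such that for every unitary representation $\pi$ of $G$ and every unit vector $\xi$ with $\|\pi(g)\xi-\xi\|<\delta$ for all $g\in F$ there is an $H$-invariant vector $\eta$ with $\|\xi-\eta\|<\varepsilon$. Then the following hold. 1. The pair $H_1<H_2$ has the relative property (T). In particular, $H<G$ has the relative property (T), and $\Gamma\curvearrowright\widehat H$ is a rigid action. 2. The action $\Gamma\curvearrowright\widehat H$ is ergodic if and only if $\{Ax\mid A\in\Lambda\}$ is infinite for all $x\in\mathbb Z^k\setminus\{0\}$. In particular, if $k\ge1$ and $\Lambda=\{I_k\}$, the action $\Gamma\curvearrowright\widehat H$ is rigid but not ergodic. 3. The action $\Gamma\curvearrowright\widehat H$ is strongly ergodic if and only if the action $\Lambda\curvearrowright\widehat{\mathbb Z^k}=\mathbb T^k$ is strongly ergodic. 4. The action $\Gamma\curvearrowright\widehat H$ is essentially free. In particular, if $k,n\ge2$, if $A\in\mathrm{SL}(k,\mathbb Z)$ is a matrix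 none of whose (complex) eigenvalues is a root of unity, and if $\Lambda=A^{\mathbb Z}$, then $\Gamma\curvearrowright\widehat H$ is rigid, essentially free, probability measure preserving and ergodic, but not strongly ergodic. -/

import Mathlib

open MeasureTheory Filter Topology
open scoped ENNReal Matrix

noncomputable section

namespace RigidActions

set_option linter.unusedSectionVars false

/-! ### Relative property (T) for pairs of groups -/

/-- The pair `H < G` of a (discrete) group and a subgroup has the relative property (T):
for every `ε > 0` there are a finite set `F ⊆ G` and `δ > 0` such that in every unitary
representation of `G`, each `(F, δ)`-invariant unit vector is `ε`-close to an `H`-invariant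
vector. -/
def HasRelativePropertyT.{u} {G : Type*} [Group G] (H : Subgroup G) : Prop :=
  ∀ ε : ℝ, 0 < ε → ∃ (F : Finset G) (δ : ℝ), 0 < δ ∧
    ∀ (E : Type u) [NormedAddCommGroup E] [InnerProductSpace ℂ E] [CompleteSpace E]
      (π : G →* (E ≃ₗᵢ[ℂ] E)) (ξ : E), ‖ξ‖ = 1 → (∀ g ∈ F, ‖π g ξ - ξ‖ < δ) →
        ∃ η : E, (∀ h ∈ H, π h η = η) ∧ ‖ξ - η‖ < ε

/-! ### Von Neumann algebras, bimodules and rigid inclusions -/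

section VonNeumann

variable {𝓗 : Type*} [NormedAddCommGroup 𝓗] [InnerProductSpace ℂ 𝓗] [CompleteSpace 𝓗]

/-- The von Neumann algebra generated by a set `S` of bounded operators: the bicommutant of
`S ∪ S*`. -/
def vonNeumannGenerate (S : Set (𝓗 →L[ℂ] 𝓗)) : VonNeumannAlgebra 𝓗 where
  toStarSubalgebra := StarSubalgebra.centralizer ℂ
    (StarSubalgebra.centralizer ℂ S : Set (𝓗 →L[ℂ] 𝓗))
  centralizer_centralizer' := by
    change Set.centralizer (Set.centralizer
      ((StarSubalgebra.centralizer ℂ _ : StarSubalgebra ℂ (𝓗 →L[ℂ] 𝓗)) : Set (𝓗 →L[ℂ] 𝓗))) =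
      ((StarSubalgebra.centralizer ℂ _ : StarSubalgebra ℂ (𝓗 →L[ℂ] 𝓗)) : Set (𝓗 →L[ℂ] 𝓗))
    rw [StarSubalgebra.coe_centralizer, Set.centralizer_centralizer_centralizer]

theorem subset_vonNeumannGenerate (S : Set (𝓗 →L[ℂ] 𝓗)) :
    S ⊆ (vonNeumannGenerate S).toStarSubalgebra := by
  intro x hx
  change x ∈ StarSubalgebra.centralizer ℂ
    (StarSubalgebra.centralizer ℂ S : Set (𝓗 →L[ℂ] 𝓗))
  rw [StarSubalgebra.mem_centralizer_iff]
  intro g hg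
  have key : ∀ z ∈ StarSubalgebra.centralizer ℂ S, z * x = x * z := fun z hz =>
    ((StarSubalgebra.mem_centralizer_iff ℂ).1 hz x hx).1.symm
  exact ⟨key g hg, key _ (star_mem hg)⟩

/-- A linear map from a von Neumann algebra `M ⊆ B(𝓗)` to `B(K)` is normal (ultraweakly
continuous) if each of its coefficients is an ultraweakly continuous functional on `M`, that is,
a functional of the form `x ↦ ∑ ⟨αᵢ, x βᵢ⟩` with `∑ ‖αᵢ‖² < ∞` and `∑ ‖βᵢ‖² < ∞`. -/
def IsNormalMap (M : VonNeumannAlgebra 𝓗) {K : Type*} [NormedAddCommGroup K]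
    [InnerProductSpace ℂ K] (φ : M.toStarSubalgebra → (K →L[ℂ] K)) : Prop :=
  ∀ ξ η : K, ∃ α β : ℕ → 𝓗,
    Summable (fun i => ‖α i‖ ^ 2) ∧ Summable (fun i => ‖β i‖ ^ 2) ∧
    ∀ x : M.toStarSubalgebra,
      HasSum (fun i => inner ℂ (α i) ((x : 𝓗 →L[ℂ] 𝓗) (β i))) (inner ℂ ξ (φ x η))

/-- A Hilbert `M`-`M`-bimodule structure on the Hilbert space `K`: commuting normal unital
`*`-representations of `M` (left action) and of the opposite algebra of `M` (right action). -/
structure HilbertBimodule (M : VonNeumannAlgebra 𝓗) (K : Type*) [NormedAddCommGroup K]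
    [InnerProductSpace ℂ K] [CompleteSpace K] where
  left : M.toStarSubalgebra →⋆ₐ[ℂ] (K →L[ℂ] K)
  right : (M.toStarSubalgebra)ᵐᵒᵖ →⋆ₐ[ℂ] (K →L[ℂ] K)
  comm : ∀ x y, left x * right y = right y * left x
  left_normal : IsNormalMap M (fun x => left x)
  right_normal : IsNormalMap M (fun x => right (MulOpposite.op x))

namespace HilbertBimodule

variable {M : VonNeumannAlgebra 𝓗} {K : Type*} [NormedAddCommGroup K]
    [InnerProductSpace ℂ K] [CompleteSpace K] (B : HilbertBimodule M K)

/-- `x ξ`. -/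
def lact (x : M.toStarSubalgebra) (ξ : K) : K := B.left x ξ

/-- `ξ x`. -/
def ract (ξ : K) (x : M.toStarSubalgebra) : K := B.right (MulOpposite.op x) ξ

/-- `⟨x ξ, ξ⟩ = τ(x) = ⟨ξ x, ξ⟩` for all `x ∈ M` (Mathlib's inner product is linear in its second
variable). -/
def IsTracial (τ : M.toStarSubalgebra → ℂ) (ξ : K) : Prop :=
  ∀ x, inner ℂ ξ (B.lact x ξ) = τ x ∧ inner ℂ ξ (B.ract ξ x) = τ x

/-- A sequence of unit vectors with `‖x ξₙ - ξₙ x‖ → 0` for all `x ∈ M`. -/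
def IsAlmostCentral (ξ : ℕ → K) : Prop :=
  (∀ n, ‖ξ n‖ = 1) ∧ ∀ x, Tendsto (fun n => ‖B.lact x (ξ n) - B.ract (ξ n) x‖) atTop (𝓝 0)

/-- The closed subspace of `A`-central vectors, for a subalgebra `A ⊆ M`. -/
def centralVectors {A : StarSubalgebra ℂ (𝓗 →L[ℂ] 𝓗)} (hA : A ≤ M.toStarSubalgebra) :
    Submodule ℂ K :=
  ⨅ x : A, LinearMap.ker (B.left ⟨x, hA x.2⟩ - B.right (MulOpposite.op ⟨x, hA x.2⟩) :
    K →L[ℂ] K).toLinearMap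

theorem mem_centralVectors {A : StarSubalgebra ℂ (𝓗 →L[ℂ] 𝓗)} (hA : A ≤ M.toStarSubalgebra)
    (ξ : K) : ξ ∈ B.centralVectors hA ↔
      ∀ x (hx : x ∈ A), B.lact ⟨x, hA hx⟩ ξ = B.ract ξ ⟨x, hA hx⟩ := by
  simp [centralVectors, lact, ract, sub_eq_zero]

instance {A : StarSubalgebra ℂ (𝓗 →L[ℂ] 𝓗)} (hA : A ≤ M.toStarSubalgebra) :
    (B.centralVectors hA).HasOrthogonalProjection := by
  have hc : IsClosed (B.centralVectors hA : Set K) := by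
    rw [centralVectors, Submodule.coe_iInf]
    exact isClosed_iInter fun x => ContinuousLinearMap.isClosed_ker _
  have : CompleteSpace (B.centralVectors hA) := hc.completeSpace_coe
  infer_instance

end HilbertBimodule

/-- The inclusion `A ⊆ M` of von Neumann algebras is rigid (has the relative property (T)) with
respect to the tracial state `τ` of `M`: in every Hilbert `M`-`M`-bimodule, each sequence `ξₙ` of
tracial, almost `M`-central vectors satisfies `‖ξₙ - P_A(ξₙ)‖ → 0`, with `P_A` the orthogonal
projection onto the `A`-central vectors. -/
def IsRigidInclusion.{u} (M : VonNeumannAlgebra 𝓗) (τ : M.toStarSubalgebra → ℂ)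
    {A : StarSubalgebra ℂ (𝓗 →L[ℂ] 𝓗)} (hA : A ≤ M.toStarSubalgebra) : Prop :=
  ∀ (K : Type u) [NormedAddCommGroup K] [InnerProductSpace ℂ K] [CompleteSpace K]
    (B : HilbertBimodule M K) (ξ : ℕ → K), (∀ n, B.IsTracial τ (ξ n)) → B.IsAlmostCentral ξ →
      Tendsto (fun n => ‖ξ n - (B.centralVectors hA).starProjection (ξ n)‖) atTop (𝓝 0)

end VonNeumann

/-! ### The crossed product of a measure preserving action, and rigid actions -/

section Crossed

/- `Γ` is a countable discrete group, with the discrete measurable structure, acting by measure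
preserving transformations of the measure space `(X, μ)`. The crossed product is realized on
`L²(X × Γ)` (with the product of `μ` and the counting measure), where `a ∈ L^∞(X)` acts by
`(a ξ)(x, h) = a(x) ξ(x, h)` and `u_g` by `(u_g ξ)(x, h) = ξ(g⁻¹ x, g⁻¹ h)`. -/
variable (Γ : Type*) [Group Γ] [Countable Γ] [MeasurableSpace Γ] [DiscreteMeasurableSpace Γ]
  {X : Type*} [MeasurableSpace X] [MulAction Γ X] [MeasurableConstSMul Γ X]
  (μ : Measure X) [IsProbabilityMeasure μ] [SMulInvariantMeasure Γ X μ]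

/-- The Hilbert space `L²(X × Γ) = L²(X) ⊗ ℓ²(Γ)`. -/
abbrev CrossedSpace : Type _ := Lp ℂ 2 (μ.prod (Measure.count : Measure Γ))

theorem measurePreserving_diag (g : Γ) :
    MeasurePreserving (fun p : X × Γ => (g • p.1, g * p.2))
      (μ.prod Measure.count) (μ.prod Measure.count) :=
  (measurePreserving_smul g μ).prod (measurePreserving_mul_left Measure.count g)

/-- The unitary `u_g`, as a bounded operator: `(u_g ξ)(x, h) = ξ(g⁻¹ x, g⁻¹ h)`. -/
def crossedUnitary (g : Γ) : CrossedSpace Γ μ →L[ℂ] CrossedSpace Γ μ :=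
  (Lp.compMeasurePreservingₗᵢ ℂ (fun p : X × Γ => (g⁻¹ • p.1, g⁻¹ * p.2))
    (measurePreserving_diag Γ μ g⁻¹)).toContinuousLinearMap

variable {μ} in
theorem memLp_top_comp_fst {a : X → ℂ} (ha : MemLp a ∞ μ) :
    MemLp (fun p : X × Γ => a p.1) ∞ (μ.prod (Measure.count : Measure Γ)) := by
  refine ⟨ha.1.comp_fst, lt_of_le_of_lt ?_ ha.2⟩
  rw [eLpNorm_exponent_top, eLpNorm_exponent_top]
  refine essSup_le_of_ae_le _ ?_
  exact Measure.quasiMeasurePreserving_fst.ae (ae_le_eLpNormEssSup (f := a) (μ := μ))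

/-- The algebra `L^∞(X)` of multiplication operators `(a ξ)(x, h) = a(x) ξ(x, h)`. -/
def linftyAlgebra : StarSubalgebra ℂ (CrossedSpace Γ μ →L[ℂ] CrossedSpace Γ μ) where
  carrier := {T | ∃ a : X → ℂ, MemLp a ∞ μ ∧ ∀ ξ : CrossedSpace Γ μ,
    T ξ =ᵐ[μ.prod Measure.count] fun p => a p.1 * ξ p}
  mul_mem' := by
    rintro S T ⟨a, ha, hS⟩ ⟨b, hb, hT⟩
    refine ⟨fun x => a x * b x, hb.mul ha, fun ξ => ?_⟩
    filter_upwards [hS (T ξ), hT ξ] with p h1 h2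
    rw [ContinuousLinearMap.mul_def, ContinuousLinearMap.comp_apply, h1, h2, mul_assoc]
  add_mem' := by
    rintro S T ⟨a, ha, hS⟩ ⟨b, hb, hT⟩
    refine ⟨fun x => a x + b x, ha.add hb, fun ξ => ?_⟩
    filter_upwards [hS ξ, hT ξ, Lp.coeFn_add (S ξ) (T ξ)] with p h1 h2 h3
    rw [add_apply, h3, Pi.add_apply, h1, h2, add_mul]
  algebraMap_mem' c := by
    refine ⟨fun _ => c, memLp_top_const c, fun ξ => ?_⟩
    filter_upwards [Lp.coeFn_smul c ξ] with p h
    rw [Algebra.algebraMap_eq_smul_one, smul_apply,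
      one_apply_eq_self, h, Pi.smul_apply, smul_eq_mul]
  star_mem' := by
    rintro T ⟨a, ha, hT⟩
    refine ⟨fun x => star (a x), ha.star, fun ξ => ?_⟩
    have hm : MemLp (fun p : X × Γ => star (a p.1) * ξ p) 2
        (μ.prod (Measure.count : Measure Γ)) :=
      (Lp.memLp ξ).mul (memLp_top_comp_fst Γ ha.star)
    have heq : star T ξ = hm.toLp _ := by
      refine ext_inner_right ℂ fun ζ => ?_
      rw [ContinuousLinearMap.star_eq_adjoint, ContinuousLinearMap.adjoint_inner_left,
        L2.inner_def, L2.inner_def]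
      refine integral_congr_ae ?_
      filter_upwards [hT ζ, hm.coeFn_toLp] with p h1 h2
      rw [h1, h2]
      simp only [RCLike.inner_apply, map_mul, RCLike.star_def, RCLike.conj_conj]
      ring
    rw [heq]
    exact hm.coeFn_toLp

/-- The crossed product von Neumann algebra `L^∞(X) ⋊ Γ`. -/
def crossedProduct : VonNeumannAlgebra (CrossedSpace Γ μ) :=
  vonNeumannGenerate (linftyAlgebra Γ μ ∪ Set.range (crossedUnitary Γ μ))

theorem linftyAlgebra_le_crossedProduct :
    linftyAlgebra Γ μ ≤ (crossedProduct Γ μ).toStarSubalgebra :=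
  fun _ hx => subset_vonNeumannGenerate _ (Or.inl hx)

theorem crossedUnitary_mem_crossedProduct (g : Γ) :
    crossedUnitary Γ μ g ∈ (crossedProduct Γ μ).toStarSubalgebra :=
  subset_vonNeumannGenerate _ (Or.inr ⟨g, rfl⟩)

theorem measure_fiber_one_ne_top :
    (μ.prod (Measure.count : Measure Γ)) (Set.univ ×ˢ {1}) ≠ ∞ := by
  simp [Measure.prod_prod]

/-- The unit vector `1_X ⊗ δ_e` of `L²(X × Γ)`. -/
def crossedVacuum : CrossedSpace Γ μ :=
  indicatorConstLp 2 (MeasurableSet.univ.prod (MeasurableSet.singleton (1 : Γ)))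
    (measure_fiber_one_ne_top Γ μ) (1 : ℂ)

/-- The trace of the crossed product: the vector state of `1_X ⊗ δ_e`, which maps `a u_g` to
`∫ a dμ` if `g = e` and to `0` otherwise. -/
def crossedTrace (x : (crossedProduct Γ μ).toStarSubalgebra) : ℂ :=
  inner ℂ (crossedVacuum Γ μ)
    ((x : CrossedSpace Γ μ →L[ℂ] CrossedSpace Γ μ) (crossedVacuum Γ μ))

/-- The pmp action of `Γ` on `(X, μ)` is rigid: `L^∞(X) ⊆ L^∞(X) ⋊ Γ` is a rigid inclusion. -/
def IsRigidAction.{u} : Prop :=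
  IsRigidInclusion.{_, u} (crossedProduct Γ μ) (crossedTrace Γ μ)
    (linftyAlgebra_le_crossedProduct Γ μ)

end Crossed

/-! ### Strong ergodicity and essential freeness -/

section Ergodic

variable (Γ : Type*) [Group Γ] {X : Type*} [MeasurableSpace X] [MulAction Γ X] (μ : Measure X)

/-- There are no non-trivial asymptotically invariant sequences of measurable sets. -/
def IsStronglyErgodic : Prop :=
  ∀ S : ℕ → Set X, (∀ i, MeasurableSet (S i)) →
    (∀ g : Γ, Tendsto (fun i => μ.real (symmDiff ((fun x => g • x) '' S i) (S i))) atTop (𝓝 0)) →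
      Tendsto (fun i => μ.real (S i) * (1 - μ.real (S i))) atTop (𝓝 0)

/-- Almost every point has a trivial stabilizer. -/
def IsEssentiallyFree : Prop :=
  ∀ᵐ x ∂μ, ∀ g : Γ, g • x = x → g = 1

end Ergodic

/-! ### The action of `SL(ι, ℤ)` on the dual torus of `ℤ^ι` -/

section Torus

variable {ι : Type*} [Fintype ι] [DecidableEq ι]

/-- The normalized Haar (Lebesgue) measure on the torus `(ℝ/ℤ)^ι`. -/
def torusMeasure (ι : Type*) [Fintype ι] : Measure (UnitAddTorus ι) :=
  Measure.pi fun _ => AddCircle.haarAddCircle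

instance : IsProbabilityMeasure (torusMeasure ι) := by
  unfold torusMeasure; infer_instance

instance : Measure.IsAddHaarMeasure (torusMeasure ι) := by
  unfold torusMeasure; infer_instance

/-- The dual action of `SL(ι, ℤ)` on the torus, the dual group of `ℤ^ι`: `g` acts by the inverse
transpose, so that a character `v ∈ ℤ^ι` of the torus satisfies `v(g • x) = (g⁻¹ v)(x)`
(see `mFourier_smul`). -/
instance torusAction : MulAction (Matrix.SpecialLinearGroup ι ℤ) (UnitAddTorus ι) where
  smul g x := fun i => ∑ j, (g⁻¹).1 j i • x j
  one_smul x := by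
    funext i
    change ∑ j, ((1 : Matrix.SpecialLinearGroup ι ℤ)⁻¹).1 j i • x j = x i
    simp [Matrix.one_apply]
  mul_smul g h x := by
    funext i
    change ∑ j, ((g * h)⁻¹).1 j i • x j = ∑ j, (g⁻¹).1 j i • ∑ l, (h⁻¹).1 l j • x l
    have : ∀ j, ((g * h)⁻¹).1 j i = ∑ l, (h⁻¹).1 j l * (g⁻¹).1 l i := fun j => by
      rw [mul_inv_rev]; rfl
    simp only [this, Finset.sum_smul, Finset.smul_sum]
    rw [Finset.sum_comm]
    refine Finset.sum_congr rfl fun l _ => Finset.sum_congr rfl fun j _ => ?_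
    rw [mul_comm, mul_smul]

theorem torus_smul_apply (g : Matrix.SpecialLinearGroup ι ℤ) (x : UnitAddTorus ι) (i : ι) :
    (g • x) i = ∑ j, (g⁻¹).1 j i • x j := rfl

theorem mFourier_smul (g : Matrix.SpecialLinearGroup ι ℤ) (v : ι → ℤ) (x : UnitAddTorus ι) :
    UnitAddTorus.mFourier v (g • x) = UnitAddTorus.mFourier ((g⁻¹).1 *ᵥ v) x := by
  simp only [UnitAddTorus.mFourier, ContinuousMap.coe_mk, torus_smul_apply, fourier_apply]
  have h : ∀ y : ι → UnitAddCircle, ∏ i, (AddCircle.toCircle (y i) : ℂ) =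
      AddCircle.toCircle (∑ i, y i) := fun y => by
    induction (Finset.univ : Finset ι) using Finset.induction_on with
    | empty => simp
    | insert a s ha ih => rw [Finset.prod_insert ha, Finset.sum_insert ha, ih,
        AddCircle.toCircle_add, Circle.coe_mul]
  rw [h, h]
  congr 2
  simp only [Matrix.mulVec, dotProduct, Finset.sum_smul, Finset.smul_sum]
  rw [Finset.sum_comm]
  refine Finset.sum_congr rfl fun j _ => Finset.sum_congr rfl fun i _ => ?_
  rw [mul_comm, mul_smul]

theorem continuous_torus_smul (g : Matrix.SpecialLinearGroup ι ℤ) :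
    Continuous (fun x : UnitAddTorus ι => g • x) := by
  refine continuous_pi fun i => ?_
  simp only [torus_smul_apply]
  fun_prop

instance : MeasurableConstSMul (Matrix.SpecialLinearGroup ι ℤ) (UnitAddTorus ι) :=
  ⟨fun g => (continuous_torus_smul g).measurable⟩

instance : SMulInvariantMeasure (Matrix.SpecialLinearGroup ι ℤ) (UnitAddTorus ι)
    (torusMeasure ι) where
  measure_preimage_smul g s hs := by
    let f : UnitAddTorus ι →+ UnitAddTorus ι :=
      { toFun := fun x => g • x
        map_zero' := by funext i; simp [torus_smul_apply]
        map_add' := fun x y => by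
          funext i; simp [torus_smul_apply, Finset.sum_add_distrib] }
    have hf : MeasurePreserving f (torusMeasure ι) (torusMeasure ι) :=
      AddMonoidHom.measurePreserving (continuous_torus_smul g) (MulAction.surjective g) rfl
    exact hf.measure_preimage hs.nullMeasurableSet

instance : Countable (Matrix.SpecialLinearGroup ι ℤ) :=
  have : Countable (Matrix ι ι ℤ) := inferInstanceAs (Countable (ι → ι → ℤ))
  Subtype.val_injective.countable

end Torus

/-! ### The groups `G, Γ, H, H₁, H₂` -/

section Groups

variable {k n : ℕ}

/-- The index set of size `k + n + 1`. -/
abbrev Idx (k n : ℕ) : Type := (Fin k ⊕ Fin n) ⊕ Unit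

/-- The block matrix with rows `(A, B, v)`, `(0, C, w)`, `(0, 0, 1)`. -/
def blockMatrix (A : Matrix.SpecialLinearGroup (Fin k) ℤ) (B : Matrix (Fin k) (Fin n) ℤ)
    (C : Matrix.SpecialLinearGroup (Fin n) ℤ) (v : Fin k → ℤ) (w : Fin n → ℤ) :
    Matrix.SpecialLinearGroup (Idx k n) ℤ :=
  ⟨Matrix.fromBlocks (Matrix.fromBlocks A.1 B 0 C.1) (Matrix.replicateCol Unit (Sum.elim v w)) 0 1,
    by simp [Matrix.det_fromBlocks_zero₂₁, A.2, C.2]⟩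

theorem blockMatrix_mul (A A' : Matrix.SpecialLinearGroup (Fin k) ℤ)
    (B B' : Matrix (Fin k) (Fin n) ℤ) (C C' : Matrix.SpecialLinearGroup (Fin n) ℤ)
    (v v' : Fin k → ℤ) (w w' : Fin n → ℤ) :
    blockMatrix A B C v w * blockMatrix A' B' C' v' w' =
      blockMatrix (A * A') (A.1 * B' + B * C'.1) (C * C')
        (A.1 *ᵥ v' + B *ᵥ w' + v) (C.1 *ᵥ w' + w) := by
  apply Subtype.ext
  have h : (Matrix.fromBlocks A.1 B 0 C.1) * Matrix.replicateCol Unit (Sum.elim v' w') +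
      Matrix.replicateCol Unit (Sum.elim v w) =
      Matrix.replicateCol Unit (Sum.elim (A.1 *ᵥ v' + B *ᵥ w' + v) (C.1 *ᵥ w' + w)) := by
    ext i j
    rcases i with i | i <;>
      simp [Matrix.mul_apply, Matrix.mulVec, dotProduct]
  change Matrix.fromBlocks _ _ _ _ * Matrix.fromBlocks _ _ _ _ = Matrix.fromBlocks _ _ _ _
  rw [Matrix.fromBlocks_multiply, ← h]
  simp [Matrix.fromBlocks_multiply]

theorem blockMatrix_one : blockMatrix (1 : Matrix.SpecialLinearGroup (Fin k) ℤ) 0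
    (1 : Matrix.SpecialLinearGroup (Fin n) ℤ) 0 0 = 1 := by
  apply Subtype.ext
  simp [blockMatrix]

theorem blockMatrix_inv (A : Matrix.SpecialLinearGroup (Fin k) ℤ) (B : Matrix (Fin k) (Fin n) ℤ)
    (C : Matrix.SpecialLinearGroup (Fin n) ℤ) (v : Fin k → ℤ) (w : Fin n → ℤ) :
    (blockMatrix A B C v w)⁻¹ = blockMatrix A⁻¹ (-((A⁻¹).1 * B * (C⁻¹).1)) C⁻¹
      (-((A⁻¹).1 *ᵥ v + -((A⁻¹).1 * B * (C⁻¹).1) *ᵥ w)) (-((C⁻¹).1 *ᵥ w)) := by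
  symm
  apply eq_inv_of_mul_eq_one_left
  have hC : (C⁻¹).1 * C.1 = 1 := congrArg Subtype.val (inv_mul_cancel C)
  rw [blockMatrix_mul, ← blockMatrix_one]
  congr 1
  · simp
  · rw [Matrix.neg_mul, Matrix.mul_assoc _ _ C.1, hC, Matrix.mul_one, add_neg_cancel]
  · simp
  · exact add_neg_cancel _
  · exact add_neg_cancel _

/-- `G = [[Λ, M_{k,n}(ℤ), ℤ^k], [0, SL(n,ℤ), ℤ^n], [0, 0, 1]]`. -/
def groupG (n : ℕ) (Λ : Subgroup (Matrix.SpecialLinearGroup (Fin k) ℤ)) :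
    Subgroup (Matrix.SpecialLinearGroup (Idx k n) ℤ) where
  carrier := {g | ∃ A ∈ Λ, ∃ B C v w, g = blockMatrix A B C v w}
  mul_mem' := by
    rintro _ _ ⟨A, hA, B, C, v, w, rfl⟩ ⟨A', hA', B', C', v', w', rfl⟩
    exact ⟨_, Λ.mul_mem hA hA', _, _, _, _, blockMatrix_mul ..⟩
  one_mem' := ⟨1, Λ.one_mem, 0, 1, 0, 0, blockMatrix_one.symm⟩
  inv_mem' := by
    rintro _ ⟨A, hA, B, C, v, w, rfl⟩
    exact ⟨_, Λ.inv_mem hA, _, _, _, _, blockMatrix_inv ..⟩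

/-- `Γ = [[Λ, M_{k,n}(ℤ), 0], [0, SL(n,ℤ), 0], [0, 0, 1]]`. -/
def groupΓ (n : ℕ) (Λ : Subgroup (Matrix.SpecialLinearGroup (Fin k) ℤ)) :
    Subgroup (Matrix.SpecialLinearGroup (Idx k n) ℤ) where
  carrier := {g | ∃ A ∈ Λ, ∃ B C, g = blockMatrix A B C 0 0}
  mul_mem' := by
    rintro _ _ ⟨A, hA, B, C, rfl⟩ ⟨A', hA', B', C', rfl⟩
    exact ⟨_, Λ.mul_mem hA hA', _, _, by
      rw [blockMatrix_mul, Matrix.mulVec_zero, Matrix.mulVec_zero, Matrix.mulVec_zero, add_zero,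
        add_zero, add_zero]⟩
  one_mem' := ⟨1, Λ.one_mem, 0, 1, blockMatrix_one.symm⟩
  inv_mem' := by
    rintro _ ⟨A, hA, B, C, rfl⟩
    exact ⟨_, Λ.inv_mem hA, _, _, by
      rw [blockMatrix_inv, Matrix.mulVec_zero, Matrix.mulVec_zero, Matrix.mulVec_zero, add_zero,
        neg_zero, neg_zero]⟩

/-- `H = [[I_k, 0, ℤ^k], [0, I_n, ℤ^n], [0, 0, 1]]`. -/
def groupH (k n : ℕ) : Subgroup (Matrix.SpecialLinearGroup (Idx k n) ℤ) where
  carrier := {g | ∃ v w, g = blockMatrix 1 0 1 v w}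
  mul_mem' := by
    rintro _ _ ⟨v, w, rfl⟩ ⟨v', w', rfl⟩
    exact ⟨_, _, by rw [blockMatrix_mul, mul_one, mul_one, Matrix.mul_zero, Matrix.zero_mul,
      add_zero]⟩
  one_mem' := ⟨0, 0, blockMatrix_one.symm⟩
  inv_mem' := by
    rintro _ ⟨v, w, rfl⟩
    exact ⟨_, _, by rw [blockMatrix_inv, inv_one, inv_one, Matrix.mul_zero, Matrix.zero_mul,
      neg_zero]⟩

/-- `H₁ = [[I_k, M_{k,n}(ℤ), ℤ^k], [0, I_n, ℤ^n], [0, 0, 1]]`. -/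
def groupH₁ (k n : ℕ) : Subgroup (Matrix.SpecialLinearGroup (Idx k n) ℤ) where
  carrier := {g | ∃ B v w, g = blockMatrix 1 B 1 v w}
  mul_mem' := by
    rintro _ _ ⟨B, v, w, rfl⟩ ⟨B', v', w', rfl⟩
    exact ⟨_, _, _, by rw [blockMatrix_mul, mul_one, mul_one]⟩
  one_mem' := ⟨0, 0, 0, blockMatrix_one.symm⟩
  inv_mem' := by
    rintro _ ⟨B, v, w, rfl⟩
    exact ⟨_, _, _, by rw [blockMatrix_inv, inv_one, inv_one]⟩

/-- `H₂ = [[I_k, M_{k,n}(ℤ), ℤ^k], [0, SL(n,ℤ), ℤ^n], [0, 0, 1]]`. -/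
def groupH₂ (k n : ℕ) : Subgroup (Matrix.SpecialLinearGroup (Idx k n) ℤ) where
  carrier := {g | ∃ B C v w, g = blockMatrix 1 B C v w}
  mul_mem' := by
    rintro _ _ ⟨B, C, v, w, rfl⟩ ⟨B', C', v', w', rfl⟩
    exact ⟨_, _, _, _, by rw [blockMatrix_mul, mul_one]⟩
  one_mem' := ⟨0, 1, 0, 0, blockMatrix_one.symm⟩
  inv_mem' := by
    rintro _ ⟨B, C, v, w, rfl⟩
    exact ⟨_, _, _, _, by rw [blockMatrix_inv, inv_one]⟩

variable {Λ : Subgroup (Matrix.SpecialLinearGroup (Fin k) ℤ)}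

theorem groupH_le_groupG : groupH k n ≤ groupG n Λ := by
  rintro _ ⟨v, w, rfl⟩
  exact ⟨1, Λ.one_mem, 0, 1, v, w, rfl⟩

theorem groupH₁_le_groupH₂ : groupH₁ k n ≤ groupH₂ k n := by
  rintro _ ⟨B, v, w, rfl⟩
  exact ⟨B, 1, v, w, rfl⟩

/-- The homomorphism `Γ → SL(k + n, ℤ)` that takes the upper left corner. -/
def corner : groupΓ n Λ →* Matrix.SpecialLinearGroup (Fin k ⊕ Fin n) ℤ where
  toFun g := ⟨g.1.1.toBlocks₁₁, by
    obtain ⟨_, A, hA, B, C, rfl⟩ := g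
    simp [blockMatrix, A.2, C.2]⟩
  map_one' := by
    apply Subtype.ext
    change (1 : Matrix (Idx k n) (Idx k n) ℤ).toBlocks₁₁ = 1
    ext i j
    simp [Matrix.toBlocks₁₁, Matrix.one_apply]
  map_mul' := by
    rintro ⟨_, A, hA, B, C, rfl⟩ ⟨_, A', hA', B', C', rfl⟩
    apply Subtype.ext
    change (blockMatrix A B C 0 0 * blockMatrix A' B' C' 0 0).1.toBlocks₁₁ =
      (blockMatrix A B C 0 0).1.toBlocks₁₁ * (blockMatrix A' B' C' 0 0).1.toBlocks₁₁
    rw [blockMatrix_mul]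
    simp [blockMatrix, Matrix.fromBlocks_multiply]

/-- Under the identification of `ℤ^k × ℤ^n` with `H`, the conjugation action of `Γ` on `H` is
the linear action of the upper left corner. -/
theorem conj_translation (g : groupΓ n Λ) (v : Fin k → ℤ) (w : Fin n → ℤ) :
    g.1 * blockMatrix 1 0 1 v w * g.1⁻¹ =
      blockMatrix 1 0 1 (fun i => ((corner g).1 *ᵥ Sum.elim v w) (Sum.inl i))
        (fun i => ((corner g).1 *ᵥ Sum.elim v w) (Sum.inr i)) := by
  obtain ⟨_, A, hA, B, C, rfl⟩ := g
  rw [mul_inv_eq_iff_eq_mul]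
  have hc : (corner (⟨_, A, hA, B, C, rfl⟩ : groupΓ n Λ)).1 =
      Matrix.fromBlocks A.1 B 0 C.1 := Matrix.toBlocks_fromBlocks₁₁ ..
  rw [hc]
  simp only [blockMatrix_mul, Matrix.fromBlocks_mulVec]
  congr 1 <;> simp <;> rfl

/-- The action of `Γ` on the dual torus `𝕋^{k+n}` of `H ≅ ℤ^{k+n}` that is dual to the conjugation
action of `Γ` on `H`. -/
instance : MulAction (groupΓ n Λ) (UnitAddTorus (Fin k ⊕ Fin n)) :=
  MulAction.compHom _ (corner (n := n) (Λ := Λ))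

theorem groupΓ_smul_def (g : groupΓ n Λ) (x : UnitAddTorus (Fin k ⊕ Fin n)) :
    g • x = corner g • x := rfl

instance : MeasurableConstSMul (groupΓ n Λ) (UnitAddTorus (Fin k ⊕ Fin n)) :=
  ⟨fun g => measurable_const_smul (corner g)⟩

instance : SMulInvariantMeasure (groupΓ n Λ) (UnitAddTorus (Fin k ⊕ Fin n))
    (torusMeasure (Fin k ⊕ Fin n)) :=
  ⟨fun g _ hs => measure_preimage_smul_of_nullMeasurableSet hs.nullMeasurableSet (corner g)⟩

/-- `Γ` is a discrete group. -/
instance : MeasurableSpace (groupΓ n Λ) := ⊤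

instance : DiscreteMeasurableSpace (groupΓ n Λ) := ⟨fun _ => trivial⟩

end Groups

end RigidActions

end

open RigidActions

universe u

/-!
# Rigid actions on tori that are not strongly ergodic

**Relative property (T).** Let a unitary representation of a group containing `ℤ² ⋊ SL(2, ℤ)` have
an almost invariant unit vector `ξ`. The spectral measure of `ξ` for the restriction to `ℤ²` lives
on the dual torus `𝕋²`, is concentrated near `0`, and is almost invariant under the elementary
matrices. A cone argument in the plane (`measureReal_compl_zero_le`) shows that nearly all of its
mass sits at `0`, which bounds the displacement of `ξ` by *all* of `ℤ²` at once
(`norm_translation_sub_sq_le`). In `H₂`, the rows and columns of `M_{k,n}(ℤ)` and `ℤ^n` lie in such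
copies of `ℤ²`, and the translations in `ℤ^k` are commutators of the two, so `H₁` moves `ξ` by a
uniformly small amount; the element of smallest norm in the closed convex hull of its orbit is the
required invariant vector.

**Rigidity.** The crossed product contains `G = H ⋊ Γ` as unitaries, the elements of `H` being the
characters of the torus. Conjugation by them is a unitary representation of `G` on any bimodule, so
an almost central vector is close to one that commutes with the characters. Commuting with the
characters is the same as commuting with `L^∞`: left and right multiplication are normal, hence on
`L^∞` their coefficients are integrals against `L¹` functions, and these are determined by their
Fourier coefficients (`normal_eq_of_mFourier`).

**Ergodicity and freeness.** By Parseval's identity an action by automorphisms of a torus is ergodic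
exactly when the dual orbits of non-zero characters are infinite (`ergodicSMul_torus_iff`); an orbit
of `Γ` can only be finite if it consists of characters of `ℤ^k`. A non-trivial automorphism fixes
almost no point, as the kernel of a non-trivial character is a null set.

**Strong ergodicity.** If `S ⊆ 𝕋^{k+n}` is almost invariant, then the squared Fourier coefficients
of its indicator function are almost invariant under the elementary matrices of `SL(n, ℤ)`. The cone
argument, now on the lattice `ℤ²`, shows that they are concentrated on the characters of `ℤ^k`
(`massMeasure_torusCoeff_le`), that is, `S` is close to the preimage of a subset of `𝕋^k`. Hence
strong ergodicity on `𝕋^{k+n}` and on `𝕋^k` are equivalent.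

**The example.** A finite orbit of `A` on `ℤ^k \ {0}` would give an eigenvalue that is a root of
unity, so `A^ℤ` acts ergodically on `𝕋^k`. It does not act strongly ergodically: the unions of long
runs of translates of a small set are almost invariant, and their measure grows from nearly zero to
one in small steps (`exists_almost_invariant_of_zpowers`).
-/

open MeasureTheory Filter Topology
open scoped ENNReal Matrix

noncomputable section

namespace RigidActions

/-! ### Continuous functional calculus for commuting unitaries -/

section JointFunctionalCalculus

open UnitAddTorus WeakDual

theorem mFourier_eq_prod_zpow {ι : Type*} [Fintype ι] (v : ι → ℤ) (x : UnitAddTorus ι) :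
    mFourier v x = ((∏ i, AddCircle.toCircle (x i) ^ v i : Circle) : ℂ) := by
  simp only [mFourier, ContinuousMap.coe_mk, fourier_apply, AddCircle.toCircle_zsmul]
  exact (map_prod Circle.coeHom (fun i => AddCircle.toCircle (x i) ^ v i) Finset.univ).symm

/-- The commutative case of `exists_starAlgHom_mFourier`: a character of the algebra restricts to
a character of `ℤ^ι`, that is, to a point of the torus, and the functional calculus is the
composition with this map followed by the inverse of the Gelfand transform. -/
theorem exists_starAlgHom_mFourier_of_comm {ι A : Type*} [Fintype ι] [CommCStarAlgebra A]
    (T : Multiplicative (ι → ℤ) →* unitary A) :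
    ∃ S : C(UnitAddTorus ι, ℂ) →⋆ₐ[ℂ] A, ∀ v, S (mFourier v) = T (.ofAdd v) := by
  classical
  have hnorm : ∀ (φ : characterSpace ℂ A) (u : unitary A), ‖φ (u : A)‖ = 1 := fun φ u => by
    have h : star (φ (u : A)) * φ (u : A) = 1 := by
      rw [← map_star, ← map_mul, Unitary.coe_star_mul_self, map_one]
    exact CStarRing.norm_of_mem_unitary (Unitary.mem_iff.2 ⟨h, by rw [mul_comm]; exact h⟩)
  let χ : characterSpace ℂ A → Multiplicative (ι → ℤ) →* Circle := fun φ =>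
    { toFun := fun v => ⟨φ (T v : A), mem_sphere_zero_iff_norm.2 (hnorm φ _)⟩
      map_one' := by ext; simp
      map_mul' := fun v w => by
        ext
        change φ (T (v * w) : A) = φ (T v : A) * φ (T w : A)
        simp }
  have h1 : (1 : ℝ) ≠ 0 := one_ne_zero
  let θ : C(characterSpace ℂ A, UnitAddTorus ι) :=
    { toFun := fun φ i => (AddCircle.homeomorphCircle h1).symm (χ φ (.ofAdd (Pi.single i 1)))
      continuous_toFun := by
        refine continuous_pi fun i => (Homeomorph.continuous _).comp ?_
        exact Continuous.subtype_mk
          (gelfandStarTransform A (T (.ofAdd (Pi.single i 1)) : A)).continuous _ }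
  have hθ : ∀ φ i, AddCircle.toCircle (θ φ i) = χ φ (.ofAdd (Pi.single i 1)) := fun φ i => by
    rw [← AddCircle.homeomorphCircle_apply h1]
    exact Homeomorph.apply_symm_apply _ _
  refine ⟨((gelfandStarTransform A).symm : C(characterSpace ℂ A, ℂ) →⋆ₐ[ℂ] A).comp
    (θ.compStarAlgHom' ℂ ℂ), fun v => ?_⟩
  have key : θ.compStarAlgHom' ℂ ℂ (mFourier v) = gelfandStarTransform A (T (.ofAdd v) : A) := by
    ext φ
    change mFourier v (θ φ) = (χ φ (.ofAdd v) : ℂ)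
    have hv : (Multiplicative.ofAdd v) =
        ∏ i, (Multiplicative.ofAdd (Pi.single i 1 : ι → ℤ)) ^ v i := by
      apply Multiplicative.toAdd.injective
      simp [← Pi.single_smul]
      exact (Finset.univ_sum_single v).symm
    rw [hv, map_prod, mFourier_eq_prod_zpow]
    simp only [map_zpow, hθ]
  change (gelfandStarTransform A).symm (θ.compStarAlgHom' ℂ ℂ (mFourier v)) = _
  rw [key, StarAlgEquiv.symm_apply_apply]

/-- Continuous functional calculus for a commuting family of unitaries: a unitary representation
`T` of `ℤ^ι` in a C⋆-algebra extends to the continuous functions on the dual torus. It comes from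
the Gelfand transform of the commutative C⋆-algebra generated by the range of `T`. -/
theorem exists_starAlgHom_mFourier {ι B : Type*} [Fintype ι] [CStarAlgebra B]
    (T : Multiplicative (ι → ℤ) →* unitary B) :
    ∃ S : C(UnitAddTorus ι, ℂ) →⋆ₐ[ℂ] B, ∀ v, S (mFourier v) = T (.ofAdd v) := by
  have hcomm : ∀ a ∈ Set.range fun v => (T v : B), ∀ b ∈ Set.range fun v => (T v : B),
      a * b = b * a := by
    rintro _ ⟨v, rfl⟩ _ ⟨w, rfl⟩
    change ((T v * T w : unitary B) : B) = (T w * T v : unitary B)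
    rw [← map_mul, ← map_mul, mul_comm]
  have hstar : ∀ a ∈ Set.range fun v => (T v : B), ∀ b ∈ Set.range fun v => (T v : B),
      a * star b = star b * a := by
    rintro _ ⟨v, rfl⟩ _ ⟨w, rfl⟩
    refine hcomm _ ⟨v, rfl⟩ _ ⟨w⁻¹, ?_⟩
    simp [map_inv, ← Unitary.star_eq_inv]
  let A₀ : StarSubalgebra ℂ B := StarAlgebra.adjoin ℂ (Set.range fun v => (T v : B))
  have hA₀ : ∀ x y : A₀, x * y = y * x := by
    have := StarAlgebra.isMulCommutative_adjoin ℂ hcomm hstar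
    exact fun x y => this.1.1 x y
  let A : StarSubalgebra ℂ B := A₀.topologicalClosure
  have hA : IsClosed (A : Set B) := A₀.isClosed_topologicalClosure
  let _ : CommRing A := A₀.commRingTopologicalClosure hA₀
  let _ : CommCStarAlgebra A := { StarSubalgebra.cstarAlgebra A with mul_comm := mul_comm }
  have hTA : ∀ v, (T v : B) ∈ A := fun v =>
    A₀.le_topologicalClosure (StarAlgebra.subset_adjoin ℂ _ ⟨v, rfl⟩)
  let T' : Multiplicative (ι → ℤ) →* unitary A :=
    { toFun := fun v => ⟨⟨T v, hTA v⟩, by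
        rw [Unitary.mem_iff]
        have h := Unitary.mem_iff.1 (T v).2
        exact ⟨Subtype.ext h.1, Subtype.ext h.2⟩⟩
      map_one' := by ext; simp
      map_mul' := fun v w => by ext; simp }
  obtain ⟨S, hS⟩ := exists_starAlgHom_mFourier_of_comm T'
  exact ⟨A.subtype.comp S, fun v => congrArg Subtype.val (hS v)⟩

end JointFunctionalCalculus

/-! ### Spectral measures of vectors -/

section SpectralMeasure

variable {X : Type*} [TopologicalSpace X]

/-- A real continuous function, seen as a complex one. -/
def complexify (f : C(X, ℝ)) : C(X, ℂ) :=
  (⟨Complex.ofReal, Complex.continuous_ofReal⟩ : C(ℝ, ℂ)).comp f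

theorem complexify_apply (f : C(X, ℝ)) (x : X) : complexify f x = (f x : ℂ) := rfl

variable {E : Type*} [NormedAddCommGroup E] [InnerProductSpace ℂ E]
  [CompleteSpace E]

theorem inner_apply_star_mul_self (S : C(X, ℂ) →⋆ₐ[ℂ] (E →L[ℂ] E)) (ξ : E) (h : C(X, ℂ)) :
    inner ℂ ξ (S (star h * h) ξ) = (‖S h ξ‖ : ℂ) ^ 2 := by
  rw [map_mul, map_star, ContinuousLinearMap.mul_def, ContinuousLinearMap.comp_apply,
    ContinuousLinearMap.star_eq_adjoint, ContinuousLinearMap.adjoint_inner_right,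
    inner_self_eq_norm_sq_to_K]
  rfl

variable [MeasurableSpace X]

/-- The spectral measure of a vector for a representation of `C(X)`. -/
theorem exists_spectral_measure [CompactSpace X] [T2Space X] [BorelSpace X]
    (S : C(X, ℂ) →⋆ₐ[ℂ] (E →L[ℂ] E)) (ξ : E) :
    ∃ μ : Measure X, IsFiniteMeasure μ ∧
      ∀ f : C(X, ℝ), ∫ x, f x ∂μ = (inner ℂ ξ (S (complexify f) ξ)).re := by
  let Φ : CompactlySupportedContinuousMap X ℝ →ₗ[ℝ] ℝ :=
    { toFun := fun f => (inner ℂ ξ (S (complexify f) ξ)).re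
      map_add' := fun f g => by
        have : complexify ((f + g : CompactlySupportedContinuousMap X ℝ) : C(X, ℝ)) =
          complexify f + complexify g := by ext x; simp [complexify_apply]
        rw [this, map_add, add_apply, inner_add_right, Complex.add_re]
      map_smul' := fun c f => by
        have : complexify ((c • f : CompactlySupportedContinuousMap X ℝ) : C(X, ℝ)) =
          (c : ℂ) • complexify f := by ext x; simp [complexify_apply]
        rw [this, map_smul, smul_apply, inner_smul_right]
        simp }
  have hpos : ∀ f : CompactlySupportedContinuousMap X ℝ, 0 ≤ f → 0 ≤ Φ f := fun f hf => by
    let g : C(X, ℝ) := ⟨fun x => Real.sqrt (f x), f.continuous.sqrt⟩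
    have hg : complexify f = star (complexify g) * complexify g := by
      ext x
      simp only [complexify_apply, ContinuousMap.mul_apply, ContinuousMap.star_apply,
        RCLike.star_def, Complex.conj_ofReal, ← Complex.ofReal_mul]
      exact congrArg _ (Real.mul_self_sqrt (hf x)).symm
    change 0 ≤ (inner ℂ ξ (S (complexify f) ξ)).re
    rw [hg, inner_apply_star_mul_self, ← Complex.ofReal_pow, Complex.ofReal_re]
    positivity
  let Λ := PositiveLinearMap.mk₀ Φ hpos
  refine ⟨RealRMK.rieszMeasure Λ, inferInstance, fun f => ?_⟩
  exact RealRMK.integral_rieszMeasure Λ (CompactlySupportedContinuousMap.continuousMapEquiv f)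

theorem integral_norm_sq_spectral_measure {S : C(X, ℂ) →⋆ₐ[ℂ] (E →L[ℂ] E)} {ξ : E}
    {μ : Measure X} (hμ : ∀ f : C(X, ℝ), ∫ x, f x ∂μ = (inner ℂ ξ (S (complexify f) ξ)).re)
    (h : C(X, ℂ)) : ∫ x, ‖h x‖ ^ 2 ∂μ = ‖S h ξ‖ ^ 2 := by
  let f : C(X, ℝ) := ⟨fun x => ‖h x‖ ^ 2, by fun_prop⟩
  have hf : complexify f = star h * h := by
    ext x
    simp [complexify_apply, f, Complex.conj_mul']
  have := hμ f
  rw [hf, inner_apply_star_mul_self, ← Complex.ofReal_pow, Complex.ofReal_re] at this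
  exact this

/-- If `u` implements the map `m` of the spectrum and almost fixes the unit vector `ξ`, then the
spectral measure of `ξ` is almost invariant under `m`. -/
theorem integral_comp_spectral_measure_le [CompactSpace X]
    {S : C(X, ℂ) →⋆ₐ[ℂ] (E →L[ℂ] E)} {ξ : E} (hξ : ‖ξ‖ = 1)
    {μ : Measure X} (hμ : ∀ f : C(X, ℝ), ∫ x, f x ∂μ = (inner ℂ ξ (S (complexify f) ξ)).re)
    (u : E ≃ₗᵢ[ℂ] E) (m : C(X, X)) (hu : ∀ (f : C(X, ℂ)) (η : E), S (f.comp m) (u η) = u (S f η))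
    {f : C(X, ℝ)} (hf : ‖f‖ ≤ 1) :
    ∫ x, f (m x) ∂μ ≤ ∫ x, f x ∂μ + 2 * ‖u ξ - ξ‖ := by
  have hfc : ‖complexify f‖ ≤ 1 := by
    rw [ContinuousMap.norm_le _ zero_le_one]
    intro x
    rw [complexify_apply, Complex.norm_real]
    exact (f.norm_coe_le_norm x).trans hf
  have hS : ∀ η : E, ‖S (complexify f) η‖ ≤ ‖η‖ := fun η =>
    calc ‖S (complexify f) η‖ ≤ ‖S (complexify f)‖ * ‖η‖ := ContinuousLinearMap.le_opNorm _ _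
      _ ≤ 1 * ‖η‖ := by
        gcongr
        exact (NonUnitalStarAlgHom.norm_apply_le S _).trans hfc
      _ = ‖η‖ := one_mul _
  set η := u.symm ξ with hη
  have huη : u η = ξ := by simp [hη]
  have hη1 : ‖η‖ = 1 := by rw [hη, LinearIsometryEquiv.norm_map, hξ]
  have hd : ‖η - ξ‖ = ‖u ξ - ξ‖ := by
    rw [← u.norm_map, map_sub, huη, norm_sub_rev]
  have h1 := hμ (f.comp m)
  have h2 : complexify (f.comp m) = (complexify f).comp m := rfl
  have h3 : inner ℂ ξ (S ((complexify f).comp m) ξ) = inner ℂ η (S (complexify f) η) := by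
    rw [← huη, hu, LinearIsometryEquiv.inner_map_map]
  rw [h2, h3] at h1
  change ∫ x, f.comp m x ∂μ ≤ _
  rw [h1, hμ f, ← sub_le_iff_le_add', ← Complex.sub_re]
  have h4 : inner ℂ η (S (complexify f) η) - inner ℂ ξ (S (complexify f) ξ) =
      inner ℂ (η - ξ) (S (complexify f) η) + inner ℂ ξ (S (complexify f) (η - ξ)) := by
    rw [inner_sub_left, map_sub, inner_sub_right]; ring
  rw [h4]
  calc _ ≤ ‖inner ℂ (η - ξ) (S (complexify f) η) + inner ℂ ξ (S (complexify f) (η - ξ))‖ :=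
        Complex.re_le_norm _
    _ ≤ ‖η - ξ‖ * ‖S (complexify f) η‖ + ‖ξ‖ * ‖S (complexify f) (η - ξ)‖ :=
        (norm_add_le _ _).trans (add_le_add (norm_inner_le_norm _ _) (norm_inner_le_norm _ _))
    _ ≤ ‖η - ξ‖ * ‖η‖ + ‖ξ‖ * ‖η - ξ‖ := by gcongr <;> apply hS
    _ = 2 * ‖u ξ - ξ‖ := by rw [hη1, hξ, hd]; ring

end SpectralMeasure

/-- Comparison of two finite measures on closed sets, from a comparison on continuous functions. -/
theorem measureReal_le_of_integral_le {X : Type*} [TopologicalSpace X] [CompactSpace X]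
    [MeasurableSpace X] [BorelSpace X] [HasOuterApproxClosed X] {μ ν : Measure X}
    [IsFiniteMeasure μ] [IsFiniteMeasure ν] {c : ℝ}
    (h : ∀ f : C(X, ℝ), ‖f‖ ≤ 1 → ∫ x, f x ∂ν ≤ ∫ x, f x ∂μ + c) {F : Set X} (hF : IsClosed F) :
    ν.real F ≤ μ.real F + c := by
  let f : ℕ → C(X, ℝ) := fun n => ⟨fun x => (hF.apprSeq n x : ℝ), by fun_prop⟩
  have hf : ∀ n, ‖f n‖ ≤ 1 := fun n => (ContinuousMap.norm_le _ zero_le_one).2 fun x => by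
    change ‖(hF.apprSeq n x : ℝ)‖ ≤ 1
    simpa using HasOuterApproxClosed.apprSeq_apply_le_one hF n x
  have hint : ∀ (ρ : Measure X) [IsFiniteMeasure ρ], Tendsto (fun n => ∫ x, f n x ∂ρ) atTop
      (𝓝 (ρ.real F)) := fun ρ _ => by
    have := (ENNReal.tendsto_toReal (measure_ne_top ρ F)).comp
      (HasOuterApproxClosed.tendsto_lintegral_apprSeq hF ρ)
    refine this.congr fun n => ?_
    exact BoundedContinuousFunction.toReal_lintegral_coe_eq_integral _ ρ
  exact le_of_tendsto_of_tendsto' (hint ν) ((hint μ).add_const c) fun n => h _ (hf n)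

/-! ### Almost invariant measures on the two-dimensional torus -/

section Cones

/-- The covering map `ℝ² → 𝕋²`. -/
def torusCover (z : ℝ × ℝ) : UnitAddTorus (Fin 2) := ![(z.1 : UnitAddCircle), (z.2 : UnitAddCircle)]

theorem continuous_torusCover : Continuous torusCover := by
  refine continuous_pi fun i => ?_
  fin_cases i
  · exact (AddCircle.continuous_mk' 1).comp continuous_fst
  · exact (AddCircle.continuous_mk' 1).comp continuous_snd

/-- The square `[-r, r]²`. -/
def square (r : ℝ) : Set (ℝ × ℝ) := {z | |z.1| ≤ r ∧ |z.2| ≤ r}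

theorem isCompact_square (r : ℝ) : IsCompact (square r) := by
  have : square r = Set.Icc (-r) r ×ˢ Set.Icc (-r) r := by
    ext z; simp only [square, abs_le, Set.mem_ofPred_eq, Set.mem_prod, Set.mem_Icc]
  rw [this]
  exact isCompact_Icc.prod isCompact_Icc

theorem coe_addCircle_inj {s t : ℝ} (h : (s : UnitAddCircle) = t) (hst : |s| + |t| < 1) :
    s = t := by
  rw [← sub_eq_zero, ← AddCircle.coe_sub, AddCircle.coe_eq_zero_iff] at h
  obtain ⟨n, hn⟩ := h
  have hlt : |(n : ℝ)| < 1 := by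
    have : (n : ℝ) = s - t := by simpa using hn
    rw [this]
    exact (abs_sub s t).trans_lt hst
  have : n = 0 := by
    rw [← Int.abs_lt_one_iff]; exact_mod_cast hlt
  subst this
  simp at hn
  linarith

theorem torusCover_inj {r r' : ℝ} (hr : r + r' < 1) {z w : ℝ × ℝ} (hz : z ∈ square r)
    (hw : w ∈ square r') (h : torusCover z = torusCover w) : z = w := by
  have h1 := congrFun h 0
  have h2 := congrFun h 1
  exact Prod.ext (coe_addCircle_inj h1 ((add_le_add hz.1 hw.1).trans_lt hr))
    (coe_addCircle_inj h2 ((add_le_add hz.2 hw.2).trans_lt hr))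

/-- A linear map that takes the cone `K` into the smaller cone `K'` and almost preserves a measure
concentrated near `0` shows that the measure almost vanishes on `K \ K'`. -/
theorem measureReal_cone_le {μ : Measure (UnitAddTorus (Fin 2))} [IsFiniteMeasure μ] {c r : ℝ}
    (hr : 4 * r < 1) {g : UnitAddTorus (Fin 2) → UnitAddTorus (Fin 2)} {G : ℝ × ℝ → ℝ × ℝ}
    (hG : ∀ z, torusCover (G z) = g (torusCover z)) (hGr : ∀ z ∈ square r, G z ∈ square (3 * r))
    {K K' : Set (ℝ × ℝ)} (hK' : IsClosed K') (hKK' : ∀ z ∈ K, G z ∈ K')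
    (hg : ∀ F, IsClosed F → μ.real (g ⁻¹' F) ≤ μ.real F + c) :
    μ.real (torusCover '' (K ∩ square r)) ≤
      μ.real (torusCover '' (K' ∩ square r)) + c + μ.real (torusCover '' square r)ᶜ := by
  set F := torusCover '' (K' ∩ square (3 * r)) with hF
  have hFc : IsClosed F :=
    (((isCompact_square _).inter_left hK').image continuous_torusCover).isClosed
  have h1 : torusCover '' (K ∩ square r) ⊆ g ⁻¹' F := by
    rintro _ ⟨z, hz, rfl⟩
    exact ⟨G z, ⟨hKK' z hz.1, hGr z hz.2⟩, hG z⟩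
  have h2 : F ⊆ torusCover '' (K' ∩ square r) ∪ (torusCover '' square r)ᶜ := by
    rintro _ ⟨z, hz, rfl⟩
    by_cases h : torusCover z ∈ torusCover '' square r
    · obtain ⟨w, hw, hwz⟩ := h
      have : w = z := torusCover_inj (by linarith) hw hz.2 hwz
      subst this
      exact Or.inl ⟨w, ⟨hz.1, hw⟩, rfl⟩
    · exact Or.inr h
  calc μ.real (torusCover '' (K ∩ square r)) ≤ μ.real (g ⁻¹' F) := measureReal_mono h1
    _ ≤ μ.real F + c := hg F hFc
    _ ≤ μ.real (torusCover '' (K' ∩ square r)) + μ.real (torusCover '' square r)ᶜ + c := by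
      gcongr
      exact (measureReal_mono h2).trans (measureReal_union_le _ _)
    _ = _ := by ring

theorem measureReal_cone_diff_le {μ : Measure (UnitAddTorus (Fin 2))} [IsFiniteMeasure μ] {c r : ℝ}
    (hr : 4 * r < 1) {g : UnitAddTorus (Fin 2) → UnitAddTorus (Fin 2)} {G : ℝ × ℝ → ℝ × ℝ}
    (hG : ∀ z, torusCover (G z) = g (torusCover z)) (hGr : ∀ z ∈ square r, G z ∈ square (3 * r))
    {K K' : Set (ℝ × ℝ)} (hK' : IsClosed K') (hKK' : ∀ z ∈ K, G z ∈ K') (hsub : K' ⊆ K)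
    (hg : ∀ F, IsClosed F → μ.real (g ⁻¹' F) ≤ μ.real F + c) :
    μ.real (torusCover '' (K ∩ square r) \ torusCover '' (K' ∩ square r)) ≤
      c + μ.real (torusCover '' square r)ᶜ := by
  have h := measureReal_cone_le hr hG hGr hK' hKK' hg
  rw [measureReal_sdiff (Set.image_mono (Set.inter_subset_inter_left _ hsub))
    (((isCompact_square _).inter_left hK').image continuous_torusCover).measurableSet]
  linarith

/-- The shear `(x, y) ↦ (x, y + a x)` of the torus. -/
def shearSnd (a : ℤ) (x : UnitAddTorus (Fin 2)) : UnitAddTorus (Fin 2) := ![x 0, x 1 + a • x 0]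

/-- The shear `(x, y) ↦ (x + a y, y)` of the torus. -/
def shearFst (a : ℤ) (x : UnitAddTorus (Fin 2)) : UnitAddTorus (Fin 2) := ![x 0 + a • x 1, x 1]

theorem continuous_shearSnd (a : ℤ) : Continuous (shearSnd a) := by
  refine continuous_pi fun i => ?_
  fin_cases i <;> simp [shearSnd] <;> fun_prop

theorem continuous_shearFst (a : ℤ) : Continuous (shearFst a) := by
  refine continuous_pi fun i => ?_
  fin_cases i <;> simp [shearFst] <;> fun_prop

theorem shearSnd_add (a b : ℤ) (x : UnitAddTorus (Fin 2)) :
    shearSnd a (shearSnd b x) = shearSnd (a + b) x := by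
  funext i
  fin_cases i
  · rfl
  · simp [shearSnd, add_smul]; abel

theorem shearFst_add (a b : ℤ) (x : UnitAddTorus (Fin 2)) :
    shearFst a (shearFst b x) = shearFst (a + b) x := by
  funext i
  fin_cases i
  · simp [shearFst, add_smul]; abel
  · rfl

/-- There is no measure on `ℝ² \ {0}` that is almost invariant under the elementary matrices:
a finite measure on the torus that is concentrated near `0` and almost invariant under the shears
is almost concentrated at `0`. The squares of the shears map each of the cones `{xy ≥ 0}` and
`{xy ≤ 0}` into two smaller cones that meet only at `0`, so that the differences, which have small
measure, cover the complement of `0`. -/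
theorem measureReal_compl_zero_le {μ : Measure (UnitAddTorus (Fin 2))} [IsFiniteMeasure μ]
    {c r : ℝ} (hr : 4 * r < 1)
    (h₁ : ∀ a : ℤ, |a| = 1 → ∀ F, IsClosed F → μ.real (shearSnd a ⁻¹' F) ≤ μ.real F + c)
    (h₂ : ∀ a : ℤ, |a| = 1 → ∀ F, IsClosed F → μ.real (shearFst a ⁻¹' F) ≤ μ.real F + c) :
    μ.real {0}ᶜ ≤ 8 * c + 5 * μ.real (torusCover '' square r)ᶜ := by
  set w := μ.real (torusCover '' square r)ᶜ with hw
  let K : ℤ → Set (ℝ × ℝ) := fun a => {z | 0 ≤ (a : ℝ) * (z.1 * z.2)}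
  let K₁ : ℤ → Set (ℝ × ℝ) := fun a => {z | 0 ≤ (a : ℝ) * (z.1 * z.2) ∧ 2 * |z.1| ≤ |z.2|}
  let K₂ : ℤ → Set (ℝ × ℝ) := fun a => {z | 0 ≤ (a : ℝ) * (z.1 * z.2) ∧ 2 * |z.2| ≤ |z.1|}
  have hK₁ : ∀ a, IsClosed (K₁ a) := fun a => by
    simp only [K₁, Set.ofPred_and]
    exact (isClosed_le (by fun_prop) (by fun_prop)).inter (isClosed_le (by fun_prop) (by fun_prop))
  have hK₂ : ∀ a, IsClosed (K₂ a) := fun a => by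
    simp only [K₂, Set.ofPred_and]
    exact (isClosed_le (by fun_prop) (by fun_prop)).inter (isClosed_le (by fun_prop) (by fun_prop))
  -- for `|a| = 1`, adding `2 a s` to `t` with `0 ≤ a s t` increases `|t|` by `2 |s|`
  have habs : ∀ a : ℤ, |a| = 1 → ∀ s t : ℝ, 0 ≤ (a : ℝ) * (s * t) →
      0 ≤ (a : ℝ) * (s * (t + (2 * a : ℤ) * s)) ∧ 2 * |s| ≤ |t + (2 * a : ℤ) * s| := by
    intro a ha s t h
    have ha2 : (a : ℝ) * a = 1 := by
      have : a * a = 1 := by rw [← abs_mul_abs_self, ha, mul_one]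
      exact_mod_cast this
    refine ⟨?_, ?_⟩
    · have : (a : ℝ) * (s * (t + (2 * a : ℤ) * s)) = a * (s * t) + 2 * (a * a) * (s * s) := by
        push_cast; ring
      rw [this, ha2]
      nlinarith [mul_self_nonneg s]
    · rw [← abs_two, ← abs_mul, ← sq_le_sq]
      push_cast
      nlinarith [sq_nonneg t]
  have hsq : ∀ a : ℤ, |a| = 1 → ∀ s t : ℝ, |s| ≤ r → |t| ≤ r → |t + (2 * a : ℤ) * s| ≤ 3 * r := by
    intro a ha s t hs ht
    have ha' : |(a : ℝ)| = 1 := by exact_mod_cast ha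
    calc |t + (2 * a : ℤ) * s| ≤ |t| + |(2 * a : ℤ) * s| := abs_add_le _ _
      _ = |t| + 2 * |s| := by push_cast; rw [abs_mul, abs_mul, ha', abs_two]; ring
      _ ≤ 3 * r := by linarith
  have e₁ : ∀ a : ℤ, |a| = 1 → μ.real (torusCover '' (K a ∩ square r) \
      torusCover '' (K₁ a ∩ square r)) ≤ 2 * c + w := fun a ha => by
    refine measureReal_cone_diff_le (G := fun z => (z.1, z.2 + (2 * a : ℤ) * z.1))
      (g := shearSnd (2 * a)) hr (fun z => ?_) (fun z hz => ⟨?_, ?_⟩) (hK₁ a)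
      (fun z hz => habs a ha z.1 z.2 hz) (fun z hz => hz.1) fun F hF => ?_
    · funext i; fin_cases i <;> simp [torusCover, shearSnd, ← AddCircle.coe_zsmul]
    · exact hz.1.trans (by linarith [(abs_nonneg _).trans hz.1])
    · exact hsq a ha _ _ hz.1 hz.2
    · have : shearSnd (2 * a) ⁻¹' F = shearSnd a ⁻¹' (shearSnd a ⁻¹' F) := by
        ext x; simp [shearSnd_add, two_mul]
      rw [this]
      linarith [h₁ a ha _ (hF.preimage (continuous_shearSnd a)), h₁ a ha F hF]
  have e₂ : ∀ a : ℤ, |a| = 1 → μ.real (torusCover '' (K a ∩ square r) \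
      torusCover '' (K₂ a ∩ square r)) ≤ 2 * c + w := fun a ha => by
    refine measureReal_cone_diff_le (G := fun z => (z.1 + (2 * a : ℤ) * z.2, z.2))
      (g := shearFst (2 * a)) hr (fun z => ?_) (fun z hz => ⟨?_, ?_⟩) (hK₂ a)
      (fun z hz => ?_) (fun z hz => hz.1) fun F hF => ?_
    · funext i; fin_cases i <;> simp [torusCover, shearFst, ← AddCircle.coe_zsmul]
    · exact hsq a ha _ _ hz.2 hz.1
    · exact hz.2.trans (by linarith [(abs_nonneg _).trans hz.1])
    · have := habs a ha z.2 z.1 (by rw [mul_comm z.2]; exact hz)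
      exact ⟨by rw [mul_comm (_ + _)]; exact this.1, this.2⟩
    · have : shearFst (2 * a) ⁻¹' F = shearFst a ⁻¹' (shearFst a ⁻¹' F) := by
        ext x; simp [shearFst_add, two_mul]
      rw [this]
      linarith [h₂ a ha _ (hF.preimage (continuous_shearFst a)), h₂ a ha F hF]
  let D : ℤ → Set (UnitAddTorus (Fin 2)) := fun a =>
    (torusCover '' (K a ∩ square r) \ torusCover '' (K₁ a ∩ square r)) ∪
      (torusCover '' (K a ∩ square r) \ torusCover '' (K₂ a ∩ square r))
  have hD : ∀ a : ℤ, |a| = 1 → μ.real (D a) ≤ 2 * (2 * c + w) := fun a ha =>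
    (measureReal_union_le _ _).trans (by linarith [e₁ a ha, e₂ a ha])
  have hcone : ∀ a : ℤ, ∀ z ∈ square r, z ≠ 0 → 0 ≤ (a : ℝ) * (z.1 * z.2) → torusCover z ∈ D a := by
    intro a z hz hz0 hza
    by_cases h : 2 * |z.1| ≤ |z.2|
    · refine Or.inr ⟨⟨z, ⟨hza, hz⟩, rfl⟩, ?_⟩
      rintro ⟨y, ⟨hy, hyr⟩, hyz⟩
      have : y = z := torusCover_inj (by linarith [(abs_nonneg _).trans hz.1]) hyr hz hyz
      subst this
      have h2 := hy.2
      have : |y.1| = 0 := by linarith [abs_nonneg y.1, abs_nonneg y.2]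
      have h' : |y.2| = 0 := by linarith [abs_nonneg y.1, abs_nonneg y.2]
      exact hz0 (Prod.ext (abs_eq_zero.1 this) (abs_eq_zero.1 h'))
    · refine Or.inl ⟨⟨z, ⟨hza, hz⟩, rfl⟩, ?_⟩
      rintro ⟨y, ⟨hy, hyr⟩, hyz⟩
      have : y = z := torusCover_inj (by linarith [(abs_nonneg _).trans hz.1]) hyr hz hyz
      subst this
      exact h hy.2
  have hcov : ({0}ᶜ : Set (UnitAddTorus (Fin 2))) ⊆
      (D 1 ∪ D (-1)) ∪ (torusCover '' square r)ᶜ := by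
    intro x hx
    by_cases h : x ∈ torusCover '' square r
    · left
      obtain ⟨z, hz, rfl⟩ := h
      have hz0 : z ≠ 0 := by
        rintro rfl
        exact hx (by funext i; fin_cases i <;> simp [torusCover])
      rcases le_total 0 (z.1 * z.2) with h | h
      · exact Or.inl (hcone 1 z hz hz0 (by simpa using h))
      · exact Or.inr (hcone (-1) z hz hz0 (by simpa using h))
    · exact Or.inr h
  calc μ.real {0}ᶜ ≤ μ.real ((D 1 ∪ D (-1)) ∪ (torusCover '' square r)ᶜ) := measureReal_mono hcov
    _ ≤ μ.real (D 1) + μ.real (D (-1)) + w :=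
      (measureReal_union_le _ _).trans (add_le_add_left (measureReal_union_le _ _) _)
    _ ≤ 8 * c + 5 * w := by linarith [hD 1 (by simp), hD (-1) (by simp)]

end Cones

/-! ### Quantitative relative property (T) for `ℤ² < ℤ² ⋊ SL(2, ℤ)` -/

section Displacement

variable {G E : Type*} [Group G] [NormedAddCommGroup E] [InnerProductSpace ℂ E]
  (π : G →* (E ≃ₗᵢ[ℂ] E)) (ξ : E)

theorem norm_map_mul_sub_le (g h : G) :
    ‖π (g * h) ξ - ξ‖ ≤ ‖π g ξ - ξ‖ + ‖π h ξ - ξ‖ := by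
  have : π (g * h) ξ - ξ = π g (π h ξ - ξ) + (π g ξ - ξ) := by
    rw [map_mul, LinearIsometryEquiv.coe_mul, Function.comp_apply, map_sub]; abel
  rw [this, add_comm ‖π g ξ - ξ‖]
  exact (norm_add_le _ _).trans_eq (by rw [LinearIsometryEquiv.norm_map])

theorem norm_map_inv_sub (g : G) : ‖π g⁻¹ ξ - ξ‖ = ‖π g ξ - ξ‖ := by
  rw [← (π g).norm_map, map_sub, ← Function.comp_apply (f := π g), ← LinearIsometryEquiv.coe_mul,
    ← map_mul, mul_inv_cancel, map_one, LinearIsometryEquiv.coe_one, id, norm_sub_rev]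

theorem norm_map_prod_sub_le {ι A : Type*} [CommMonoid A] (τ : A →* G) (s : Finset ι) (f : ι → A) :
    ‖π (τ (∏ i ∈ s, f i)) ξ - ξ‖ ≤ ∑ i ∈ s, ‖π (τ (f i)) ξ - ξ‖ := by
  classical
  induction s using Finset.induction_on with
  | empty => simp
  | insert i s hi ih =>
    rw [Finset.prod_insert hi, Finset.sum_insert hi, map_mul]
    exact (norm_map_mul_sub_le π ξ _ _).trans (by gcongr)

end Displacement

section RelativeT

open UnitAddTorus

theorem coe_toCircle_sub_one_norm_ge (y : UnitAddCircle) :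
    4 * ‖y‖ ≤ ‖(AddCircle.toCircle y : ℂ) - 1‖ := by
  obtain ⟨t, ht, rfl⟩ : ∃ t : ℝ, |t| = ‖y‖ ∧ (t : UnitAddCircle) = y := by
    induction y using QuotientAddGroup.induction_on with
    | H t =>
      refine ⟨t - round t, (UnitAddCircle.norm_eq).symm, ?_⟩
      rw [AddCircle.coe_sub, sub_eq_self, AddCircle.coe_eq_zero_iff]
      exact ⟨round t, by simp⟩
  have ht2 : |t| ≤ 1 / 2 := by
    have := AddCircle.norm_le_half_period (p := 1) (x := (t : UnitAddCircle)) one_ne_zero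
    rw [ht]; simpa using this
  rw [← ht, AddCircle.toCircle_apply_mk, Circle.coe_exp]
  have h1 : ((2 * Real.pi / 1 * t : ℝ) : ℂ) * Complex.I =
      Complex.I * ((2 * (Real.pi * t) : ℝ) : ℂ) := by
    push_cast; ring
  rw [h1, Complex.norm_exp_I_mul_ofReal_sub_one, Real.norm_eq_abs, abs_mul, abs_two,
    mul_div_cancel_left₀ _ two_ne_zero]
  have h2 := Real.mul_abs_le_abs_sin (x := Real.pi * t) (by
    rw [abs_mul, abs_of_pos Real.pi_pos]; nlinarith [Real.pi_pos])
  rw [abs_mul, abs_of_pos Real.pi_pos, ← mul_assoc, div_mul_cancel₀ _ Real.pi_ne_zero] at h2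
  linarith

theorem measureReal_compl_square_le {E : Type*} [NormedAddCommGroup E] [InnerProductSpace ℂ E]
    [CompleteSpace E] {S : C(UnitAddTorus (Fin 2), ℂ) →⋆ₐ[ℂ] (E →L[ℂ] E)} {ξ : E}
    {μ : Measure (UnitAddTorus (Fin 2))} [IsFiniteMeasure μ]
    (hμ : ∀ f : C(UnitAddTorus (Fin 2), ℝ),
      ∫ x, f x ∂μ = (inner ℂ ξ (S (complexify f) ξ)).re) {δ : ℝ}
    (hδ : ∀ i, ‖S (mFourier (Pi.single i 1)) ξ - ξ‖ ≤ δ) :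
    μ.real (torusCover '' square (1 / 8))ᶜ ≤ 8 * δ ^ 2 := by
  let A : Fin 2 → Set (UnitAddTorus (Fin 2)) := fun i =>
    {x | 1 / 4 ≤ ‖(mFourier (Pi.single i 1) - 1 : C(UnitAddTorus (Fin 2), ℂ)) x‖ ^ 2}
  have hA : ∀ i, μ.real (A i) ≤ 4 * δ ^ 2 := fun i => by
    have h1 := mul_meas_ge_le_integral_of_nonneg (μ := μ)
      (f := fun x => ‖(mFourier (Pi.single i 1) - 1 : C(UnitAddTorus (Fin 2), ℂ)) x‖ ^ 2)
      (Eventually.of_forall fun x => by positivity)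
      ((by fun_prop : Continuous _).integrable_of_hasCompactSupport
        (HasCompactSupport.of_compactSpace _)) (1 / 4)
    rw [integral_norm_sq_spectral_measure hμ, map_sub, map_one] at h1
    have h2 : ‖(S (mFourier (Pi.single i 1)) - 1) ξ‖ ^ 2 ≤ δ ^ 2 :=
      pow_le_pow_left₀ (norm_nonneg _) (hδ i) 2
    change 1 / 4 * μ.real (A i) ≤ _ at h1
    linarith
  have hsub : (torusCover '' square (1 / 8))ᶜ ⊆ A 0 ∪ A 1 := by
    intro x hx
    by_contra hxA
    apply hx
    have hsmall : ∀ i, ∃ t : ℝ, |t| ≤ 1 / 8 ∧ (t : UnitAddCircle) = x i := fun i => by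
      have hi : ‖(AddCircle.toCircle (x i) : ℂ) - 1‖ ^ 2 < 1 / 4 := by
        have : x ∉ A i := fun h => hxA (by fin_cases i; exacts [Or.inl h, Or.inr h])
        simpa [A, mFourier_single, fourier_one] using this
      have hi' : ‖x i‖ ≤ 1 / 8 := by
        nlinarith [coe_toCircle_sub_one_norm_ge (x i), norm_nonneg (x i)]
      generalize x i = y at hi'
      induction y using QuotientAddGroup.induction_on with
      | H t =>
        refine ⟨t - round t, (UnitAddCircle.norm_eq).symm.trans_le hi', ?_⟩
        rw [AddCircle.coe_sub, sub_eq_self, AddCircle.coe_eq_zero_iff]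
        exact ⟨round t, by simp⟩
    obtain ⟨s, hs, hs'⟩ := hsmall 0
    obtain ⟨t, ht, ht'⟩ := hsmall 1
    exact ⟨(s, t), ⟨hs, ht⟩, by funext i; fin_cases i; exacts [hs', ht']⟩
  calc _ ≤ μ.real (A 0 ∪ A 1) := measureReal_mono hsub
    _ ≤ 8 * δ ^ 2 := (measureReal_union_le _ _).trans (by linarith [hA 0, hA 1])

/-- A unitary that conjugates `T^v` into `T^{M v}` implements the dual map of the torus. -/
theorem map_comp_apply_of_mFourier {ι E : Type*} [Fintype ι] [NormedAddCommGroup E]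
    [InnerProductSpace ℂ E] [CompleteSpace E] (S : C(UnitAddTorus ι, ℂ) →⋆ₐ[ℂ] (E →L[ℂ] E))
    (u : E ≃ₗᵢ[ℂ] E) (m : C(UnitAddTorus ι, UnitAddTorus ι))
    (h : ∀ v η, S ((mFourier v).comp m) (u η) = u (S (mFourier v) η))
    (f : C(UnitAddTorus ι, ℂ)) (η : E) : S (f.comp m) (u η) = u (S f η) := by
  have hS : Continuous S := AddMonoidHomClass.continuous_of_bound S 1 fun f => by
    simpa using NonUnitalStarAlgHom.norm_apply_le S f
  have hmem : f ∈ (Submodule.span ℂ (Set.range (mFourier (d := ι)))).topologicalClosure := by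
    rw [span_mFourier_closure_eq_top]; trivial
  have hclosed : IsClosed {f : C(UnitAddTorus ι, ℂ) | S (f.comp m) (u η) = u (S f η)} :=
    isClosed_eq ((hS.comp (ContinuousMap.continuous_precomp m)).clm_apply continuous_const)
      (u.continuous.comp (hS.clm_apply continuous_const))
  refine closure_minimal (fun f hf => ?_) hclosed hmem
  induction hf using Submodule.span_induction with
  | mem f hf => obtain ⟨v, rfl⟩ := hf; exact h v η
  | zero => simp
  | add f g _ _ hf hg =>
    change S ((f.comp m) + (g.comp m)) (u η) = _
    rw [map_add, map_add, add_apply, add_apply, map_add, hf, hg]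
  | smul c f _ hf =>
    change S (c • (f.comp m)) (u η) = _
    rw [map_smul, map_smul, smul_apply, smul_apply, map_smul, hf]

theorem mFourier_fin_two (v : Fin 2 → ℤ) (x : UnitAddTorus (Fin 2)) :
    mFourier v x = ((AddCircle.toCircle (v 0 • x 0 + v 1 • x 1) : Circle) : ℂ) := by
  simp [mFourier_eq_prod_zpow, AddCircle.toCircle_add, AddCircle.toCircle_zsmul]

/-- Quantitative relative property (T) of the pair `ℤ² < ℤ² ⋊ SL(2, ℤ)`: a unit vector moved at
most `δ` by the elementary matrices and by the two generators of `ℤ²` is almost fixed by all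
of `ℤ²`. -/
theorem norm_translation_sub_sq_le {G E : Type*} [Group G] [NormedAddCommGroup E]
    [InnerProductSpace ℂ E] [CompleteSpace E] (π : G →* (E ≃ₗᵢ[ℂ] E))
    (τ : Multiplicative (Fin 2 → ℤ) →* G) {a b : G}
    (ha : ∀ v : Fin 2 → ℤ, a * τ (.ofAdd v) * a⁻¹ = τ (.ofAdd ![v 0 + v 1, v 1]))
    (hb : ∀ v : Fin 2 → ℤ, b * τ (.ofAdd v) * b⁻¹ = τ (.ofAdd ![v 0, v 0 + v 1]))
    {ξ : E} (hξ : ‖ξ‖ = 1) {δ : ℝ} (haδ : ‖π a ξ - ξ‖ ≤ δ) (hbδ : ‖π b ξ - ξ‖ ≤ δ)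
    (hτδ : ∀ i, ‖π (τ (.ofAdd (Pi.single i 1))) ξ - ξ‖ ≤ δ) (v : Fin 2 → ℤ) :
    ‖π (τ (.ofAdd v)) ξ - ξ‖ ^ 2 ≤ 64 * δ + 160 * δ ^ 2 := by
  obtain ⟨S, hS⟩ := exists_starAlgHom_mFourier
    ((Unitary.linearIsometryEquiv (𝕜 := ℂ) (H := E)).symm.toMonoidHom.comp (π.comp τ))
  replace hS : ∀ v η, S (mFourier v) η = π (τ (.ofAdd v)) η := fun v η => by
    rw [hS]; rfl
  obtain ⟨μ, _, hμ⟩ := exists_spectral_measure S ξ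
  have key : ∀ (g : G) (m : C(UnitAddTorus (Fin 2), UnitAddTorus (Fin 2)))
      (M : (Fin 2 → ℤ) → Fin 2 → ℤ) (_ : ∀ v, g * τ (.ofAdd v) * g⁻¹ = τ (.ofAdd (M v)))
      (_ : ∀ v x, mFourier v (m x) = mFourier (M v) x) (_ : ‖π g ξ - ξ‖ ≤ δ)
      (F : Set (UnitAddTorus (Fin 2))), IsClosed F → μ.real (m ⁻¹' F) ≤ μ.real F + 2 * δ := by
    intro g m M hM hm hg F hF
    have hcomm : ∀ f η, S (f.comp m) (π g η) = π g (S f η) := fun f η => by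
      refine map_comp_apply_of_mFourier S (π g) m (fun v η => ?_) f η
      have : (mFourier v).comp m = mFourier (M v) := by ext x; exact hm v x
      rw [this, hS, hS, ← hM, map_mul, map_mul]
      simp
    rw [← map_measureReal_apply m.continuous.measurable hF.measurableSet]
    have : IsFiniteMeasure (μ.map m) := inferInstance
    refine measureReal_le_of_integral_le (fun f hf => ?_) hF
    rw [integral_map m.continuous.measurable.aemeasurable
      f.continuous.aestronglyMeasurable]
    exact (integral_comp_spectral_measure_le hξ hμ (π g) m hcomm hf).trans (by linarith)
  have hinv : ∀ (g : G) (M M' : (Fin 2 → ℤ) → Fin 2 → ℤ) (_ : ∀ v, M (M' v) = v)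
      (_ : ∀ v, g * τ (.ofAdd v) * g⁻¹ = τ (.ofAdd (M v))) (v : Fin 2 → ℤ),
      g⁻¹ * τ (.ofAdd v) * g⁻¹⁻¹ = τ (.ofAdd (M' v)) := by
    intro g M M' hMM' hM v
    conv_lhs => rw [← hMM' v, ← hM]
    group
  have h₁ : ∀ c : ℤ, |c| = 1 → ∀ F, IsClosed F →
      μ.real (shearSnd c ⁻¹' F) ≤ μ.real F + 2 * δ := by
    intro c hc
    have hm : ∀ v x, mFourier v (shearSnd c x) = mFourier ![v 0 + c * v 1, v 1] x := fun v x => by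
      rw [mFourier_fin_two, mFourier_fin_two]
      congr 2
      simp [shearSnd, add_smul, mul_smul, smul_comm c]
      abel
    rcases (abs_eq zero_le_one).1 hc with rfl | rfl
    · exact key a ⟨_, continuous_shearSnd 1⟩ _ (by simpa using ha) hm haδ
    · refine key a⁻¹ ⟨_, continuous_shearSnd (-1)⟩ _ (hinv a _ _ (fun v => ?_) ha) hm
        (by rwa [norm_map_inv_sub])
      funext i; fin_cases i <;> simp
  have h₂ : ∀ c : ℤ, |c| = 1 → ∀ F, IsClosed F →
      μ.real (shearFst c ⁻¹' F) ≤ μ.real F + 2 * δ := by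
    intro c hc
    have hm : ∀ v x, mFourier v (shearFst c x) = mFourier ![v 0, c * v 0 + v 1] x := fun v x => by
      rw [mFourier_fin_two, mFourier_fin_two]
      congr 2
      simp [shearFst, add_smul, mul_smul, smul_comm c]
      abel
    rcases (abs_eq zero_le_one).1 hc with rfl | rfl
    · exact key b ⟨_, continuous_shearFst 1⟩ _ (by simpa using hb) hm hbδ
    · refine key b⁻¹ ⟨_, continuous_shearFst (-1)⟩ _ (hinv b _ _ (fun v => ?_) hb) hm
        (by rwa [norm_map_inv_sub])
      funext i; fin_cases i <;> simp
  have hμ0 := measureReal_compl_zero_le (r := 1 / 8) (by norm_num) h₁ h₂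
  have hW := measureReal_compl_square_le hμ (δ := δ) (fun i => by rw [hS]; exact hτδ i)
  have hint : ‖π (τ (.ofAdd v)) ξ - ξ‖ ^ 2 = ∫ x, ‖(mFourier v - 1 : C(_, ℂ)) x‖ ^ 2 ∂μ := by
    rw [integral_norm_sq_spectral_measure hμ, map_sub, map_one, sub_apply, hS]; rfl
  calc ‖π (τ (.ofAdd v)) ξ - ξ‖ ^ 2 = ∫ x, ‖(mFourier v - 1 : C(_, ℂ)) x‖ ^ 2 ∂μ := hint
    _ ≤ ∫ x, ({0}ᶜ : Set (UnitAddTorus (Fin 2))).indicator (fun _ => (4 : ℝ)) x ∂μ := by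
      refine integral_mono ((by fun_prop : Continuous _).integrable_of_hasCompactSupport
        (HasCompactSupport.of_compactSpace _))
        ((integrable_const _).indicator (measurableSet_singleton _).compl) fun x => ?_
      by_cases hx : x = 0
      · subst hx
        simp [mFourier]
      · rw [Set.indicator_of_mem (by simpa using hx)]
        have h1 : ‖(mFourier v - 1 : C(UnitAddTorus (Fin 2), ℂ)) x‖ ≤ 2 := by
          refine (norm_sub_le _ _).trans ?_
          have := (mFourier v).norm_coe_le_norm x
          rw [mFourier_norm] at this
          have h1 : ‖(1 : C(UnitAddTorus (Fin 2), ℂ)) x‖ = 1 := by simp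
          linarith
        nlinarith [norm_nonneg ((mFourier v - 1 : C(UnitAddTorus (Fin 2), ℂ)) x)]
    _ = 4 * μ.real {0}ᶜ := by
      rw [integral_indicator_const _ (measurableSet_singleton _).compl, smul_eq_mul, mul_comm]
    _ ≤ _ := by linarith

end RelativeT

/-! ### Relative property (T) of `H₁ < H₂` and `H < G` -/

/-- A vector that is moved a bounded distance by a subgroup is close to an invariant vector, namely
the element of smallest norm of the closed convex hull of its orbit. -/
theorem exists_invariant_norm_sub_le {G E : Type*} [Group G] [NormedAddCommGroup E]
    [InnerProductSpace ℂ E] [CompleteSpace E] (π : G →* (E ≃ₗᵢ[ℂ] E)) (H : Subgroup G) {ξ : E}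
    {c : ℝ} (hc : ∀ h ∈ H, ‖π h ξ - ξ‖ ≤ c) : ∃ η : E, (∀ h ∈ H, π h η = η) ∧ ‖ξ - η‖ ≤ c := by
  let _ : InnerProductSpace ℝ E := InnerProductSpace.rclikeToReal ℂ E
  set O : Set E := {η | ∃ h ∈ H, π h ξ = η} with hO
  set K : Set E := closure (convexHull ℝ O) with hK
  have hξO : ξ ∈ O := ⟨1, H.one_mem, by simp⟩
  have hOK : O ⊆ K := (subset_convexHull ℝ O).trans subset_closure
  have hKconv : Convex ℝ K := (convex_convexHull ℝ O).closure
  have hmap : ∀ h ∈ H, ∀ x ∈ K, π h x ∈ K := by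
    intro h hh
    have hpre : Convex ℝ ((π h) ⁻¹' K) := fun x hx y hy a b ha hb hab => by
      have := hKconv hx hy ha hb hab
      rw [Set.mem_preimage, map_add, ← Complex.coe_smul, ← Complex.coe_smul, map_smul, map_smul]
      exact this
    refine closure_minimal (convexHull_min ?_ hpre) (isClosed_closure.preimage (π h).continuous)
    rintro _ ⟨g, hg, rfl⟩
    exact hOK ⟨h * g, H.mul_mem hh hg, by simp⟩
  have hball : K ⊆ Metric.closedBall ξ c := by
    refine closure_minimal (convexHull_min ?_ (convex_closedBall ξ c)) Metric.isClosed_closedBall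
    rintro _ ⟨h, hh, rfl⟩
    simpa [dist_eq_norm] using hc h hh
  obtain ⟨η, hη, hmin⟩ := exists_norm_eq_iInf_of_complete_convex ⟨ξ, hOK hξO⟩
    isClosed_closure.isComplete hKconv (0 : E)
  refine ⟨η, fun h hh => ?_, ?_⟩
  · have hmin' : ‖0 - π h η‖ = ⨅ w : K, ‖0 - (w : E)‖ := by
      rw [← hmin, zero_sub, zero_sub, norm_neg, norm_neg, LinearIsometryEquiv.norm_map]
    have h1 := (norm_eq_iInf_iff_real_inner_le_zero hKconv hη).1 hmin _ (hmap h hh η hη)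
    have h2 := (norm_eq_iInf_iff_real_inner_le_zero hKconv (hmap h hh η hη)).1 hmin' _ hη
    have h3 : inner ℝ (π h η - η) (π h η - η) =
        inner ℝ (0 - η) (π h η - η) + inner ℝ (0 - π h η) (η - π h η) := by
      simp only [inner_sub_left, inner_sub_right, inner_zero_left]; ring
    have h4 : inner ℝ (π h η - η) (π h η - η) ≤ 0 := by rw [h3]; linarith
    rw [real_inner_self_nonpos] at h4
    exact sub_eq_zero.1 h4
  · have := hball hη
    rwa [Metric.mem_closedBall, dist_comm, dist_eq_norm] at this

section GroupH₂

variable {k n : ℕ}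

/-- An element of `H₂`, given by its blocks. -/
def elemH₂ (B : Matrix (Fin k) (Fin n) ℤ) (C : Matrix.SpecialLinearGroup (Fin n) ℤ)
    (v : Fin k → ℤ) (w : Fin n → ℤ) : groupH₂ k n :=
  ⟨blockMatrix 1 B C v w, B, C, v, w, rfl⟩

theorem elemH₂_mul (B B' : Matrix (Fin k) (Fin n) ℤ) (C C' : Matrix.SpecialLinearGroup (Fin n) ℤ)
    (v v' : Fin k → ℤ) (w w' : Fin n → ℤ) :
    elemH₂ B C v w * elemH₂ B' C' v' w' =
      elemH₂ (B' + B * C'.1) (C * C') (v' + B *ᵥ w' + v) (C.1 *ᵥ w' + w) := by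
  apply Subtype.ext
  change blockMatrix _ _ _ _ _ * blockMatrix _ _ _ _ _ = blockMatrix _ _ _ _ _
  rw [blockMatrix_mul]
  simp

theorem elemH₂_conj {B B' : Matrix (Fin k) (Fin n) ℤ} {C : Matrix.SpecialLinearGroup (Fin n) ℤ}
    {w w' : Fin n → ℤ} (hB : B' * C.1 = B) (hw : C.1 *ᵥ w = w') :
    elemH₂ 0 C 0 0 * elemH₂ B 1 0 w * (elemH₂ 0 C 0 0)⁻¹ = elemH₂ B' 1 0 w' := by
  rw [mul_inv_eq_iff_eq_mul, elemH₂_mul, elemH₂_mul, hB, hw]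
  simp

/-- The embedding of `ℤ^n` in `H₂` as translations. -/
def translationH₂ : Multiplicative (Fin n → ℤ) →* groupH₂ k n :=
  MonoidHom.mk' (fun w => elemH₂ 0 1 0 w.toAdd) fun w w' => by
    rw [elemH₂_mul]; simp [add_comm]

/-- The embedding of `M_{k,n}(ℤ)` in `H₂`. -/
def unipotentH₂ : Multiplicative (Matrix (Fin k) (Fin n) ℤ) →* groupH₂ k n :=
  MonoidHom.mk' (fun B => elemH₂ B.toAdd 1 0 0) fun B B' => by
    rw [elemH₂_mul]; simp [add_comm]

open Matrix.SpecialLinearGroup (transvection)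

/-- The finite set that witnesses the relative property (T) of `H₁ < H₂`: elementary matrices of
`SL(n, ℤ)` and the generators of `M_{k,n}(ℤ)` and `ℤ^n`. -/
def generatorsH₂ (k n : ℕ) : Set (groupH₂ k n) :=
  {g | ∃ (i j : Fin n) (hij : i ≠ j) (c : Fin 2),
      g = elemH₂ 0 (transvection hij ((-1) ^ c.1)) 0 0} ∪
    (Set.range (fun i : Fin n => elemH₂ 0 1 0 (Pi.single i 1)) ∪
      Set.range (fun p : Fin k × Fin n => elemH₂ (Matrix.single p.1 p.2 1) 1 0 0))

theorem finite_generatorsH₂ (k n : ℕ) : (generatorsH₂ k n).Finite := by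
  refine Set.Finite.union ?_ ((Set.finite_range _).union (Set.finite_range _))
  refine (Set.finite_range (fun p : {q : Fin n × Fin n // q.1 ≠ q.2} × Fin 2 =>
    elemH₂ (k := k) 0 (transvection p.1.2 ((-1) ^ p.2.1)) 0 0)).subset ?_
  rintro _ ⟨i, j, hij, c, rfl⟩
  exact ⟨(⟨(i, j), hij⟩, c), rfl⟩

theorem transvection_mulVec {n : ℕ} {i j : Fin n} (hij : i ≠ j) (c : ℤ) (w : Fin n → ℤ) :
    (transvection hij c).1 *ᵥ w = w + Pi.single i (c * w j) := by
  rw [show (transvection hij c).1 = 1 + Matrix.single i j c from rfl, Matrix.add_mulVec,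
    Matrix.one_mulVec, Matrix.single_mulVec]
  congr 1

theorem mul_transvection_eq (B : Matrix (Fin k) (Fin n) ℤ) {i j : Fin n} (hij : i ≠ j) (c : ℤ) :
    B * (transvection hij c).1 = B + B * Matrix.single i j c := by
  rw [show (transvection hij c).1 = 1 + Matrix.single i j c from rfl, Matrix.mul_add,
    Matrix.mul_one]

variable {E : Type*} [NormedAddCommGroup E] [InnerProductSpace ℂ E] [CompleteSpace E]
  (π : groupH₂ k n →* (E ≃ₗᵢ[ℂ] E)) {ξ : E} {δ κ : ℝ}

theorem norm_translationH₂_single_sub_le (hξ : ‖ξ‖ = 1)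
    (hF : ∀ g ∈ generatorsH₂ k n, ‖π g ξ - ξ‖ ≤ δ)
    (hκ : 0 ≤ κ) (hδκ : 64 * δ + 160 * δ ^ 2 ≤ κ ^ 2) {i j : Fin n} (hij : i ≠ j) (a : ℤ) :
    ‖π (translationH₂ (.ofAdd (Pi.single i a))) ξ - ξ‖ ≤ κ := by
  let f : (Fin 2 → ℤ) →+ (Fin n → ℤ) :=
    { toFun := fun v => Pi.single i (v 0) + Pi.single j (v 1)
      map_zero' := by simp
      map_add' := fun v w => by simp [Pi.single_add]; abel }
  have h := norm_translation_sub_sq_le π (translationH₂.comp f.toMultiplicative)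
    (a := elemH₂ 0 (transvection hij ((-1) ^ 0)) 0 0)
    (b := elemH₂ 0 (transvection hij.symm ((-1) ^ 0)) 0 0)
    (fun v => elemH₂_conj (by simp) (by
      rw [transvection_mulVec]
      simp [f, hij.symm, Pi.single_add]; abel))
    (fun v => elemH₂_conj (by simp) (by
      rw [transvection_mulVec]
      simp [f, hij, Pi.single_add]; abel))
    hξ (hF _ (Or.inl ⟨i, j, hij, 0, rfl⟩)) (hF _ (Or.inl ⟨j, i, hij.symm, 0, rfl⟩))
    (fun l => by
      refine hF _ (Or.inr (Or.inl ?_))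
      fin_cases l
      · exact ⟨i, by simp [f, translationH₂]⟩
      · exact ⟨j, by simp [f, translationH₂]⟩) ![a, 0]
  have h2 := h.trans hδκ
  rw [sq_le_sq₀ (norm_nonneg _) hκ] at h2
  simpa [f] using h2

theorem norm_unipotentH₂_single_sub_le (hξ : ‖ξ‖ = 1)
    (hF : ∀ g ∈ generatorsH₂ k n, ‖π g ξ - ξ‖ ≤ δ)
    (hκ : 0 ≤ κ) (hδκ : 64 * δ + 160 * δ ^ 2 ≤ κ ^ 2) (l : Fin k) {i j : Fin n} (hij : i ≠ j)
    (a : ℤ) : ‖π (unipotentH₂ (.ofAdd (Matrix.single l i a))) ξ - ξ‖ ≤ κ := by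
  let f : (Fin 2 → ℤ) →+ Matrix (Fin k) (Fin n) ℤ :=
    { toFun := fun v => Matrix.single l i (v 0) + Matrix.single l j (v 1)
      map_zero' := by simp
      map_add' := fun v w => by simp [Matrix.single_add]; abel }
  have hneg : ∀ (i : Fin n) (a : ℤ), Matrix.single l i (-a) = -Matrix.single l i a := fun i a => by
    ext; simp only [Matrix.single_apply, Matrix.neg_apply]; split_ifs <;> simp
  -- conjugation by `C` acts on the rows by the inverse of `C`, whence the negative sign
  have h := norm_translation_sub_sq_le π (unipotentH₂.comp f.toMultiplicative)
    (a := elemH₂ 0 (transvection hij.symm ((-1) ^ 1)) 0 0)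
    (b := elemH₂ 0 (transvection hij ((-1) ^ 1)) 0 0)
    (fun v => elemH₂_conj (by
      rw [mul_transvection_eq]
      simp [f, hij, Matrix.add_mul, Matrix.single_add, hneg]; abel) (by simp))
    (fun v => elemH₂_conj (by
      rw [mul_transvection_eq]
      simp [f, hij.symm, Matrix.add_mul, Matrix.single_add, hneg]; abel) (by simp))
    hξ (hF _ (Or.inl ⟨j, i, hij.symm, 1, rfl⟩)) (hF _ (Or.inl ⟨i, j, hij, 1, rfl⟩))
    (fun l' => by
      refine hF _ (Or.inr (Or.inr ?_))
      fin_cases l'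
      · exact ⟨(l, i), by simp [f, unipotentH₂]⟩
      · exact ⟨(l, j), by simp [f, unipotentH₂]⟩) ![a, 0]
  have h2 := h.trans hδκ
  rw [sq_le_sq₀ (norm_nonneg _) hκ] at h2
  simpa [f] using h2

/-- Every element of `H₁` is a product of boundedly many elements of the subgroups `ℤ^n` and
`M_{k,n}(ℤ)`, as the translations in `ℤ^k` are commutators of such elements. -/
theorem norm_elemH₁_sub_le (hξ : ‖ξ‖ = 1) (hn : 2 ≤ n)
    (hF : ∀ g ∈ generatorsH₂ k n, ‖π g ξ - ξ‖ ≤ δ)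
    (hκ : 0 ≤ κ) (hδκ : 64 * δ + 160 * δ ^ 2 ≤ κ ^ 2) (B : Matrix (Fin k) (Fin n) ℤ)
    (v : Fin k → ℤ) (w : Fin n → ℤ) :
    ‖π (elemH₂ B 1 v w) ξ - ξ‖ ≤ 3 * ((n + k * n) * κ) := by
  have : Nontrivial (Fin n) := Fin.nontrivial_iff_two_le.2 hn
  have hw : ∀ w, ‖π (elemH₂ 0 1 0 w) ξ - ξ‖ ≤ n * κ := fun w => by
    have h := norm_map_prod_sub_le π ξ translationH₂ Finset.univ
      (fun i => Multiplicative.ofAdd (Pi.single i (w i) : Fin n → ℤ))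
    rw [← ofAdd_sum, Finset.univ_sum_single w] at h
    refine h.trans ((Finset.sum_le_sum fun i _ => ?_).trans_eq (b := ∑ _i : Fin n, κ) (by simp))
    obtain ⟨j, hj⟩ := exists_ne i
    exact norm_translationH₂_single_sub_le π hξ hF hκ hδκ hj.symm _
  have hB : ∀ B, ‖π (elemH₂ B 1 0 0) ξ - ξ‖ ≤ k * n * κ := fun B => by
    have h := norm_map_prod_sub_le π ξ unipotentH₂ Finset.univ
      (fun p : Fin k × Fin n => Multiplicative.ofAdd (Matrix.single p.1 p.2 (B p.1 p.2)))
    rw [← ofAdd_sum, Fintype.sum_prod_type, ← Matrix.matrix_eq_sum_single B] at h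
    refine h.trans ((Finset.sum_le_sum fun p _ => ?_).trans_eq
      (b := ∑ _p : Fin k × Fin n, κ) (by simp))
    obtain ⟨j, hj⟩ := exists_ne p.2
    exact norm_unipotentH₂_single_sub_le π hξ hF hκ hδκ p.1 hj.symm _
  have hv : ‖π (elemH₂ 0 1 v 0) ξ - ξ‖ ≤ 2 * ((n + k * n) * κ) := by
    let i₀ : Fin n := ⟨0, by omega⟩
    let B₀ : Matrix (Fin k) (Fin n) ℤ := Matrix.of fun l i => if i = i₀ then v l else 0
    have h0 : B₀ *ᵥ Pi.single i₀ 1 = v := by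
      ext l; simp [B₀]
    have hcomm : elemH₂ 0 1 v 0 = elemH₂ B₀ 1 0 0 * elemH₂ 0 1 0 (Pi.single i₀ 1) *
        (elemH₂ 0 1 0 (Pi.single i₀ 1) * elemH₂ B₀ 1 0 0)⁻¹ := by
      rw [eq_mul_inv_iff_mul_eq, elemH₂_mul, elemH₂_mul, elemH₂_mul, h0]
      simp only [Matrix.zero_mulVec, zero_add, add_zero, Matrix.zero_mul, Matrix.mulVec_zero]
      simp
    rw [hcomm]
    have h1 := norm_map_mul_sub_le π ξ (elemH₂ B₀ 1 0 0) (elemH₂ 0 1 0 (Pi.single i₀ 1))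
    have h2 := norm_map_mul_sub_le π ξ (elemH₂ 0 1 0 (Pi.single i₀ 1)) (elemH₂ B₀ 1 0 0)
    rw [← norm_map_inv_sub] at h2
    have h3 := norm_map_mul_sub_le π ξ (elemH₂ B₀ 1 0 0 * elemH₂ 0 1 0 (Pi.single i₀ 1))
      (elemH₂ 0 1 0 (Pi.single i₀ 1) * elemH₂ B₀ 1 0 0)⁻¹
    linarith [hB B₀, hw (Pi.single i₀ 1)]
  have hsplit : elemH₂ B 1 v w = elemH₂ 0 1 v 0 * (elemH₂ 0 1 0 w * elemH₂ B 1 0 0) := by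
    rw [elemH₂_mul, elemH₂_mul]; simp
  rw [hsplit]
  have h1 := norm_map_mul_sub_le π ξ (elemH₂ 0 1 v 0) (elemH₂ 0 1 0 w * elemH₂ B 1 0 0)
  have h2 := norm_map_mul_sub_le π ξ (elemH₂ 0 1 0 w) (elemH₂ B 1 0 0)
  linarith [hB B, hw w]

end GroupH₂

/-- The pair `H₁ < H₂` has the relative property (T). -/
theorem hasRelativePropertyT_groupH₁ (k : ℕ) {n : ℕ} (hn : 2 ≤ n) :
    HasRelativePropertyT.{u, 0} ((groupH₁ k n).subgroupOf (groupH₂ k n)) := by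
  intro ε hε
  have hN : (0 : ℝ) < 3 * (n + k * n) + 1 := by positivity
  set κ := ε / (3 * (n + k * n) + 1) with hκ
  have hκ0 : 0 < κ := div_pos hε hN
  have hκε : 3 * ((n + k * n) * κ) < ε := by
    have : (3 * (n + k * n) + 1) * κ = ε := mul_div_cancel₀ _ hN.ne'
    linarith
  refine ⟨(finite_generatorsH₂ k n).toFinset, min 1 (κ ^ 2 / 224), by positivity,
    fun E _ _ _ π ξ hξ hF => ?_⟩
  have hδ : 64 * min 1 (κ ^ 2 / 224) + 160 * min 1 (κ ^ 2 / 224) ^ 2 ≤ κ ^ 2 := by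
    have h0 : 0 < min 1 (κ ^ 2 / 224) := by positivity
    have h1 := min_le_left 1 (κ ^ 2 / 224)
    have h2 := min_le_right 1 (κ ^ 2 / 224)
    nlinarith
  obtain ⟨η, hη, hηξ⟩ := exists_invariant_norm_sub_le π ((groupH₁ k n).subgroupOf (groupH₂ k n))
    (ξ := ξ) (c := 3 * ((n + k * n) * κ)) (by
      rintro ⟨_, hg⟩ ⟨B, v, w, rfl⟩
      exact norm_elemH₁_sub_le π hξ hn (fun g hg => (hF g (by simpa using hg)).le) hκ0.le hδ B v w)
  exact ⟨η, hη, hηξ.trans_lt hκε⟩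

theorem groupH₂_le_groupG {k n : ℕ} {Λ : Subgroup (Matrix.SpecialLinearGroup (Fin k) ℤ)} :
    groupH₂ k n ≤ groupG n Λ := by
  rintro _ ⟨B, C, v, w, rfl⟩
  exact ⟨1, Λ.one_mem, B, C, v, w, rfl⟩

/-- The pair `H < G` inherits the relative property (T) from `H₁ < H₂`, as `H ≤ H₁` and
`H₂ ≤ G`. -/
theorem hasRelativePropertyT_groupH {k n : ℕ} (hn : 2 ≤ n)
    (Λ : Subgroup (Matrix.SpecialLinearGroup (Fin k) ℤ)) :
    HasRelativePropertyT.{u, 0} ((groupH k n).subgroupOf (groupG n Λ)) := by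
  classical
  intro ε hε
  obtain ⟨F, δ, hδ, h⟩ := hasRelativePropertyT_groupH₁.{u} k hn ε hε
  refine ⟨F.image (Subgroup.inclusion groupH₂_le_groupG), δ, hδ, fun E _ _ _ π ξ hξ hF => ?_⟩
  obtain ⟨η, hη, hηξ⟩ := h E (π.comp (Subgroup.inclusion groupH₂_le_groupG)) ξ hξ
    fun g hg => hF _ (Finset.mem_image_of_mem _ hg)
  refine ⟨η, ?_, hηξ⟩
  rintro ⟨_, hg⟩ ⟨v, w, rfl⟩
  exact hη (elemH₂ 0 1 v w) ⟨0, v, w, rfl⟩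

/-! ### From relative property (T) to rigid inclusions -/

section Conjugation

variable {𝓗 : Type*} [NormedAddCommGroup 𝓗] [InnerProductSpace ℂ 𝓗] [CompleteSpace 𝓗]
  {M : VonNeumannAlgebra 𝓗} {K : Type*} [NormedAddCommGroup K] [InnerProductSpace ℂ K]
  [CompleteSpace K] {G : Type*} [Group G]

theorem mem_unitary_of_norm_map (W : G →* (𝓗 →L[ℂ] 𝓗)) (hW : ∀ g ξ, ‖W g ξ‖ = ‖ξ‖) (g : G) :
    W g ∈ unitary (𝓗 →L[ℂ] 𝓗) := by
  have h1 : star (W g) * W g = 1 := by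
    have := (W g).norm_map_iff_adjoint_comp_self.1 (hW g)
    rwa [← ContinuousLinearMap.star_eq_adjoint] at this
  have h2 : W g * W g⁻¹ = 1 := by rw [← map_mul, mul_inv_cancel, map_one]
  have h3 : star (W g) = W g⁻¹ := by
    rw [← mul_one (star (W g)), ← h2, ← mul_assoc, h1, one_mul]
  exact Unitary.mem_iff.2 ⟨h1, by rw [h3, h2]⟩

theorem right_mul_right (B : HilbertBimodule M K) (W : G →* unitary M.toStarSubalgebra) (g h : G) :
    B.right (MulOpposite.op (W g : M.toStarSubalgebra)) *
      B.right (MulOpposite.op (W h : M.toStarSubalgebra)) =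
      B.right (MulOpposite.op (W (h * g) : M.toStarSubalgebra)) := by
  rw [← map_mul, ← MulOpposite.op_mul, map_mul W]; rfl

theorem right_mem_unitary (B : HilbertBimodule M K) (W : G →* unitary M.toStarSubalgebra) (g : G) :
    B.right (MulOpposite.op (W g : M.toStarSubalgebra)) ∈ unitary (K →L[ℂ] K) := by
  have hs : star (B.right (MulOpposite.op (W g : M.toStarSubalgebra))) =
      B.right (MulOpposite.op (W g⁻¹ : M.toStarSubalgebra)) := by
    rw [← map_star, ← MulOpposite.op_star, map_inv, ← Unitary.star_eq_inv, Unitary.coe_star]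
  rw [Unitary.mem_iff, hs, right_mul_right, right_mul_right]
  simp

/-- The unitary representation `ξ ↦ W g ξ (W g)*` on a bimodule over `M`, for a group of
unitaries of `M`. -/
def conjugationRep (B : HilbertBimodule M K) (W : G →* unitary M.toStarSubalgebra) :
    G →* (K ≃ₗᵢ[ℂ] K) :=
  (Unitary.linearIsometryEquiv (𝕜 := ℂ) (H := K)).toMonoidHom.comp <|
    MonoidHom.mk' (fun g => ⟨B.left (W g : M.toStarSubalgebra), Unitary.map_mem B.left (W g).2⟩ *
      ⟨B.right (MulOpposite.op (W g⁻¹ : M.toStarSubalgebra)), right_mem_unitary B W g⁻¹⟩)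
    fun g h => by
      apply Subtype.ext
      change B.left (W (g * h) : M.toStarSubalgebra) *
        B.right (MulOpposite.op (W (g * h)⁻¹ : M.toStarSubalgebra)) =
        (B.left (W g : M.toStarSubalgebra) *
          B.right (MulOpposite.op (W g⁻¹ : M.toStarSubalgebra))) *
        (B.left (W h : M.toStarSubalgebra) * B.right (MulOpposite.op (W h⁻¹ : M.toStarSubalgebra)))
      have h1 : B.left (W (g * h) : M.toStarSubalgebra) =
          B.left (W g : M.toStarSubalgebra) * B.left (W h : M.toStarSubalgebra) := by
        rw [← map_mul, map_mul W]; rfl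
      rw [h1, mul_inv_rev, ← right_mul_right, mul_assoc, mul_assoc,
        ← mul_assoc (B.right _) (B.left _) (B.right _), ← B.comm, mul_assoc]

theorem conjugationRep_apply (B : HilbertBimodule M K) (W : G →* unitary M.toStarSubalgebra)
    (g : G) (ξ : K) : conjugationRep B W g ξ = B.lact (W g) (B.ract ξ (W g⁻¹ : unitary _)) := rfl

theorem ract_ract_inv (B : HilbertBimodule M K) (W : G →* unitary M.toStarSubalgebra)
    (g : G) (ξ : K) : B.ract (B.ract ξ (W g)) (W g⁻¹ : unitary _) = ξ := by
  have : B.right (MulOpposite.op (W g⁻¹ : M.toStarSubalgebra)) *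
      B.right (MulOpposite.op (W g : M.toStarSubalgebra)) = 1 := by
    rw [← map_mul, ← MulOpposite.op_mul, map_inv, ← Unitary.star_eq_inv]
    simp
  exact congrArg (fun T : K →L[ℂ] K => T ξ) this

theorem ract_conjugationRep (B : HilbertBimodule M K) (W : G →* unitary M.toStarSubalgebra)
    (g : G) (ξ : K) : B.ract (conjugationRep B W g ξ) (W g) = B.lact (W g) ξ := by
  have hc : ∀ (x y : M.toStarSubalgebra) (ζ : K), B.lact x (B.ract ζ y) = B.ract (B.lact x ζ) y :=
    fun x y ζ => congrArg (fun T : K →L[ℂ] K => T ζ) (B.comm x (MulOpposite.op y))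
  have h1 := ract_ract_inv B W g⁻¹ (B.lact (W g) ξ)
  rwa [inv_inv, ← hc, ← conjugationRep_apply] at h1

theorem norm_conjugationRep_sub (B : HilbertBimodule M K) (W : G →* unitary M.toStarSubalgebra)
    (g : G) (ξ : K) : ‖conjugationRep B W g ξ - ξ‖ = ‖B.lact (W g) ξ - B.ract ξ (W g)‖ := by
  rw [← ract_conjugationRep]
  exact ((Unitary.norm_map ⟨_, right_mem_unitary B W g⟩ _).symm.trans
    (congrArg norm (map_sub (B.right (MulOpposite.op (W g : M.toStarSubalgebra))) _ _)))

/-- A pair `H < G` with the relative property (T) that is realized by unitaries of `M` gives a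
rigid inclusion `A ⊆ M`, if the unitaries of `H` generate `A` in the sense that the vectors which
they centralize are `A`-central. -/
theorem isRigidInclusion_of_hasRelativePropertyT {τ : M.toStarSubalgebra → ℂ}
    {A : StarSubalgebra ℂ (𝓗 →L[ℂ] 𝓗)} (hA : A ≤ M.toStarSubalgebra) {H : Subgroup G}
    (hT : HasRelativePropertyT.{u} H) (W : G →* unitary M.toStarSubalgebra)
    (hH : ∀ (K : Type u) [NormedAddCommGroup K] [InnerProductSpace ℂ K] [CompleteSpace K]
      (B : HilbertBimodule M K) (η : K), (∀ h ∈ H, B.lact (W h) η = B.ract η (W h)) →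
        η ∈ B.centralVectors hA) :
    IsRigidInclusion.{_, u} M τ hA := by
  intro K _ _ _ B ξ _ hξ
  rw [Metric.tendsto_atTop]
  intro ε hε
  obtain ⟨F, δ, hδ, hF⟩ := hT ε hε
  have hev : ∀ᶠ i in atTop, ∀ g ∈ F, ‖conjugationRep B W g (ξ i) - ξ i‖ < δ := by
    rw [Filter.eventually_all_finset]
    intro g _
    filter_upwards [(hξ.2 (W g)).eventually_lt_const hδ] with i hi
    rwa [norm_conjugationRep_sub]
  obtain ⟨N, hN⟩ := eventually_atTop.1 hev
  refine ⟨N, fun i hi => ?_⟩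
  obtain ⟨η, hη, hηξ⟩ := hF K (conjugationRep B W) (ξ i) (hξ.1 i) (hN i hi)
  have hmem := hH K B η fun h hh => by
    rw [← ract_conjugationRep, hη h hh]
  rw [Real.dist_eq, sub_zero, abs_norm]
  refine lt_of_le_of_lt ?_ hηξ
  rw [Submodule.starProjection_minimal]
  exact ciInf_le ⟨0, by rintro _ ⟨x, rfl⟩; exact norm_nonneg _⟩
    (⟨η, hmem⟩ : B.centralVectors hA)

end Conjugation

/-! ### Normal maps on multiplication operators -/

section FourierUniqueness

open UnitAddTorus

variable {ι : Type*} [Fintype ι]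

theorem integrable_continuousMap_mul {X : Type*} [TopologicalSpace X] [CompactSpace X]
    [MeasurableSpace X] [BorelSpace X] {μ : Measure X} {g : X → ℂ} (hg : Integrable g μ)
    (c : C(X, ℂ)) : Integrable (fun x => c x * g x) μ :=
  hg.bdd_mul (c := ‖c‖) c.continuous.aestronglyMeasurable
    (Eventually.of_forall fun x => c.norm_coe_le_norm x)

theorem integral_continuousMap_mul_eq_zero {μ : Measure (UnitAddTorus ι)} {g : UnitAddTorus ι → ℂ}
    (hg : Integrable g μ) (h : ∀ v, ∫ x, mFourier v x * g x ∂μ = 0) (c : C(UnitAddTorus ι, ℂ)) :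
    ∫ x, c x * g x ∂μ = 0 := by
  let L : C(UnitAddTorus ι, ℂ) →L[ℂ] ℂ := LinearMap.mkContinuous
    { toFun := fun c => ∫ x, c x * g x ∂μ
      map_add' := fun c d => by
        rw [← integral_add (integrable_continuousMap_mul hg c) (integrable_continuousMap_mul hg d)]
        exact integral_congr_ae (Eventually.of_forall fun x => add_mul _ _ _)
      map_smul' := fun a c => by
        rw [RingHom.id_apply, smul_eq_mul, ← integral_const_mul]
        exact integral_congr_ae (Eventually.of_forall fun x => mul_assoc _ _ _) }
    (∫ x, ‖g x‖ ∂μ) fun c => by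
      rw [mul_comm, ← integral_const_mul]
      refine norm_integral_le_of_norm_le (hg.norm.const_mul _) (Eventually.of_forall fun x => ?_)
      rw [norm_mul]
      gcongr
      exact c.norm_coe_le_norm x
  have hle : (Submodule.span ℂ (Set.range (mFourier (d := ι)))).topologicalClosure ≤
      LinearMap.ker L.toLinearMap := by
    refine Submodule.topologicalClosure_minimal _ (Submodule.span_le.2 ?_) L.isClosed_ker
    rintro _ ⟨v, rfl⟩
    exact h v
  have hc : c ∈ LinearMap.ker L.toLinearMap := hle (by rw [span_mFourier_closure_eq_top]; trivial)
  exact hc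

/-- Uniqueness of Fourier coefficients for integrable functions on the torus. -/
theorem ae_eq_zero_of_mFourier {μ : Measure (UnitAddTorus ι)} [IsFiniteMeasure μ]
    {g : UnitAddTorus ι → ℂ} (hg : Integrable g μ)
    (h : ∀ v, ∫ x, mFourier v x * g x ∂μ = 0) : g =ᵐ[μ] 0 := by
  refine ae_eq_zero_of_forall_setIntegral_isClosed_eq_zero hg fun F hF => ?_
  let c : ℕ → C(UnitAddTorus ι, ℂ) := fun n => ⟨fun x => ((hF.apprSeq n x : ℝ) : ℂ), by fun_prop⟩
  have hlim : Tendsto (fun n => ∫ x, c n x * g x ∂μ) atTop (𝓝 (∫ x, F.indicator g x ∂μ)) := by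
    refine tendsto_integral_of_dominated_convergence (fun x => ‖g x‖)
      (fun n => (integrable_continuousMap_mul hg _).1) hg.norm
      (fun n => Eventually.of_forall fun x => ?_) (Eventually.of_forall fun x => ?_)
    · rw [norm_mul]
      refine mul_le_of_le_one_left (norm_nonneg _) ?_
      simpa [c] using HasOuterApproxClosed.apprSeq_apply_le_one hF n x
    · have h1 := (tendsto_pi_nhds.1 (HasOuterApproxClosed.tendsto_apprSeq hF)) x
      have h2 : Tendsto (fun n => c n x) atTop
          (𝓝 (((F.indicator (fun _ => (1 : NNReal)) x : NNReal) : ℝ) : ℂ)) :=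
        (Complex.continuous_ofReal.tendsto _).comp ((NNReal.continuous_coe.tendsto _).comp h1)
      convert h2.mul_const (g x) using 2
      by_cases hx : x ∈ F <;> simp [hx]
  rw [← integral_indicator hF.measurableSet]
  refine tendsto_nhds_unique hlim ?_
  simp only [integral_continuousMap_mul_eq_zero hg h]
  exact tendsto_const_nhds

end FourierUniqueness

theorem L2_norm_sq_eq_integral {α : Type*} [MeasurableSpace α] {μ : Measure α} (f : Lp ℂ 2 μ) :
    ‖f‖ ^ 2 = ∫ x, ‖f x‖ ^ 2 ∂μ := by
  have h : (inner ℂ f f : ℂ) = ((∫ x, ‖f x‖ ^ 2 ∂μ : ℝ) : ℂ) := by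
    rw [L2.inner_def, ← integral_complex_ofReal]
    refine integral_congr_ae (Eventually.of_forall fun x => ?_)
    simp only [inner_self_eq_norm_sq_to_K]
    push_cast
    rfl
  rw [inner_self_eq_norm_sq_to_K] at h
  refine Complex.ofReal_injective ?_
  rw [Complex.ofReal_pow]
  exact h

theorem integrable_norm_sq_L2 {α : Type*} [MeasurableSpace α] {μ : Measure α} (f : Lp ℂ 2 μ) :
    Integrable (fun x => ‖f x‖ ^ 2) μ :=
  (memLp_two_iff_integrable_sq_norm (Lp.memLp f).1).1 (Lp.memLp f)

section NormalFunctionals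

variable (Γ : Type*) [Group Γ] [Countable Γ] [MeasurableSpace Γ] [DiscreteMeasurableSpace Γ]
  {X : Type*} [MeasurableSpace X] [MulAction Γ X] [MeasurableConstSMul Γ X]
  {μ : Measure X} [IsProbabilityMeasure μ] [SMulInvariantMeasure Γ X μ]

/-- The operator of multiplication by a bounded function of the first variable. -/
def mulOperator {a : X → ℂ} (ha : MemLp a ∞ μ) : CrossedSpace Γ μ →L[ℂ] CrossedSpace Γ μ :=
  (ContinuousLinearMap.mul ℂ ℂ).holderL (μ.prod Measure.count) ∞ 2 2
    (memLp_top_comp_fst Γ ha).toLp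

theorem mulOperator_apply {a : X → ℂ} (ha : MemLp a ∞ μ) (ξ : CrossedSpace Γ μ) :
    mulOperator Γ ha ξ =ᵐ[μ.prod Measure.count] fun p => a p.1 * ξ p := by
  refine (ContinuousLinearMap.coeFn_holder _ _ _).trans ?_
  filter_upwards [(memLp_top_comp_fst Γ ha).coeFn_toLp] with p hp
  simp [hp]

theorem mulOperator_mem_linftyAlgebra {a : X → ℂ} (ha : MemLp a ∞ μ) :
    mulOperator Γ ha ∈ linftyAlgebra Γ μ := ⟨a, ha, mulOperator_apply Γ ha⟩

variable {Γ}

/-- On the multiplication operators, the coefficients of a normal map are integrals against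
integrable functions. -/
theorem exists_integrable_of_isNormalMap {K : Type*} [NormedAddCommGroup K] [InnerProductSpace ℂ K]
    {φ : (crossedProduct Γ μ).toStarSubalgebra → (K →L[ℂ] K)}
    (hφ : IsNormalMap (crossedProduct Γ μ) φ) (ξ η : K) :
    ∃ g : X → ℂ, Integrable g μ ∧ ∀ (T) (hT : T ∈ linftyAlgebra Γ μ) (a : X → ℂ), MemLp a ∞ μ →
      (∀ ζ : CrossedSpace Γ μ, T ζ =ᵐ[μ.prod Measure.count] fun p => a p.1 * ζ p) →
        inner ℂ ξ (φ ⟨T, linftyAlgebra_le_crossedProduct Γ μ hT⟩ η) = ∫ x, a x * g x ∂μ := by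
  obtain ⟨α, β, hα, hβ, h⟩ := hφ ξ η
  have hFi : ∀ i, Integrable (fun p => inner ℂ (α i p) (β i p)) (μ.prod Measure.count) := fun i =>
    L2.integrable_inner (α i) (β i)
  let F : ℕ → Lp ℂ 1 (μ.prod (Measure.count : Measure Γ)) := fun i => (hFi i).toL1 _
  have hF : Summable F := by
    refine Summable.of_norm_bounded (hα.add hβ) fun i => ?_
    rw [L1.norm_of_fun_eq_integral_norm, L2_norm_sq_eq_integral, L2_norm_sq_eq_integral,
      ← integral_add (integrable_norm_sq_L2 (α i)) (integrable_norm_sq_L2 (β i))]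
    refine integral_mono (hFi i).norm ((integrable_norm_sq_L2 (α i)).add
      (integrable_norm_sq_L2 (β i))) fun p => ?_
    have h1 := norm_inner_le_norm (𝕜 := ℂ) (α i p) (β i p)
    have h2 := two_mul_le_add_sq ‖α i p‖ ‖β i p‖
    have h3 : 0 ≤ ‖α i p‖ * ‖β i p‖ := by positivity
    change _ ≤ ‖α i p‖ ^ 2 + ‖β i p‖ ^ 2
    linarith
  set f := ∑' i, F i with hf
  refine ⟨fun x => ∫ γ, f (x, γ) ∂Measure.count, (L1.integrable_coeFn f).integral_prod_left,
    fun T hT a ha hTa => ?_⟩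
  have ha' := memLp_top_comp_fst Γ ha
  have hsum := hF.hasSum.mapL ((ContinuousLinearMap.mul ℂ ℂ).lpPairing
    (μ.prod (Measure.count : Measure Γ)) ∞ 1 ha'.toLp)
  have hval : ∀ g : Lp ℂ 1 (μ.prod (Measure.count : Measure Γ)),
      (ContinuousLinearMap.mul ℂ ℂ).lpPairing _ ∞ 1 ha'.toLp g =
        ∫ p, a p.1 * g p ∂(μ.prod Measure.count) := fun g => by
    rw [ContinuousLinearMap.lpPairing_eq_integral]
    refine integral_congr_ae ?_
    filter_upwards [ha'.coeFn_toLp] with p hp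
    simp [hp]
  have hint : Integrable (fun p : X × Γ => a p.1 * f p) (μ.prod Measure.count) :=
    ha'.integrable_mul (Lp.memLp f)
  rw [hval, integral_prod _ hint] at hsum
  simp only [integral_const_mul] at hsum
  refine (h ⟨T, _⟩).unique ?_
  refine (congrArg (HasSum · _) (funext fun i => ?_)).mpr hsum
  rw [hval, L2.inner_def]
  refine integral_congr_ae ?_
  filter_upwards [hTa (β i), (hFi i).coeFn_toL1] with p h1 h2
  rw [h1, h2]
  simp only [RCLike.inner_apply]
  ring

/-- Two normal maps that agree on the characters of the torus agree on all multiplication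
operators. -/
theorem normal_eq_of_mFourier {ι : Type*} [Fintype ι] {μ : Measure (UnitAddTorus ι)}
    [IsProbabilityMeasure μ] [MulAction Γ (UnitAddTorus ι)] [MeasurableConstSMul Γ (UnitAddTorus ι)]
    [SMulInvariantMeasure Γ (UnitAddTorus ι) μ]
    {K : Type*} [NormedAddCommGroup K] [InnerProductSpace ℂ K]
    {φ ψ : (crossedProduct Γ μ).toStarSubalgebra → (K →L[ℂ] K)}
    (hφ : IsNormalMap (crossedProduct Γ μ) φ) (hψ : IsNormalMap (crossedProduct Γ μ) ψ) (η : K)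
    (hχ : ∀ v, MemLp (UnitAddTorus.mFourier v) ∞ μ)
    (h : ∀ v, φ ⟨mulOperator Γ (hχ v), linftyAlgebra_le_crossedProduct Γ μ
      (mulOperator_mem_linftyAlgebra Γ (hχ v))⟩ η = ψ ⟨mulOperator Γ (hχ v),
        linftyAlgebra_le_crossedProduct Γ μ (mulOperator_mem_linftyAlgebra Γ (hχ v))⟩ η)
    {T} (hT : T ∈ linftyAlgebra Γ μ) :
    φ ⟨T, linftyAlgebra_le_crossedProduct Γ μ hT⟩ η =
      ψ ⟨T, linftyAlgebra_le_crossedProduct Γ μ hT⟩ η := by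
  refine ext_inner_left ℂ fun ξ => ?_
  obtain ⟨f, hf, hfφ⟩ := exists_integrable_of_isNormalMap hφ ξ η
  obtain ⟨g, hg, hgψ⟩ := exists_integrable_of_isNormalMap hψ ξ η
  have h0 : (fun x => f x - g x) =ᵐ[μ] 0 := by
    refine ae_eq_zero_of_mFourier (hf.sub hg) fun v => ?_
    have h1 := hfφ _ (mulOperator_mem_linftyAlgebra Γ (hχ v)) _ (hχ v) (mulOperator_apply Γ (hχ v))
    have h2 := hgψ _ (mulOperator_mem_linftyAlgebra Γ (hχ v)) _ (hχ v) (mulOperator_apply Γ (hχ v))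
    rw [h, h2] at h1
    simp only [mul_sub]
    rw [integral_sub (integrable_continuousMap_mul hf _) (integrable_continuousMap_mul hg _), h1,
      sub_self]
  obtain ⟨a, ha, hTa⟩ := id hT
  rw [hfφ T hT a ha hTa, hgψ T hT a ha hTa]
  refine integral_congr_ae ?_
  filter_upwards [h0] with x hx
  rw [sub_eq_zero.1 hx]

end NormalFunctionals

/-! ### Rigidity of the action on the torus -/

section CrossedUnitaries

variable (Γ : Type*) [Group Γ] [Countable Γ] [MeasurableSpace Γ] [DiscreteMeasurableSpace Γ]
  {X : Type*} [MeasurableSpace X] [MulAction Γ X] [MeasurableConstSMul Γ X]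
  (μ : Measure X) [IsProbabilityMeasure μ] [SMulInvariantMeasure Γ X μ]

theorem crossedUnitary_apply (g : Γ) (ξ : CrossedSpace Γ μ) :
    crossedUnitary Γ μ g ξ =ᵐ[μ.prod Measure.count] fun p => ξ (g⁻¹ • p.1, g⁻¹ * p.2) :=
  Lp.coeFn_compMeasurePreserving ξ (measurePreserving_diag Γ μ g⁻¹)

theorem norm_crossedUnitary (g : Γ) (ξ : CrossedSpace Γ μ) : ‖crossedUnitary Γ μ g ξ‖ = ‖ξ‖ :=
  LinearIsometry.norm_map _ _

theorem crossedUnitary_one : crossedUnitary Γ μ (1 : Γ) = 1 := by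
  ext ξ
  filter_upwards [crossedUnitary_apply Γ μ 1 ξ] with p hp
  rw [hp]
  simp

theorem crossedUnitary_mul (g h : Γ) :
    crossedUnitary Γ μ (g * h) = crossedUnitary Γ μ g * crossedUnitary Γ μ h := by
  ext ξ
  rw [ContinuousLinearMap.mul_def, ContinuousLinearMap.comp_apply]
  have h1 := (measurePreserving_diag Γ μ g⁻¹).quasiMeasurePreserving.ae
    (crossedUnitary_apply Γ μ h ξ)
  filter_upwards [crossedUnitary_apply Γ μ (g * h) ξ, h1,
    crossedUnitary_apply Γ μ g (crossedUnitary Γ μ h ξ)] with p h2 h3 h4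
  rw [h2, h4, h3, mul_inv_rev, mul_smul, mul_assoc]

variable {μ} in
/-- `u_g a u_g* = a(g⁻¹ ·)`. -/
theorem crossedUnitary_mul_mulOperator (g : Γ) {a b : X → ℂ} (ha : MemLp a ∞ μ) (hb : MemLp b ∞ μ)
    (hab : ∀ x, b x = a (g⁻¹ • x)) :
    crossedUnitary Γ μ g * mulOperator Γ ha = mulOperator Γ hb * crossedUnitary Γ μ g := by
  ext ξ
  rw [ContinuousLinearMap.mul_def, ContinuousLinearMap.comp_apply, ContinuousLinearMap.mul_def,
    ContinuousLinearMap.comp_apply]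
  have h1 := (measurePreserving_diag Γ μ g⁻¹).quasiMeasurePreserving.ae
    (mulOperator_apply Γ ha ξ)
  filter_upwards [crossedUnitary_apply Γ μ g (mulOperator Γ ha ξ), h1,
    mulOperator_apply Γ hb (crossedUnitary Γ μ g ξ), crossedUnitary_apply Γ μ g ξ]
    with p h2 h3 h4 h5
  rw [h2, h3, h4, h5, hab]

variable {μ} in
theorem mulOperator_mul {a b c : X → ℂ} (ha : MemLp a ∞ μ) (hb : MemLp b ∞ μ) (hc : MemLp c ∞ μ)
    (habc : ∀ x, c x = a x * b x) : mulOperator Γ hc = mulOperator Γ ha * mulOperator Γ hb := by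
  ext ξ
  rw [ContinuousLinearMap.mul_def, ContinuousLinearMap.comp_apply]
  filter_upwards [mulOperator_apply Γ hc ξ, mulOperator_apply Γ hb ξ,
    mulOperator_apply Γ ha (mulOperator Γ hb ξ)] with p h1 h2 h3
  rw [h1, h3, h2, habc, mul_assoc]

variable {μ} in
theorem norm_mulOperator {a : X → ℂ} (ha : MemLp a ∞ μ) (h1 : ∀ x, ‖a x‖ = 1)
    (ξ : CrossedSpace Γ μ) : ‖mulOperator Γ ha ξ‖ = ‖ξ‖ := by
  refine le_antisymm ?_ ?_ <;> refine Lp.norm_le_norm_of_ae_le ?_ <;>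
  · filter_upwards [mulOperator_apply Γ ha ξ] with p hp
    rw [hp, norm_mul, h1, one_mul]

end CrossedUnitaries

section Rigidity

open UnitAddTorus

variable {k n : ℕ} {Λ : Subgroup (Matrix.SpecialLinearGroup (Fin k) ℤ)}

/-- The projection of `G = H ⋊ Γ` onto `Γ`. -/
def projΓ : groupG n Λ →* groupΓ n Λ :=
  MonoidHom.mk' (fun g => ⟨⟨Matrix.fromBlocks g.1.1.toBlocks₁₁ 0 0 1, by
      obtain ⟨_, A, hA, B, C, v, w, rfl⟩ := g
      simp [blockMatrix, A.2, C.2]⟩, by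
      obtain ⟨_, A, hA, B, C, v, w, rfl⟩ := g
      refine ⟨A, hA, B, C, Subtype.ext ?_⟩
      simp [blockMatrix]⟩) (by
    rintro ⟨_, A, hA, B, C, v, w, rfl⟩ ⟨_, A', hA', B', C', v', w', rfl⟩
    apply Subtype.ext
    apply Subtype.ext
    change Matrix.fromBlocks
        (blockMatrix A B C v w * blockMatrix A' B' C' v' w').1.toBlocks₁₁ 0 0 1 =
      Matrix.fromBlocks (blockMatrix A B C v w).1.toBlocks₁₁ 0 0 1 *
      Matrix.fromBlocks (blockMatrix A' B' C' v' w').1.toBlocks₁₁ 0 0 1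
    rw [blockMatrix_mul]
    simp [blockMatrix, Matrix.fromBlocks_multiply])

/-- The translation part of an element of `G`. -/
def lastColumn (g : groupG n Λ) : Fin k ⊕ Fin n → ℤ := fun i => g.1.1 (Sum.inl i) (Sum.inr ())

theorem lastColumn_mul (g h : groupG n Λ) :
    lastColumn (g * h) = lastColumn g + (corner (projΓ g)).1 *ᵥ lastColumn h := by
  obtain ⟨_, A, hA, B, C, v, w, rfl⟩ := g
  obtain ⟨_, A', hA', B', C', v', w', rfl⟩ := h
  have h1 : lastColumn (⟨_, A', hA', B', C', v', w', rfl⟩ : groupG n Λ) = Sum.elim v' w' := rfl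
  have h2 : lastColumn (⟨_, A, hA, B, C, v, w, rfl⟩ : groupG n Λ) = Sum.elim v w := rfl
  have h3 : (corner (projΓ ⟨_, A, hA, B, C, v, w, rfl⟩ : groupΓ n Λ)).1 =
    Matrix.fromBlocks A.1 B 0 C.1 := rfl
  rw [h1, h2, h3]
  change (fun i =>
    (blockMatrix A B C v w * blockMatrix A' B' C' v' w').1 (Sum.inl i) (Sum.inr ())) = _
  rw [blockMatrix_mul]
  ext i
  rcases i with i | i <;> simp [blockMatrix, Matrix.fromBlocks_mulVec] <;> ring

theorem norm_mFourier_apply {ι : Type*} [Fintype ι] (v : ι → ℤ) (x : UnitAddTorus ι) :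
    ‖mFourier v x‖ = 1 := by
  rw [mFourier_eq_prod_zpow]; exact Circle.norm_coe _

theorem memLp_mFourier {ι : Type*} [Fintype ι] (v : ι → ℤ) (μ : Measure (UnitAddTorus ι)) :
    MemLp (mFourier v) ∞ μ :=
  memLp_top_of_bound (mFourier v).continuous.aestronglyMeasurable 1
    (Eventually.of_forall fun x => (norm_mFourier_apply v x).le)

/-- The unitaries `e_h u_γ` of the crossed product, for `hγ ∈ G = H ⋊ Γ`: the translation `h` acts
as a character of the torus. -/
def crossedRep : groupG n Λ →* (CrossedSpace (groupΓ n Λ) (torusMeasure (Fin k ⊕ Fin n)) →L[ℂ]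
    CrossedSpace (groupΓ n Λ) (torusMeasure (Fin k ⊕ Fin n))) where
  toFun g := mulOperator (groupΓ n Λ) (memLp_mFourier (lastColumn g) _) *
    crossedUnitary (groupΓ n Λ) _ (projΓ g)
  map_one' := by
    rw [map_one, crossedUnitary_one, mul_one]
    ext ξ
    filter_upwards [mulOperator_apply (groupΓ n Λ) (memLp_mFourier
      (lastColumn (1 : groupG n Λ)) (torusMeasure (Fin k ⊕ Fin n))) ξ] with p hp
    have : lastColumn (1 : groupG n Λ) = 0 := by
      ext i; simp [lastColumn]
    rw [hp, this, mFourier_zero]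
    simp
  map_mul' g h := by
    have h1 := crossedUnitary_mul_mulOperator (groupΓ n Λ) (projΓ g)
      (memLp_mFourier (lastColumn h) (torusMeasure (Fin k ⊕ Fin n)))
      (memLp_mFourier ((corner (projΓ g)).1 *ᵥ lastColumn h) _) fun x => by
        rw [groupΓ_smul_def, map_inv, mFourier_smul, inv_inv]
    have h2 := mulOperator_mul (groupΓ n Λ)
      (memLp_mFourier (lastColumn g) (torusMeasure (Fin k ⊕ Fin n)))
      (memLp_mFourier ((corner (projΓ g)).1 *ᵥ lastColumn h) _)
      (memLp_mFourier (lastColumn (g * h)) _) fun x => by rw [lastColumn_mul, mFourier_add]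
    rw [h2, map_mul, crossedUnitary_mul, mul_assoc, mul_assoc, ← mul_assoc _ (crossedUnitary _ _ _),
      ← h1, mul_assoc]

theorem crossedRep_mem (g : groupG n Λ) :
    crossedRep g ∈ (crossedProduct (groupΓ n Λ) (torusMeasure (Fin k ⊕ Fin n))).toStarSubalgebra :=
  mul_mem (linftyAlgebra_le_crossedProduct _ _ (mulOperator_mem_linftyAlgebra _ _))
    (crossedUnitary_mem_crossedProduct _ _ _)

/-- `crossedRep`, with values in the unitary group of the crossed product. -/
def crossedUnitaryRep : groupG n Λ →*
    unitary (crossedProduct (groupΓ n Λ) (torusMeasure (Fin k ⊕ Fin n))).toStarSubalgebra where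
  toFun g := ⟨⟨crossedRep g, crossedRep_mem g⟩, by
    have := mem_unitary_of_norm_map (crossedRep (n := n) (Λ := Λ)) (fun g ξ =>
      (norm_mulOperator (groupΓ n Λ) (memLp_mFourier (lastColumn g) _)
        (norm_mFourier_apply _) _).trans
        (norm_crossedUnitary (groupΓ n Λ) _ (projΓ g) ξ)) g
    rw [Unitary.mem_iff] at this ⊢
    exact ⟨Subtype.ext this.1, Subtype.ext this.2⟩⟩
  map_one' := Subtype.ext (Subtype.ext (map_one crossedRep))
  map_mul' g h := Subtype.ext (Subtype.ext (map_mul crossedRep g h))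

/-- The translation by `v`, as an element of `H ≤ G`. -/
def translationG (Λ : Subgroup (Matrix.SpecialLinearGroup (Fin k) ℤ)) (v : Fin k ⊕ Fin n → ℤ) :
    groupG n Λ :=
  ⟨blockMatrix 1 0 1 (fun i => v (Sum.inl i)) (fun i => v (Sum.inr i)),
    groupH_le_groupG ⟨_, _, rfl⟩⟩

theorem projΓ_translationG (v : Fin k ⊕ Fin n → ℤ) : projΓ (translationG Λ v) = 1 := by
  apply Subtype.ext
  apply Subtype.ext
  simp [projΓ, translationG, blockMatrix]

theorem lastColumn_translationG (v : Fin k ⊕ Fin n → ℤ) : lastColumn (translationG Λ v) = v := by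
  ext i
  rcases i with i | i <;> rfl

theorem crossedRep_translationG (v : Fin k ⊕ Fin n → ℤ) :
    crossedRep (translationG Λ v) = mulOperator (groupΓ n Λ) (memLp_mFourier v _) := by
  have : crossedRep (translationG Λ v) = mulOperator (groupΓ n Λ)
      (memLp_mFourier (lastColumn (translationG Λ v)) _) *
        crossedUnitary (groupΓ n Λ) _ (projΓ (translationG Λ v)) := rfl
  rw [this, projΓ_translationG, crossedUnitary_one, mul_one]
  congr 1
  rw [lastColumn_translationG]

theorem coe_crossedUnitaryRep_translationG (v : Fin k ⊕ Fin n → ℤ) :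
    (crossedUnitaryRep (n := n) (Λ := Λ) (translationG Λ v)).1 =
      ⟨mulOperator (groupΓ n Λ) (memLp_mFourier v _), linftyAlgebra_le_crossedProduct _ _
        (mulOperator_mem_linftyAlgebra _ _)⟩ :=
    Subtype.ext (crossedRep_translationG v)

/-- The action of `Γ` on the dual of `H` is rigid. -/
theorem isRigidAction_torus (hn : 2 ≤ n)
    (Λ : Subgroup (Matrix.SpecialLinearGroup (Fin k) ℤ)) :
    IsRigidAction.{0, 0, u} (groupΓ n Λ) (torusMeasure (Fin k ⊕ Fin n)) := by
  refine isRigidInclusion_of_hasRelativePropertyT _ (hasRelativePropertyT_groupH.{u} hn Λ)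
    (crossedUnitaryRep (n := n) (Λ := Λ)) fun K _ _ _ B η hη => ?_
  rw [HilbertBimodule.mem_centralVectors]
  intro T hT
  refine normal_eq_of_mFourier B.left_normal B.right_normal η (fun v => memLp_mFourier v _)
    (fun v => ?_) hT
  have h := hη (translationG Λ v) ⟨_, _, rfl⟩
  rw [coe_crossedUnitaryRep_translationG] at h
  exact h

end Rigidity

/-! ### Ergodicity and essential freeness of actions on the torus -/

section Fourier

open UnitAddTorus

variable {ι : Type*} [Fintype ι]

/-- The Fourier coefficients of a function on the torus. -/
def torusCoeff (f : UnitAddTorus ι → ℂ) (v : ι → ℤ) : ℂ :=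
  ∫ x, mFourier (-v) x * f x ∂torusMeasure ι

theorem hasSum_norm_sq_torusCoeff {f : UnitAddTorus ι → ℂ} (hf : MemLp f 2 (torusMeasure ι)) :
    HasSum (fun v => ‖torusCoeff f v‖ ^ 2) (∫ x, ‖f x‖ ^ 2 ∂torusMeasure ι) := by
  have h := UnitAddTorus.hasSum_sq_mFourierCoeff (d := ι) (hf.toLp f)
  have h1 : ∀ v, mFourierCoeff (hf.toLp f) v = torusCoeff f v := fun v => by
    refine integral_congr_ae ?_
    filter_upwards [hf.coeFn_toLp] with x hx
    rw [hx]; rfl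
  have h2 : ∫ x, ‖hf.toLp f x‖ ^ 2 ∂torusMeasure ι = ∫ x, ‖f x‖ ^ 2 ∂torusMeasure ι := by
    refine integral_congr_ae ?_
    filter_upwards [hf.coeFn_toLp] with x hx
    rw [hx]
  rw [← h2]
  exact (congrArg (HasSum · _) (funext fun v => congrArg (fun z : ℂ => ‖z‖ ^ 2) (h1 v))).mp h

theorem integral_mFourier_eq_zero {v : ι → ℤ} (hv : v ≠ 0) :
    ∫ x, mFourier v x ∂torusMeasure ι = 0 := by
  have h : inner ℂ (ContinuousMap.toLp (E := ℂ) 2 (torusMeasure ι) ℂ (mFourier 0))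
      (ContinuousMap.toLp (E := ℂ) 2 (torusMeasure ι) ℂ (mFourier v)) = 0 :=
    (orthonormal_mFourier (d := ι)).2 hv.symm
  rw [ContinuousMap.inner_toLp] at h
  simp only [mFourier_zero, ContinuousMap.one_apply, map_one, mul_one] at h
  exact h

variable [DecidableEq ι]

theorem torusCoeff_comp_smul (f : UnitAddTorus ι → ℂ) (g : Matrix.SpecialLinearGroup ι ℤ)
    (v : ι → ℤ) : torusCoeff (fun x => f (g • x)) v = torusCoeff f (g.1 *ᵥ v) := by
  rw [torusCoeff, torusCoeff,
    ← (measurePreserving_smul g (torusMeasure ι)).integral_comp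
      (measurableEmbedding_const_smul g) (fun x => mFourier (-(g.1 *ᵥ v)) x * f x)]
  refine integral_congr_ae (Eventually.of_forall fun x => ?_)
  have hg : (g⁻¹).1 *ᵥ -(g.1 *ᵥ v) = -v := by
    have : (g⁻¹).1 * g.1 = 1 := congrArg Subtype.val (inv_mul_cancel g)
    rw [Matrix.mulVec_neg, Matrix.mulVec_mulVec, this, Matrix.one_mulVec]
  simp only [mFourier_smul, hg]

variable {Γ : Type*} [Group Γ] [MulAction Γ (UnitAddTorus ι)]
  {ρ : Γ →* Matrix.SpecialLinearGroup ι ℤ}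

/-- An action on the torus by automorphisms is ergodic if and only if the non-zero orbits of the
dual action on characters are infinite. -/
theorem ergodicSMul_torus_iff [SMulInvariantMeasure Γ (UnitAddTorus ι) (torusMeasure ι)]
    (hρ : ∀ g (x : UnitAddTorus ι), g • x = ρ g • x) :
    ErgodicSMul Γ (UnitAddTorus ι) (torusMeasure ι) ↔
      ∀ v : ι → ℤ, v ≠ 0 → (Set.range fun g => (ρ g).1 *ᵥ v).Infinite := by
  constructor
  · intro herg v hv hfin
    -- the sum of the characters in a finite orbit is invariant, with integral zero
    let F : UnitAddTorus ι → ℝ := fun x => (∑ w ∈ hfin.toFinset, mFourier w x).re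
    have hFc : Continuous F := by fun_prop
    have hFinv : ∀ (g : Γ) x, F (g • x) = F x := fun g x => by
      simp only [F, hρ, mFourier_smul]
      congr 1
      refine Finset.sum_nbij' (fun w => (ρ g⁻¹).1 *ᵥ w) (fun w => (ρ g).1 *ᵥ w) ?_ ?_ ?_ ?_ ?_
      · intro w hw
        simp only [Set.Finite.mem_toFinset] at hw ⊢
        obtain ⟨h, rfl⟩ := hw
        exact ⟨g⁻¹ * h, by simp [Matrix.mulVec_mulVec]⟩
      · intro w hw
        simp only [Set.Finite.mem_toFinset] at hw ⊢
        obtain ⟨h, rfl⟩ := hw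
        exact ⟨g * h, by simp [Matrix.mulVec_mulVec]⟩
      · intro w _
        simp only [Matrix.mulVec_mulVec]
        rw [← Matrix.SpecialLinearGroup.coe_mul, ← map_mul]; simp
      · intro w _
        simp only [Matrix.mulVec_mulVec]
        rw [← Matrix.SpecialLinearGroup.coe_mul, ← map_mul]; simp
      · intro w _
        simp
    have hint : ∫ x, F x ∂torusMeasure ι = 0 := by
      have h1 : ∀ w ∈ hfin.toFinset, Integrable (fun x => mFourier w x) (torusMeasure ι) :=
        fun w _ => (memLp_mFourier w (torusMeasure ι)).integrable le_top
      have h2 : Integrable (fun x => ∑ w ∈ hfin.toFinset, mFourier w x) (torusMeasure ι) :=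
        integrable_finsetSum _ h1
      have h3 := integral_re h2
      change ∫ x, F x ∂torusMeasure ι = _ at h3
      rw [h3, integral_finsetSum _ h1, Finset.sum_eq_zero, map_zero]
      intro w hw
      rw [Set.Finite.mem_toFinset] at hw
      obtain ⟨g, rfl⟩ := hw
      refine integral_mFourier_eq_zero fun h0 => hv ?_
      have h4 := congrArg (fun u => (ρ g⁻¹).1 *ᵥ u) h0
      simp only [Matrix.mulVec_mulVec, Matrix.mulVec_zero] at h4
      rw [← Matrix.SpecialLinearGroup.coe_mul, ← map_mul] at h4
      simpa using h4
    have hopen : IsOpen {x | 0 < F x} := isOpen_lt continuous_const hFc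
    have hF0 : 0 < F 0 := by
      have h1 : ∀ w : ι → ℤ, mFourier w 0 = 1 := fun w => by simp [mFourier]
      have h2 : 0 < hfin.toFinset.card := Finset.card_pos.2 ⟨v, by
        rw [Set.Finite.mem_toFinset]; exact ⟨1, by simp⟩⟩
      simp only [F, h1]
      simpa using h2
    have hconst := aeconst_of_forall_preimage_smul_ae_eq Γ (μ := torusMeasure ι)
      (s := {x | 0 < F x}) hopen.measurableSet.nullMeasurableSet fun g => by
        have : (g • · : UnitAddTorus ι → UnitAddTorus ι) ⁻¹' {x | 0 < F x} = {x | 0 < F x} := by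
          ext x; simp [hFinv]
        exact Eq.eventuallyEq this
    rw [eventuallyConst_set] at hconst
    have hpos := hopen.measure_pos (torusMeasure ι) ⟨0, hF0⟩
    rcases hconst with h | h
    · have hFint : Integrable F (torusMeasure ι) :=
        hFc.integrable_of_hasCompactSupport (HasCompactSupport.of_compactSpace _)
      have h0 : 0 ≤ᵐ[torusMeasure ι] F := by
        filter_upwards [h] with x hx using le_of_lt hx
      have := (integral_eq_zero_iff_of_nonneg_ae h0 hFint).1 hint
      have hfalse : ∀ᵐ _ ∂torusMeasure ι, False := by
        filter_upwards [h, this] with x hx hx'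
        exact absurd hx' (ne_of_gt hx)
      exact hfalse.exists.elim fun _ h => h
    · exact hpos.ne' (by simpa [ae_iff] using h)
  · intro hinf
    refine ⟨fun {s} hs hinv => ?_⟩
    set f : UnitAddTorus ι → ℂ := s.indicator 1 with hf
    have hfL : MemLp f 2 (torusMeasure ι) := (memLp_const 1).indicator hs
    have hcoeff : ∀ v, v ≠ 0 → torusCoeff f v = 0 := by
      intro v hv
      have hconst : ∀ g, torusCoeff f ((ρ g).1 *ᵥ v) = torusCoeff f v := fun g => by
        rw [← torusCoeff_comp_smul]
        refine integral_congr_ae ?_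
        filter_upwards [hinv g] with x hx
        congr 1
        have hx' : (g • x ∈ s) = (x ∈ s) := hx
        rw [← hρ]
        by_cases hxs : x ∈ s
        · exact (Set.indicator_of_mem (f := (1 : UnitAddTorus ι → ℂ)) (hx'.mpr hxs)).trans
            (Set.indicator_of_mem (f := (1 : UnitAddTorus ι → ℂ)) hxs).symm
        · exact (Set.indicator_of_notMem (fun h => hxs (hx'.mp h)) _).trans
            (Set.indicator_of_notMem hxs _).symm
      have hlim := (hasSum_norm_sq_torusCoeff hfL).summable.tendsto_cofinite_zero
      by_contra hne
      have hpos : 0 < ‖torusCoeff f v‖ ^ 2 := by positivity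
      have hev := hlim.eventually_lt_const hpos
      rw [Filter.eventually_cofinite] at hev
      refine hinf v hv (hev.subset ?_)
      rintro _ ⟨g, rfl⟩
      simp [hconst]
    have hfint : Integrable f (torusMeasure ι) := hfL.integrable one_le_two
    have hzero : (fun x => f x - torusCoeff f 0) =ᵐ[torusMeasure ι] 0 := by
      refine ae_eq_zero_of_mFourier (hfint.sub (integrable_const _)) fun v => ?_
      simp only [mul_sub]
      rw [integral_sub (integrable_continuousMap_mul hfint _)
        (integrable_continuousMap_mul (integrable_const _) _), integral_mul_const]
      by_cases hv : v = 0
      · subst hv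
        simp [torusCoeff, mFourier_zero]
      · have := hcoeff (-v) (neg_ne_zero.2 hv)
        rw [torusCoeff, neg_neg] at this
        rw [this, integral_mFourier_eq_zero hv, zero_mul, sub_zero]
    rw [eventuallyConst_set]
    by_cases hc : torusCoeff f 0 = 1
    · left
      filter_upwards [hzero] with x hx
      by_contra hxs
      have h1 : f x = 0 := Set.indicator_of_notMem hxs _
      have h2 : f x - torusCoeff f 0 = 0 := hx
      rw [h1, hc] at h2
      norm_num at h2
    · right
      filter_upwards [hzero] with x hx hxs
      have h1 : f x = 1 := Set.indicator_of_mem hxs _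
      have h2 : f x - torusCoeff f 0 = 0 := hx
      rw [h1] at h2
      exact hc (sub_eq_zero.1 h2).symm

instance : NullSingletonClass (AddCircle.haarAddCircle : Measure UnitAddCircle) where
  measure_singleton x := by
    have h := AddCircle.volume_closedBall 1 (x := (x : UnitAddCircle)) 0
    rw [AddCircle.volume_eq_smul_haarAddCircle] at h
    simpa using h

/-- The kernel of a non-trivial character of the torus is a null set. -/
theorem ae_mFourier_ne_one {v : ι → ℤ} (hv : v ≠ 0) :
    ∀ᵐ x ∂torusMeasure ι, mFourier v x ≠ 1 := by
  obtain ⟨i, hi⟩ := Function.ne_iff.1 hv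
  let φ : UnitAddTorus ι →+ UnitAddCircle :=
    { toFun := fun x => ∑ i, v i • x i
      map_zero' := by simp
      map_add' := fun x y => by simp [Finset.sum_add_distrib] }
  have hφc : Continuous φ := by
    change Continuous fun x : UnitAddTorus ι => ∑ i, v i • x i
    fun_prop
  have hφs : Function.Surjective φ := fun y => by
    induction y using QuotientAddGroup.induction_on with
    | H t =>
      have hi' : (v i : ℝ) ≠ 0 := by exact_mod_cast hi
      refine ⟨Pi.single i ((t / v i : ℝ) : UnitAddCircle), ?_⟩
      change ∑ j, v j • (Pi.single i ((t / v i : ℝ) : UnitAddCircle) : UnitAddTorus ι) j = _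
      rw [Finset.sum_eq_single i (fun j _ hj => by simp [hj]) (by simp), Pi.single_eq_same,
        ← AddCircle.coe_zsmul, zsmul_eq_mul, mul_div_cancel₀ _ hi']
  have hφ : MeasurePreserving φ (torusMeasure ι) AddCircle.haarAddCircle :=
    AddMonoidHom.measurePreserving hφc hφs (by simp)
  have h0 : ∀ᵐ y ∂(AddCircle.haarAddCircle : Measure UnitAddCircle), y ≠ 0 :=
    Measure.ae_ne _ 0
  filter_upwards [hφ.quasiMeasurePreserving.ae h0] with x hx h1
  apply hx
  have h2 : mFourier v x = AddCircle.toCircle (φ x) := by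
    rw [mFourier_eq_prod_zpow]
    congr 1
    change _ = AddCircle.toCircle (∑ i, v i • x i)
    induction (Finset.univ : Finset ι) using Finset.induction_on with
    | empty => simp
    | insert a s ha ih =>
      rw [Finset.prod_insert ha, Finset.sum_insert ha, ih, AddCircle.toCircle_add,
        AddCircle.toCircle_zsmul]
  rw [h2] at h1
  apply AddCircle.injective_toCircle one_ne_zero
  rw [AddCircle.toCircle_zero]
  exact Circle.ext h1

theorem isEssentiallyFree_torus [Countable Γ] (hρ : ∀ g (x : UnitAddTorus ι), g • x = ρ g • x)
    (hinj : Function.Injective ρ) : IsEssentiallyFree Γ (torusMeasure ι) := by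
  rw [IsEssentiallyFree, ae_all_iff]
  intro g
  by_cases hg : g = 1
  · exact Eventually.of_forall fun _ _ => hg
  have hne : ∃ w : ι → ℤ, ((ρ g)⁻¹).1 *ᵥ w ≠ w := by
    by_contra! h
    refine hg (hinj ?_)
    rw [map_one, ← inv_eq_one]
    apply Subtype.ext
    exact Matrix.ext_of_mulVec_single fun i => by
      rw [h]; exact (Matrix.one_mulVec _).symm
  obtain ⟨w, hw⟩ := hne
  filter_upwards [ae_mFourier_ne_one (sub_ne_zero.2 hw)] with x hx hgx
  exfalso
  apply hx
  have h1 : mFourier w x = mFourier (((ρ g)⁻¹).1 *ᵥ w) x := by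
    rw [← mFourier_smul, ← hρ, hgx]
  rw [sub_eq_add_neg, mFourier_add, ← h1, mFourier_neg, Complex.mul_conj, Complex.normSq_eq_norm_sq,
    norm_mFourier_apply]
  simp

end Fourier

/-! ### The action of `Γ` on the characters of the torus -/

section GroupΓ

open Matrix.SpecialLinearGroup (transvection)

variable {k n : ℕ} {Λ : Subgroup (Matrix.SpecialLinearGroup (Fin k) ℤ)}

/-- An element of `Γ`, given by its blocks. -/
def elemΓ (A : Λ) (B : Matrix (Fin k) (Fin n) ℤ) (C : Matrix.SpecialLinearGroup (Fin n) ℤ) :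
    groupΓ n Λ := ⟨blockMatrix A.1 B C 0 0, A.1, A.2, B, C, rfl⟩

theorem exists_eq_elemΓ (g : groupΓ n Λ) : ∃ A B C, g = elemΓ A B C := by
  obtain ⟨_, A, hA, B, C, rfl⟩ := g
  exact ⟨⟨A, hA⟩, B, C, rfl⟩

theorem corner_elemΓ (A : Λ) (B : Matrix (Fin k) (Fin n) ℤ)
    (C : Matrix.SpecialLinearGroup (Fin n) ℤ) :
    (corner (elemΓ A B C)).1 = Matrix.fromBlocks A.1.1 B 0 C.1 := rfl

theorem corner_elemΓ_mulVec (A : Λ) (B : Matrix (Fin k) (Fin n) ℤ)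
    (C : Matrix.SpecialLinearGroup (Fin n) ℤ) (v : Fin k → ℤ) (w : Fin n → ℤ) :
    (corner (elemΓ A B C)).1 *ᵥ Sum.elim v w = Sum.elim (A.1.1 *ᵥ v + B *ᵥ w) (C.1 *ᵥ w) := by
  rw [corner_elemΓ, Matrix.fromBlocks_mulVec]
  simp [Function.comp_def]

theorem corner_injective : Function.Injective (corner (n := n) (Λ := Λ)) := by
  rw [injective_iff_map_eq_one]
  intro g hg
  obtain ⟨A, B, C, rfl⟩ := exists_eq_elemΓ g
  have h1 := congrArg Subtype.val hg
  rw [corner_elemΓ] at h1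
  have h2 : Matrix.fromBlocks A.1.1 B 0 C.1 = Matrix.fromBlocks 1 0 0 1 := by
    rw [h1, Matrix.fromBlocks_one]; rfl
  obtain ⟨hA, hB, _, hC⟩ := Matrix.fromBlocks_inj.1 h2
  apply Subtype.ext
  change blockMatrix A.1 B C 0 0 = 1
  rw [← blockMatrix_one, hB, show A.1 = 1 from Subtype.ext hA, show C = 1 from Subtype.ext hC]

/-- The orbits of `Γ` on `ℤ^{k+n}` are infinite, with the possible exception of those of the
vectors `(v, 0)`, which are the orbits of `Λ` on `ℤ^k`. -/
theorem infinite_orbits_iff (hn : 2 ≤ n) :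
    (∀ u : Fin k ⊕ Fin n → ℤ, u ≠ 0 →
      (Set.range fun g : groupΓ n Λ => (corner g).1 *ᵥ u).Infinite) ↔
      ∀ x : Fin k → ℤ, x ≠ 0 → {y : Fin k → ℤ | ∃ A ∈ Λ, A.1 *ᵥ x = y}.Infinite := by
  constructor
  · intro h x hx hfin
    refine h (Sum.elim x (0 : Fin n → ℤ)) (fun h0 => hx ?_)
      ((hfin.image fun y => (Sum.elim y 0 : Fin k ⊕ Fin n → ℤ)).subset ?_)
    · ext i; exact congrFun h0 (Sum.inl i)
    · rintro _ ⟨g, rfl⟩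
      obtain ⟨A, B, C, rfl⟩ := exists_eq_elemΓ g
      refine ⟨A.1.1 *ᵥ x, ⟨A.1, A.2, rfl⟩, ?_⟩
      change _ = (corner (elemΓ A B C)).1 *ᵥ Sum.elim x 0
      rw [corner_elemΓ_mulVec]
      simp
  · intro h u hu
    obtain ⟨v, w, rfl⟩ : ∃ v w, u = Sum.elim v w :=
      ⟨u ∘ Sum.inl, u ∘ Sum.inr, (Sum.elim_comp_inl_inr u).symm⟩
    by_cases hw : w = 0
    · subst hw
      have hv : v ≠ 0 := fun h0 => hu (by subst h0; ext i; rcases i with i | i <;> rfl)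
      refine Set.Infinite.mono ?_ ((h v hv).image
        (f := fun y : Fin k → ℤ => (Sum.elim y 0 : Fin k ⊕ Fin n → ℤ)) ?_)
      · rintro _ ⟨_, ⟨A, hA, rfl⟩, rfl⟩
        refine ⟨elemΓ ⟨A, hA⟩ 0 1, ?_⟩
        change (corner (elemΓ ⟨A, hA⟩ 0 1)).1 *ᵥ Sum.elim v 0 = _
        rw [corner_elemΓ_mulVec]
        simp
      · intro y _ z _ hyz
        ext i; exact congrFun hyz (Sum.inl i)
    · obtain ⟨j, hj⟩ := Function.ne_iff.1 hw
      have : Nontrivial (Fin n) := Fin.nontrivial_iff_two_le.2 hn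
      obtain ⟨i, hij⟩ := exists_ne j
      have hinj : Function.Injective fun m : ℤ =>
          (corner (elemΓ (1 : Λ) 0 (transvection hij m))).1 *ᵥ Sum.elim v w := by
        intro m m' hm
        have h1 := congrFun hm (Sum.inr i)
        simp only [corner_elemΓ_mulVec, Sum.elim_inr, transvection_mulVec, Pi.add_apply,
          Pi.single_eq_same, add_right_inj] at h1
        exact mul_right_cancel₀ hj h1
      refine (Set.infinite_range_of_injective hinj).mono ?_
      rintro _ ⟨m, rfl⟩
      exact ⟨_, rfl⟩

theorem ergodicSMul_groupΓ_iff (hn : 2 ≤ n) :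
    ErgodicSMul (groupΓ n Λ) (UnitAddTorus (Fin k ⊕ Fin n)) (torusMeasure (Fin k ⊕ Fin n)) ↔
      ∀ x : Fin k → ℤ, x ≠ 0 → {y : Fin k → ℤ | ∃ A ∈ Λ, A.1 *ᵥ x = y}.Infinite :=
  (ergodicSMul_torus_iff groupΓ_smul_def).trans (infinite_orbits_iff hn)

theorem not_ergodicSMul_of_eq_bot (hn : 2 ≤ n) (hk : 1 ≤ k) (hΛ : Λ = ⊥) :
    ¬ ErgodicSMul (groupΓ n Λ) (UnitAddTorus (Fin k ⊕ Fin n)) (torusMeasure (Fin k ⊕ Fin n)) := by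
  rw [ergodicSMul_groupΓ_iff hn]
  intro h
  refine h (Pi.single ⟨0, hk⟩ 1) (by simp) ((Set.finite_singleton (Pi.single ⟨0, hk⟩ 1)).subset ?_)
  rintro _ ⟨A, hA, rfl⟩
  rw [hΛ, Subgroup.mem_bot] at hA
  subst hA
  exact Matrix.one_mulVec _

theorem isEssentiallyFree_groupΓ :
    IsEssentiallyFree (groupΓ n Λ) (torusMeasure (Fin k ⊕ Fin n)) :=
  isEssentiallyFree_torus groupΓ_smul_def corner_injective

end GroupΓ

/-! ### Almost invariant Fourier coefficients -/

section Lattice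

/-- The analogue of `measureReal_compl_zero_le` on the lattice: there is no finite measure on
`ℤ² \ {0}` that is almost invariant under the elementary matrices. -/
theorem measureReal_int_compl_zero_le {μ : Measure (ℤ × ℤ)} [IsFiniteMeasure μ] {c : ℝ}
    (h₁ : ∀ a : ℤ, |a| = 1 → ∀ F : Set (ℤ × ℤ),
      μ.real ((fun z => (z.1, z.2 + a * z.1)) ⁻¹' F) ≤ μ.real F + c)
    (h₂ : ∀ a : ℤ, |a| = 1 → ∀ F : Set (ℤ × ℤ),
      μ.real ((fun z => (z.1 + a * z.2, z.2)) ⁻¹' F) ≤ μ.real F + c) :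
    μ.real {0}ᶜ ≤ 8 * c := by
  let K : ℤ → Set (ℤ × ℤ) := fun a => {z | 0 ≤ a * (z.1 * z.2)}
  let K₁ : ℤ → Set (ℤ × ℤ) := fun a => {z | 0 ≤ a * (z.1 * z.2) ∧ 2 * |z.1| ≤ |z.2|}
  let K₂ : ℤ → Set (ℤ × ℤ) := fun a => {z | 0 ≤ a * (z.1 * z.2) ∧ 2 * |z.2| ≤ |z.1|}
  have habs : ∀ a : ℤ, |a| = 1 → ∀ s t : ℤ, 0 ≤ a * (s * t) →
      0 ≤ a * (s * (t + a * s + a * s)) ∧ 2 * |s| ≤ |t + a * s + a * s| := by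
    intro a ha s t h
    have ha2 : a * a = 1 := by rw [← abs_mul_abs_self, ha, mul_one]
    refine ⟨?_, ?_⟩
    · have : a * (s * (t + a * s + a * s)) = a * (s * t) + 2 * (a * a) * (s * s) := by ring
      rw [this, ha2]
      nlinarith [mul_self_nonneg s]
    · rw [← abs_two, ← abs_mul, ← sq_le_sq]
      nlinarith [sq_nonneg t]
  have e₁ : ∀ a : ℤ, |a| = 1 → μ.real (K a \ K₁ a) ≤ 2 * c := fun a ha => by
    rw [measureReal_sdiff (fun z hz => hz.1) (MeasurableSet.of_discrete)]
    have hsub : K a ⊆ (fun z => (z.1, z.2 + a * z.1)) ⁻¹'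
        ((fun z => (z.1, z.2 + a * z.1)) ⁻¹' K₁ a) := fun z hz => habs a ha z.1 z.2 hz
    linarith [measureReal_mono (μ := μ) hsub, h₁ a ha ((fun z => (z.1, z.2 + a * z.1)) ⁻¹' K₁ a),
      h₁ a ha (K₁ a)]
  have e₂ : ∀ a : ℤ, |a| = 1 → μ.real (K a \ K₂ a) ≤ 2 * c := fun a ha => by
    rw [measureReal_sdiff (fun z hz => hz.1) (MeasurableSet.of_discrete)]
    have hsub : K a ⊆ (fun z => (z.1 + a * z.2, z.2)) ⁻¹'
        ((fun z => (z.1 + a * z.2, z.2)) ⁻¹' K₂ a) := fun z hz => by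
      have := habs a ha z.2 z.1 (by rw [mul_comm z.2]; exact hz)
      exact ⟨by rw [mul_comm (_ + _)]; exact this.1, this.2⟩
    linarith [measureReal_mono (μ := μ) hsub, h₂ a ha ((fun z => (z.1 + a * z.2, z.2)) ⁻¹' K₂ a),
      h₂ a ha (K₂ a)]
  have hcone : ∀ a : ℤ, ∀ z ≠ 0, 0 ≤ a * (z.1 * z.2) → z ∈ (K a \ K₁ a) ∪ (K a \ K₂ a) := by
    intro a z hz0 hza
    by_cases h : 2 * |z.1| ≤ |z.2|
    · refine Or.inr ⟨hza, fun h2 => hz0 ?_⟩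
      have h2 := h2.2
      have h3 : |z.1| = 0 := by linarith [abs_nonneg z.1, abs_nonneg z.2]
      have h4 : |z.2| = 0 := by linarith [abs_nonneg z.1, abs_nonneg z.2]
      exact Prod.ext (abs_eq_zero.1 h3) (abs_eq_zero.1 h4)
    · exact Or.inl ⟨hza, fun h2 => h h2.2⟩
  have hcov : ({0}ᶜ : Set (ℤ × ℤ)) ⊆ ((K 1 \ K₁ 1) ∪ (K 1 \ K₂ 1)) ∪
      ((K (-1) \ K₁ (-1)) ∪ (K (-1) \ K₂ (-1))) := by
    intro z hz
    rcases le_total 0 (z.1 * z.2) with h | h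
    · exact Or.inl (hcone 1 z hz (by simpa using h))
    · exact Or.inr (hcone (-1) z hz (by simpa using h))
  have hb : ∀ a : ℤ, |a| = 1 → μ.real ((K a \ K₁ a) ∪ (K a \ K₂ a)) ≤ 4 * c := fun a ha =>
    (measureReal_union_le _ _).trans (by linarith [e₁ a ha, e₂ a ha])
  calc μ.real {0}ᶜ ≤ _ := measureReal_mono hcov
    _ ≤ _ := measureReal_union_le _ _
    _ ≤ 8 * c := by linarith [hb 1 (by simp), hb (-1) (by simp)]

/-- The measure on a countable set with the given point masses. -/
def massMeasure {V : Type*} [MeasurableSpace V] (q : V → ℝ) : Measure V :=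
  Measure.sum fun v => ENNReal.ofReal (q v) • Measure.dirac v

variable {V : Type*} [MeasurableSpace V] [DiscreteMeasurableSpace V] {q : V → ℝ}

theorem massMeasure_apply (A : Set V) :
    massMeasure q A = ∑' v, ENNReal.ofReal (A.indicator q v) := by
  rw [massMeasure, Measure.sum_apply _ MeasurableSet.of_discrete]
  refine tsum_congr fun v => ?_
  by_cases hv : v ∈ A <;> simp [hv]

theorem massMeasure_real (hq : ∀ v, 0 ≤ q v) (A : Set V) :
    (massMeasure q).real A = ∑' v, A.indicator q v := by
  rw [measureReal_def, massMeasure_apply, ENNReal.tsum_toReal_eq (fun _ => ENNReal.ofReal_ne_top)]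
  exact tsum_congr fun v => ENNReal.toReal_ofReal (Set.indicator_nonneg (fun v _ => hq v) v)

theorem isFiniteMeasure_massMeasure (hs : Summable q) :
    IsFiniteMeasure (massMeasure q) :=
  ⟨by rw [massMeasure_apply, Set.indicator_univ]; exact hs.tsum_ofReal_lt_top⟩

/-- A bijection that almost preserves a square summable function almost preserves the measure
with density its square. -/
theorem massMeasure_preimage_le {c : V → ℂ} (hc : Summable fun v => ‖c v‖ ^ 2)
    (hc1 : ∑' v, ‖c v‖ ^ 2 ≤ 1) (e : V ≃ V) {t D : ℝ} (ht : 0 < t)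
    (hs : Summable fun v => ‖c (e v) - c v‖ ^ 2) (hD : ∑' v, ‖c (e v) - c v‖ ^ 2 ≤ D) (A : Set V) :
    (massMeasure fun v => ‖c v‖ ^ 2).real (e ⁻¹' A) ≤
      (massMeasure fun v => ‖c v‖ ^ 2).real A + (t + (1 + 1 / t) * D) := by
  rw [massMeasure_real (fun v => by positivity), massMeasure_real (fun v => by positivity)]
  set q : V → ℝ := fun v => ‖c v‖ ^ 2
  have hqe : Summable fun v => A.indicator q (e v) := (hc.indicator A).comp_injective e.injective
  have hpt : ∀ v, (e ⁻¹' A).indicator q v ≤ (A.indicator q (e v) + t * q (e v)) +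
      (1 + 1 / t) * ‖c (e v) - c v‖ ^ 2 := fun v => by
    by_cases hv : e v ∈ A
    · rw [Set.indicator_of_mem (show v ∈ e ⁻¹' A from hv), Set.indicator_of_mem hv]
      have h1 : ‖c v‖ ≤ ‖c (e v)‖ + ‖c (e v) - c v‖ := by
        have := norm_sub_le (c (e v)) (c (e v) - c v)
        rwa [sub_sub_cancel] at this
      have h2 : 2 * (‖c (e v)‖ * ‖c (e v) - c v‖) ≤
          t * ‖c (e v)‖ ^ 2 + 1 / t * ‖c (e v) - c v‖ ^ 2 := by
        have h3 : t * ‖c (e v)‖ ^ 2 + 1 / t * ‖c (e v) - c v‖ ^ 2 -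
            2 * (‖c (e v)‖ * ‖c (e v) - c v‖) =
            1 / t * (t * ‖c (e v)‖ - ‖c (e v) - c v‖) ^ 2 := by
          field_simp; ring
        have h4 : 0 ≤ 1 / t * (t * ‖c (e v)‖ - ‖c (e v) - c v‖) ^ 2 := by positivity
        linarith
      have h5 := pow_le_pow_left₀ (norm_nonneg _) h1 2
      simp only [q]
      nlinarith
    · rw [Set.indicator_of_notMem (show v ∉ e ⁻¹' A from hv), Set.indicator_of_notMem hv]
      positivity
  have hsum1 := e.tsum_eq (fun v => A.indicator q v)
  have hsum2 := e.tsum_eq q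
  have hq' : Summable fun v => q (e v) := hc.comp_injective e.injective
  calc _ ≤ ∑' v, ((A.indicator q (e v) + t * q (e v)) + (1 + 1 / t) * ‖c (e v) - c v‖ ^ 2) :=
        Summable.tsum_le_tsum hpt (hc.indicator _)
          ((hqe.add (hq'.mul_left t)).add (hs.mul_left _))
    _ = (∑' v, A.indicator q (e v) + t * ∑' v, q (e v)) +
        (1 + 1 / t) * ∑' v, ‖c (e v) - c v‖ ^ 2 := by
      rw [Summable.tsum_add (hqe.add (hq'.mul_left t)) (hs.mul_left _),
        Summable.tsum_add hqe (hq'.mul_left t), tsum_mul_left, tsum_mul_left]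
    _ ≤ (∑' v, A.indicator q v + t * 1) + (1 + 1 / t) * D := by
      rw [hsum1, hsum2]
      gcongr
    _ = _ := by ring

end Lattice

section Coefficients

open Matrix.SpecialLinearGroup (transvection)

variable {k n : ℕ} {Λ : Subgroup (Matrix.SpecialLinearGroup (Fin k) ℤ)}

theorem torusCoeff_sub {ι : Type*} [Fintype ι] {f g : UnitAddTorus ι → ℂ}
    (hf : MemLp f 2 (torusMeasure ι)) (hg : MemLp g 2 (torusMeasure ι)) (v : ι → ℤ) :
    torusCoeff (fun x => f x - g x) v = torusCoeff f v - torusCoeff g v := by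
  simp only [torusCoeff, mul_sub]
  exact integral_sub (integrable_continuousMap_mul (hf.integrable one_le_two) _)
    (integrable_continuousMap_mul (hg.integrable one_le_two) _)

/-- The Fourier coefficients of a function that is almost invariant under the elementary matrices
of `SL(n, ℤ)` are concentrated on the characters of `ℤ^k`. -/
theorem massMeasure_torusCoeff_le (hn : 2 ≤ n) (Λ : Subgroup (Matrix.SpecialLinearGroup (Fin k) ℤ))
    {f : UnitAddTorus (Fin k ⊕ Fin n) → ℂ}
    (hf : MemLp f 2 (torusMeasure (Fin k ⊕ Fin n)))
    (hf1 : ∫ x, ‖f x‖ ^ 2 ∂torusMeasure (Fin k ⊕ Fin n) ≤ 1) {t D : ℝ} (ht : 0 < t)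
    (hD : ∀ (i j : Fin n) (hij : i ≠ j) (a : ℤ), |a| = 1 →
      ∫ x, ‖f (elemΓ (1 : Λ) 0 (transvection hij a) • x) - f x‖ ^ 2
        ∂torusMeasure (Fin k ⊕ Fin n) ≤ D) :
    (massMeasure fun v => ‖torusCoeff f v‖ ^ 2).real {u | u ∘ Sum.inr ≠ 0} ≤
      n * (8 * (t + (1 + 1 / t) * D)) := by
  have hsum := hasSum_norm_sq_torusCoeff hf
  set μ := massMeasure fun v => ‖torusCoeff f v‖ ^ 2 with hμ
  have : IsFiniteMeasure μ := isFiniteMeasure_massMeasure hsum.summable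
  have key : ∀ (i j : Fin n) (hij : i ≠ j) (a : ℤ), |a| = 1 →
      ∀ A : Set (Fin k ⊕ Fin n → ℤ),
      μ.real ((fun u => (corner (elemΓ (1 : Λ) 0 (transvection hij a))).1 *ᵥ u) ⁻¹' A) ≤
        μ.real A + (t + (1 + 1 / t) * D) := by
    intro i j hij a ha A
    set g := elemΓ (1 : Λ) 0 (transvection hij a) with hg
    let e : (Fin k ⊕ Fin n → ℤ) ≃ (Fin k ⊕ Fin n → ℤ) :=
      { toFun := fun u => (corner g).1 *ᵥ u
        invFun := fun u => ((corner g)⁻¹).1 *ᵥ u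
        left_inv := fun u => by
          have h1 : ((corner g)⁻¹).1 * (corner g).1 = 1 :=
            congrArg Subtype.val (inv_mul_cancel (corner g))
          simp only [Matrix.mulVec_mulVec, h1, Matrix.one_mulVec]
        right_inv := fun u => by
          have h1 : (corner g).1 * ((corner g)⁻¹).1 = 1 :=
            congrArg Subtype.val (mul_inv_cancel (corner g))
          simp only [Matrix.mulVec_mulVec, h1, Matrix.one_mulVec] }
    have hfg : MemLp (fun x => f (g • x)) 2 (torusMeasure (Fin k ⊕ Fin n)) :=
      hf.comp_measurePreserving (measurePreserving_smul g _)
    have hs := hasSum_norm_sq_torusCoeff (hfg.sub hf)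
    have he : (fun v => ‖torusCoeff ((fun x => f (g • x)) - f) v‖ ^ 2) =
        fun v => ‖torusCoeff f (e v) - torusCoeff f v‖ ^ 2 := by
      funext v
      change ‖torusCoeff (fun x => f (g • x) - f x) v‖ ^ 2 = _
      rw [torusCoeff_sub hfg hf]
      exact congrArg (fun z => ‖z - torusCoeff f v‖ ^ 2) (torusCoeff_comp_smul f (corner g) v)
    rw [he] at hs
    exact massMeasure_preimage_le hsum.summable (hsum.tsum_eq.trans_le hf1) e ht hs.summable
      (hs.tsum_eq.trans_le (hD i j hij a ha)) A
  have hcol : ∀ (i j : Fin n), i ≠ j →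
      μ.real {u | (u (Sum.inr i), u (Sum.inr j)) ≠ (0 : ℤ × ℤ)} ≤
        8 * (t + (1 + 1 / t) * D) := by
    intro i j hij
    let φ : (Fin k ⊕ Fin n → ℤ) → ℤ × ℤ := fun u => (u (Sum.inr i), u (Sum.inr j))
    have hφ : Measurable φ := measurable_of_countable φ
    have hreal : ∀ F, (μ.map φ).real F = μ.real (φ ⁻¹' F) := fun F =>
      map_measureReal_apply hφ MeasurableSet.of_discrete
    have hact : ∀ (i j l : Fin n) (hij : i ≠ j) (a : ℤ) (u : Fin k ⊕ Fin n → ℤ),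
        ((corner (elemΓ (1 : Λ) 0 (transvection hij a))).1 *ᵥ u) (Sum.inr l) =
          u (Sum.inr l) + (Pi.single i (a * u (Sum.inr j)) : Fin n → ℤ) l := by
      intro i j l hij a u
      conv_lhs => rw [← Sum.elim_comp_inl_inr u]
      rw [corner_elemΓ_mulVec, Sum.elim_inr, transvection_mulVec]
      rfl
    have h8 := measureReal_int_compl_zero_le (μ := μ.map φ) (c := t + (1 + 1 / t) * D)
      (fun a ha F => by
        rw [hreal, hreal]
        convert key j i hij.symm a ha (φ ⁻¹' F) using 2
        ext u
        simp [φ, hact, hij])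
      (fun a ha F => by
        rw [hreal, hreal]
        convert key i j hij a ha (φ ⁻¹' F) using 2
        ext u
        simp [φ, hact, hij.symm])
    rw [hreal] at h8
    exact h8
  have : Nontrivial (Fin n) := Fin.nontrivial_iff_two_le.2 hn
  choose σ hσ using fun i : Fin n => exists_ne i
  have hsub : {u : Fin k ⊕ Fin n → ℤ | u ∘ Sum.inr ≠ 0} ⊆
      ⋃ i : Fin n, {u | (u (Sum.inr i), u (Sum.inr (σ i))) ≠ (0 : ℤ × ℤ)} := by
    intro u hu
    obtain ⟨i, hi⟩ := Function.ne_iff.1 hu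
    exact Set.mem_iUnion.2 ⟨i, fun h => hi (congrArg Prod.fst h)⟩
  calc _ ≤ _ := measureReal_mono hsub
    _ ≤ ∑ i : Fin n, μ.real {u | (u (Sum.inr i), u (Sum.inr (σ i))) ≠ (0 : ℤ × ℤ)} :=
      measureReal_iUnion_fintype_le _
    _ ≤ ∑ _i : Fin n, 8 * (t + (1 + 1 / t) * D) :=
      Finset.sum_le_sum fun i _ => hcol i (σ i) (hσ i).symm
    _ = _ := by simp

end Coefficients

/-! ### Strong ergodicity -/

section StrongErgodicity

open UnitAddTorus
open Matrix.SpecialLinearGroup (transvection)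

variable {k n : ℕ} {Λ : Subgroup (Matrix.SpecialLinearGroup (Fin k) ℤ)}

/-- The projection of the torus `𝕋^{k+n}` to `𝕋^k`. -/
def torusFst (x : UnitAddTorus (Fin k ⊕ Fin n)) : UnitAddTorus (Fin k) := fun i => x (Sum.inl i)

theorem measurePreserving_torusProd :
    MeasurePreserving (MeasurableEquiv.sumPiEquivProdPi fun _ : Fin k ⊕ Fin n => UnitAddCircle)
      (torusMeasure (Fin k ⊕ Fin n)) ((torusMeasure (Fin k)).prod (torusMeasure (Fin n))) :=
  measurePreserving_sumPiEquivProdPi fun _ => AddCircle.haarAddCircle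

theorem measurePreserving_torusFst :
    MeasurePreserving (torusFst (k := k) (n := n)) (torusMeasure (Fin k ⊕ Fin n))
      (torusMeasure (Fin k)) :=
  measurePreserving_fst.comp measurePreserving_torusProd

theorem torusFst_elemΓ_smul (A : Λ) (B : Matrix (Fin k) (Fin n) ℤ)
    (C : Matrix.SpecialLinearGroup (Fin n) ℤ) (x : UnitAddTorus (Fin k ⊕ Fin n)) :
    torusFst (elemΓ A B C • x) = A • torusFst x := by
  have hinv : ∃ B', (elemΓ A B C)⁻¹ = elemΓ A⁻¹ B' C⁻¹ := ⟨_, Subtype.ext <| by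
    change (blockMatrix A.1 B C 0 0)⁻¹ = blockMatrix _ _ _ 0 0
    rw [blockMatrix_inv, Matrix.mulVec_zero, Matrix.mulVec_zero, Matrix.mulVec_zero, add_zero,
      neg_zero, neg_zero]; rfl⟩
  obtain ⟨B', hB'⟩ := hinv
  funext i
  change ∑ j, ((corner (elemΓ A B C))⁻¹).1 j (Sum.inl i) • x j = ∑ j, (A.1⁻¹).1 j i • x (Sum.inl j)
  rw [← map_inv, hB', Fintype.sum_sum_type]
  simp [corner_elemΓ]

theorem image_smul_eq_preimage {G X : Type*} [Group G] [MulAction G X] (g : G) (S : Set X) :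
    (fun x => g • x) '' S = (fun x => g⁻¹ • x) ⁻¹' S :=
  (Set.preimage_smul_inv g S).symm

theorem measureReal_symmDiff_preimage {X Y : Type*} [MeasurableSpace X] [MeasurableSpace Y]
    {μ : Measure X} {ν : Measure Y} {f : X → Y} (hf : MeasurePreserving f μ ν) {S T : Set Y}
    (hS : MeasurableSet S) (hT : MeasurableSet T) :
    μ.real (symmDiff (f ⁻¹' S) (f ⁻¹' T)) = ν.real (symmDiff S T) := by
  rw [← hf.measureReal_preimage (hS.symmDiff hT).nullMeasurableSet]
  rfl

theorem preimage_torusFst_image (A : Λ) (B : Matrix (Fin k) (Fin n) ℤ)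
    (C : Matrix.SpecialLinearGroup (Fin n) ℤ) (S : Set (UnitAddTorus (Fin k))) :
    (fun x : UnitAddTorus (Fin k ⊕ Fin n) => elemΓ A B C • x) '' (torusFst ⁻¹' S) =
      torusFst ⁻¹' ((fun x => A • x) '' S) := by
  rw [image_smul_eq_preimage, image_smul_eq_preimage]
  ext x
  have h := torusFst_elemΓ_smul A B C ((elemΓ A B C)⁻¹ • x)
  rw [smul_inv_smul] at h
  simp only [Set.mem_preimage, h, inv_smul_smul]

theorem measurableSet_image_smul {G X : Type*} [Group G] [MeasurableSpace X] [MulAction G X]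
    [MeasurableConstSMul G X] (g : G) {S : Set X} (hS : MeasurableSet S) :
    MeasurableSet ((fun x => g • x) '' S) := by
  rw [image_smul_eq_preimage]
  exact measurable_const_smul _ hS

theorem isStronglyErgodic_of_groupΓ
    (h : IsStronglyErgodic (groupΓ n Λ) (torusMeasure (Fin k ⊕ Fin n))) :
    IsStronglyErgodic Λ (torusMeasure (Fin k)) := by
  intro S hS hinv
  have := h (fun i => torusFst ⁻¹' S i) (fun i => measurePreserving_torusFst.measurable (hS i))
    fun g => by
      obtain ⟨A, B, C, rfl⟩ := exists_eq_elemΓ g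
      refine (hinv A).congr fun i => ?_
      rw [preimage_torusFst_image, measureReal_symmDiff_preimage measurePreserving_torusFst
        (measurableSet_image_smul A (hS i)) (hS i)]
  refine this.congr fun i => ?_
  rw [measurePreserving_torusFst.measureReal_preimage (hS i).nullMeasurableSet]

theorem mFourier_sumElim (v : Fin k → ℤ) (w : Fin n → ℤ) (x : UnitAddTorus (Fin k ⊕ Fin n)) :
    mFourier (Sum.elim v w) x = mFourier v (torusFst x) * mFourier w fun j => x (Sum.inr j) := by
  simp [mFourier, Fintype.prod_sum_type, torusFst]

/-- The average of a function on `𝕋^{k+n}` over the fibres of the projection to `𝕋^k`. -/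
def fibreMean (f : UnitAddTorus (Fin k ⊕ Fin n) → ℂ) (a : UnitAddTorus (Fin k)) : ℂ :=
  ∫ b, f (Sum.elim a b) ∂torusMeasure (Fin n)

/-- Averaging over the fibres is the projection onto the span of the characters of `ℤ^k`. -/
theorem torusCoeff_fibreMean {f : UnitAddTorus (Fin k ⊕ Fin n) → ℂ}
    (hf : Integrable f (torusMeasure (Fin k ⊕ Fin n))) (u : Fin k ⊕ Fin n → ℤ) :
    torusCoeff (fun x => fibreMean f (torusFst x)) u =
      {u : Fin k ⊕ Fin n → ℤ | u ∘ Sum.inr ≠ 0}ᶜ.indicator (torusCoeff f) u := by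
  classical
  obtain ⟨v, w, rfl⟩ : ∃ v w, u = Sum.elim v w :=
    ⟨u ∘ Sum.inl, u ∘ Sum.inr, (Sum.elim_comp_inl_inr u).symm⟩
  have hneg : -(Sum.elim v w : Fin k ⊕ Fin n → ℤ) = Sum.elim (-v) (-w) := by
    ext i; rcases i with i | i <;> rfl
  have htr : ∀ F : UnitAddTorus (Fin k ⊕ Fin n) → ℂ, ∫ x, F x ∂torusMeasure (Fin k ⊕ Fin n) =
      ∫ z, F (Sum.elim z.1 z.2) ∂(torusMeasure (Fin k)).prod (torusMeasure (Fin n)) := fun F => by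
    rw [← (measurePreserving_torusProd (k := k) (n := n)).integral_comp
      (MeasurableEquiv.measurableEmbedding _) fun z => F (Sum.elim z.1 z.2)]
    refine integral_congr_ae (Eventually.of_forall fun x => ?_)
    exact congrArg F (Sum.elim_comp_inl_inr x).symm
  have hleft : torusCoeff (fun x => fibreMean f (torusFst x)) (Sum.elim v w) =
      (∫ a, mFourier (-v) a * fibreMean f a ∂torusMeasure (Fin k)) *
        ∫ b, mFourier (-w) b ∂torusMeasure (Fin n) := by
    rw [torusCoeff, htr, ← integral_prod_mul]
    refine integral_congr_ae (Eventually.of_forall fun z => ?_)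
    simp only [hneg, mFourier_sumElim]
    change mFourier (-v) z.1 * mFourier (-w) z.2 * fibreMean f z.1 = _
    ring
  rw [hleft]
  by_cases hw : w = 0
  · subst hw
    rw [Set.indicator_of_mem (by simp), neg_zero, mFourier_zero]
    simp only [ContinuousMap.one_apply, integral_const, probReal_univ, one_smul, mul_one]
    have hint : Integrable (fun z : UnitAddTorus (Fin k) × UnitAddTorus (Fin n) =>
        mFourier (-Sum.elim v (0 : Fin n → ℤ)) (Sum.elim z.1 z.2) * f (Sum.elim z.1 z.2))
        ((torusMeasure (Fin k)).prod (torusMeasure (Fin n))) :=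
      (measurePreserving_torusProd (k := k) (n := n)).symm.integrable_comp_of_integrable
        (integrable_continuousMap_mul hf (mFourier (-Sum.elim v 0)))
    rw [torusCoeff, htr, integral_prod _ hint]
    refine integral_congr_ae (Eventually.of_forall fun a => ?_)
    simp only [fibreMean, hneg, mFourier_sumElim, neg_zero, mFourier_zero,
      ContinuousMap.one_apply, mul_one]
    exact (integral_const_mul _ _).symm
  · rw [integral_mFourier_eq_zero (neg_ne_zero.2 hw), mul_zero, Set.indicator_of_notMem]
    simpa using hw

/-- A measurable set is close to a union of fibres of the projection to `𝕋^k`, if the Fourier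
coefficients of its indicator function are concentrated on the characters of `ℤ^k`. -/
theorem exists_measureReal_symmDiff_torusFst_le {S : Set (UnitAddTorus (Fin k ⊕ Fin n))}
    (hS : MeasurableSet S) : ∃ S' : Set (UnitAddTorus (Fin k)), MeasurableSet S' ∧
      (torusMeasure (Fin k ⊕ Fin n)).real (symmDiff (torusFst ⁻¹' S') S) ≤
        4 * (massMeasure fun v => ‖torusCoeff (S.indicator 1) v‖ ^ 2).real
          {u | u ∘ Sum.inr ≠ 0} := by
  set f : UnitAddTorus (Fin k ⊕ Fin n) → ℂ := S.indicator 1 with hf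
  have hfm : Measurable f := measurable_one.indicator hS
  have hfL : MemLp f 2 (torusMeasure (Fin k ⊕ Fin n)) := (memLp_const 1).indicator hS
  have hgm : StronglyMeasurable (fibreMean f) := by
    refine StronglyMeasurable.integral_prod_right (f := fun a b => f (Sum.elim a b)) ?_
    exact (hfm.comp (MeasurableEquiv.sumPiEquivProdPi
      fun _ : Fin k ⊕ Fin n => UnitAddCircle).symm.measurable).stronglyMeasurable
  have hgb : ∀ a, ‖fibreMean f a‖ ≤ 1 := fun a => by
    have h1 := norm_integral_le_of_norm_le_const (μ := torusMeasure (Fin n)) (C := 1)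
      (Eventually.of_forall fun b => show ‖f (Sum.elim a b)‖ ≤ 1 by
        refine (norm_indicator_le_norm_self _ _).trans ?_
        simp)
    simpa [fibreMean] using h1
  have hgL : MemLp (fun x => fibreMean f (torusFst x)) 2 (torusMeasure (Fin k ⊕ Fin n)) :=
    MemLp.of_bound (hgm.comp_measurable measurePreserving_torusFst.measurable).aestronglyMeasurable
      1 (Eventually.of_forall fun x => hgb _)
  have hS' : MeasurableSet {a | 1 / 2 < (fibreMean f a).re} :=
    measurableSet_lt measurable_const (Complex.measurable_re.comp hgm.measurable)
  refine ⟨_, hS', ?_⟩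
  have hsum := hasSum_norm_sq_torusCoeff (hfL.sub hgL)
  have hcoeff : (fun v => ‖torusCoeff (f - fun x => fibreMean f (torusFst x)) v‖ ^ 2) =
      {u : Fin k ⊕ Fin n → ℤ | u ∘ Sum.inr ≠ 0}.indicator fun v => ‖torusCoeff f v‖ ^ 2 := by
    funext u
    change ‖torusCoeff (fun x => f x - fibreMean f (torusFst x)) u‖ ^ 2 = _
    rw [torusCoeff_sub hfL hgL, torusCoeff_fibreMean (hfL.integrable one_le_two)]
    by_cases hu : u ∈ {u : Fin k ⊕ Fin n → ℤ | u ∘ Sum.inr ≠ 0}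
    · rw [Set.indicator_of_mem hu, Set.indicator_of_notMem (not_not_intro hu), sub_zero]
    · rw [Set.indicator_of_notMem hu, Set.indicator_of_mem hu, sub_self, norm_zero]
      norm_num
  rw [hcoeff] at hsum
  replace hsum : HasSum _
    (∫ x, ‖f x - fibreMean f (torusFst x)‖ ^ 2 ∂torusMeasure (Fin k ⊕ Fin n)) := hsum
  rw [massMeasure_real (fun v => by positivity), hsum.tsum_eq]
  have hmarkov := mul_meas_ge_le_integral_of_nonneg (μ := torusMeasure (Fin k ⊕ Fin n))
    (f := fun x => ‖f x - fibreMean f (torusFst x)‖ ^ 2)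
    (Eventually.of_forall fun x => by positivity) ((hfL.sub hgL).integrable_norm_pow two_ne_zero)
    (1 / 4)
  have hsub : symmDiff (torusFst ⁻¹' {a | 1 / 2 < (fibreMean f a).re}) S ⊆
      {x | 1 / 4 ≤ ‖f x - fibreMean f (torusFst x)‖ ^ 2} := by
    intro x hx
    have h1 : 1 / 2 ≤ |(f x - fibreMean f (torusFst x)).re| := by
      rcases hx with ⟨h1, h2⟩ | ⟨h1, h2⟩
      · rw [show f x = 0 from Set.indicator_of_notMem h2 _, zero_sub, Complex.neg_re, abs_neg]
        exact (le_of_lt h1).trans (le_abs_self _)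
      · rw [show f x = 1 from Set.indicator_of_mem h1 _, Complex.sub_re, Complex.one_re]
        have h3 : (fibreMean f (torusFst x)).re ≤ 1 / 2 := not_lt.1 h2
        exact le_trans (by linarith) (le_abs_self _)
    have h2 := h1.trans (Complex.abs_re_le_norm _)
    change 1 / 4 ≤ ‖f x - fibreMean f (torusFst x)‖ ^ 2
    nlinarith
  have hmono := measureReal_mono (μ := torusMeasure (Fin k ⊕ Fin n)) hsub
  linarith

theorem integral_norm_sq_indicator_comp_sub {X : Type*} [MeasurableSpace X] {μ : Measure X}
    {f : X → X} (hf : Measurable f) {S : Set X} (hS : MeasurableSet S) :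
    ∫ x, ‖S.indicator (1 : X → ℂ) (f x) - S.indicator 1 x‖ ^ 2 ∂μ =
      μ.real (symmDiff (f ⁻¹' S) S) := by
  rw [← integral_indicator_one ((hf hS).symmDiff hS)]
  refine integral_congr_ae (Eventually.of_forall fun x => ?_)
  by_cases h1 : f x ∈ S <;> by_cases h2 : x ∈ S <;>
    simp [Set.indicator, Set.mem_symmDiff, h1, h2]

/-- Asymptotically invariant sets in `𝕋^{k+n}` come from asymptotically invariant sets in
`𝕋^k`. -/
theorem isStronglyErgodic_groupΓ (hn : 2 ≤ n) (h : IsStronglyErgodic Λ (torusMeasure (Fin k))) :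
    IsStronglyErgodic (groupΓ n Λ) (torusMeasure (Fin k ⊕ Fin n)) := by
  intro S hS hinv
  set μ := torusMeasure (Fin k ⊕ Fin n) with hμ
  choose S' hS'm hS' using fun i => exists_measureReal_symmDiff_torusFst_le (hS i)
  have hclose : Tendsto (fun i => μ.real (symmDiff (torusFst ⁻¹' S' i) (S i))) atTop (𝓝 0) := by
    rw [Metric.tendsto_atTop']
    intro ε hε
    have hn0 : (0 : ℝ) < n := by exact_mod_cast (by omega : 0 < n)
    -- the bound `4 n · 8 (t + (1 + 1 / t) D)` becomes `64 n t`
    set t : ℝ := ε / (65 * n) with ht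
    have ht0 : 0 < t := by positivity
    set D : ℝ := t / (1 + 1 / t) with hD
    have hD0 : 0 < D := by positivity
    have hev : ∀ᶠ i in atTop, ∀ (p q : Fin n) (hpq : p ≠ q), ∀ a ∈ ({1, -1} : Finset ℤ),
        μ.real (symmDiff ((fun x => (elemΓ (1 : Λ) 0 (transvection hpq a))⁻¹ • x) '' S i) (S i)) <
          D := by
      simp only [eventually_all, Finset.eventually_all]
      exact fun p q hpq a _ => (hinv _).eventually_lt_const hD0
    obtain ⟨N, hN⟩ := eventually_atTop.1 hev
    refine ⟨N, fun i hi => ?_⟩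
    rw [Real.dist_eq, sub_zero, abs_of_nonneg measureReal_nonneg]
    have hfL : MemLp ((S i).indicator (1 : UnitAddTorus (Fin k ⊕ Fin n) → ℂ)) 2 μ :=
      (memLp_const 1).indicator (hS i)
    have hb := massMeasure_torusCoeff_le hn Λ hfL (by
      have h1 : ∀ x, ‖(S i).indicator (1 : UnitAddTorus (Fin k ⊕ Fin n) → ℂ) x‖ ^ 2 =
          (S i).indicator (1 : UnitAddTorus (Fin k ⊕ Fin n) → ℝ) x :=
        fun x => by by_cases hx : x ∈ S i <;> simp [hx]
      simp only [h1]
      rw [integral_indicator_one (hS i)]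
      exact measureReal_le_one) ht0 (D := D) fun p q hpq a ha => by
        rw [integral_norm_sq_indicator_comp_sub (measurable_const_smul _) (hS i)]
        have h1 := hN i hi.le p q hpq a (by
          rcases (abs_eq zero_le_one).1 ha with rfl | rfl <;> simp)
        rw [image_smul_eq_preimage, inv_inv] at h1
        exact h1.le
    have ht' : (1 + 1 / t) * D = t := mul_div_cancel₀ _ (by positivity)
    rw [ht'] at hb
    have hfin : 64 * (n * t) < ε := by
      have : 65 * (n * t) = ε := by rw [ht]; field_simp
      nlinarith [mul_pos hn0 ht0]
    linarith [hS' i]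
  have hS'inv : ∀ A : Λ, Tendsto (fun i => (torusMeasure (Fin k)).real
      (symmDiff ((fun x => A • x) '' S' i) (S' i))) atTop (𝓝 0) := by
    intro A
    have hlim := (hclose.add (hinv (elemΓ A 0 1))).add hclose
    simp only [add_zero] at hlim
    refine squeeze_zero (fun _ => measureReal_nonneg) (fun i => ?_) hlim
    have hSA := measurableSet_image_smul A (hS'm i)
    rw [← measureReal_symmDiff_preimage (measurePreserving_torusFst (n := n)) hSA (hS'm i),
      ← preimage_torusFst_image A 0 1]
    set g := elemΓ A (0 : Matrix (Fin k) (Fin n) ℤ) 1 with hg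
    have hP := measurePreserving_torusFst (n := n) |>.measurable (hS'm i)
    have h1 : μ.real (symmDiff ((fun x => g • x) '' (torusFst ⁻¹' S' i))
        ((fun x => g • x) '' S i)) = μ.real (symmDiff (torusFst ⁻¹' S' i) (S i)) := by
      rw [image_smul_eq_preimage, image_smul_eq_preimage,
        measureReal_symmDiff_preimage (measurePreserving_smul g⁻¹ μ) hP (hS i)]
    have h2 := measureReal_symmDiff_le (μ := μ)
      (s := (fun x => g • x) '' (torusFst ⁻¹' S' i)) (t := (fun x => g • x) '' S i)
      (torusFst ⁻¹' S' i)
    have h3 := measureReal_symmDiff_le (μ := μ)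
      (s := (fun x => g • x) '' S i) (t := S i) (torusFst ⁻¹' S' i)
    rw [symmDiff_comm (S i) (torusFst ⁻¹' S' i)] at h3
    linarith
  have hprod := h S' hS'm hS'inv
  have hdiff : Tendsto (fun i => μ.real (S i) * (1 - μ.real (S i)) -
      (torusMeasure (Fin k)).real (S' i) * (1 - (torusMeasure (Fin k)).real (S' i)))
      atTop (𝓝 0) := by
    refine squeeze_zero_norm (fun i => ?_) hclose
    have hP := measurePreserving_torusFst (n := n) |>.measurable (hS'm i)
    rw [← (measurePreserving_torusFst (n := n)).measureReal_preimage (hS'm i).nullMeasurableSet]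
    have h1 := abs_measureReal_sub_le_measureReal_symmDiff (μ := μ) hP.nullMeasurableSet
      (hS i).nullMeasurableSet
    refine le_trans ?_ h1
    have ha := measureReal_nonneg (μ := μ) (s := S i)
    have ha' := measureReal_le_one (μ := μ) (s := S i)
    have hb := measureReal_nonneg (μ := μ) (s := torusFst ⁻¹' S' i)
    have hb' := measureReal_le_one (μ := μ) (s := torusFst ⁻¹' S' i)
    set a := μ.real (S i)
    set b := μ.real (torusFst ⁻¹' S' i)
    have : a * (1 - a) - b * (1 - b) = (a - b) * (1 - a - b) := by ring
    rw [this, norm_mul, Real.norm_eq_abs, Real.norm_eq_abs, abs_sub_comm a b]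
    refine mul_le_of_le_one_right (abs_nonneg _) (abs_le.2 ⟨by linarith, by linarith⟩)
  simpa using hdiff.add hprod

theorem isStronglyErgodic_groupΓ_iff (hn : 2 ≤ n) :
    IsStronglyErgodic (groupΓ n Λ) (torusMeasure (Fin k ⊕ Fin n)) ↔
      IsStronglyErgodic Λ (torusMeasure (Fin k)) :=
  ⟨isStronglyErgodic_of_groupΓ, isStronglyErgodic_groupΓ hn⟩

end StrongErgodicity

/-! ### Ergodic actions of cyclic groups -/

section Cyclic

/-- The elements of a group under which a sequence of sets is asymptotically invariant. -/
def asymptoticStabilizer (G : Type*) [Group G] {X : Type*} [MeasurableSpace X] [MulAction G X]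
    [MeasurableConstSMul G X] (μ : Measure X) [IsFiniteMeasure μ] [SMulInvariantMeasure G X μ]
    {S : ℕ → Set X} (hS : ∀ i, MeasurableSet (S i)) : Subgroup G where
  carrier := {g | Tendsto (fun i => μ.real (symmDiff ((fun x => g • x) '' S i) (S i))) atTop (𝓝 0)}
  one_mem' := by simp
  mul_mem' := by
    intro g h hg hh
    have hlim := hh.add hg
    simp only [add_zero] at hlim
    refine squeeze_zero (fun _ => measureReal_nonneg) (fun i => ?_) hlim
    have h1 : (fun x => (g * h) • x) '' S i = (fun x => g • x) '' ((fun x => h • x) '' S i) := by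
      rw [Set.image_image]
      simp only [mul_smul]
    have h2 := measureReal_symmDiff_preimage (measurePreserving_smul g⁻¹ μ)
      (measurableSet_image_smul h (hS i)) (hS i)
    rw [← image_smul_eq_preimage, ← image_smul_eq_preimage] at h2
    rw [h1, ← h2]
    exact measureReal_symmDiff_le _
  inv_mem' := by
    intro g hg
    refine Tendsto.congr (fun i => ?_) hg
    have h2 := measureReal_symmDiff_preimage (measurePreserving_smul g μ)
      (measurableSet_image_smul g (hS i)) (hS i)
    rw [image_smul_eq_preimage, ← Set.preimage_comp] at h2
    rw [← image_smul_eq_preimage g, symmDiff_comm] at h2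
    rw [← h2, image_smul_eq_preimage g⁻¹, inv_inv]
    congr 2
    ext x
    simp

variable {G X : Type*} [Group G] [MeasurableSpace X] [MulAction G X] [MeasurableConstSMul G X]
  {μ : Measure X} [IsProbabilityMeasure μ] [ErgodicSMul G X μ] {a : G}

/-- The union of the translates of a small set under a long interval of powers of an ergodic
transformation is an almost invariant set; the length of the interval can be chosen such that its
measure is about one half. -/
theorem exists_almost_invariant_of_zpowers (ha : ∀ g : G, g ∈ Subgroup.zpowers a) {B : Set X}
    (hB : MeasurableSet B) (hB0 : 0 < μ.real B) (hB1 : μ.real B < 1 / 8) :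
    ∃ S, MeasurableSet S ∧ μ.real (symmDiff ((fun x => a • x) '' S) S) ≤ 2 * μ.real B ∧
      1 / 2 ≤ μ.real S ∧ μ.real S ≤ 3 / 4 := by
  let T : ℤ → Set X := fun j => (fun x => a ^ j • x) '' B
  have hTm : ∀ j, MeasurableSet (T j) := fun j => measurableSet_image_smul _ hB
  have hT : ∀ j, μ.real (T j) = μ.real B := fun j => by
    change μ.real ((fun x => a ^ j • x) '' B) = _
    rw [image_smul_eq_preimage]
    exact (measurePreserving_smul _ μ).measureReal_preimage hB.nullMeasurableSet
  have haT : ∀ j, (fun x => a • x) '' T j = T (j + 1) := fun j => by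
    simp only [T, Set.image_image, smul_smul, ← zpow_one_add, add_comm]
  let S : ℕ → Set X := fun N => ⋃ j ∈ Set.Icc (-N : ℤ) N, T j
  have hSm : ∀ N, MeasurableSet (S N) := fun N =>
    MeasurableSet.biUnion (Set.to_countable _) fun j _ => hTm j
  have hmem : ∀ N x, x ∈ S N ↔ ∃ j : ℤ, (-N ≤ j ∧ j ≤ N) ∧ x ∈ T j := fun N x => by simp [S]
  have hS0 : S 0 = B := by
    ext x
    rw [hmem]
    constructor
    · rintro ⟨j, hj, hx⟩
      obtain rfl : j = 0 := by omega
      simpa [T] using hx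
    · intro hx
      exact ⟨0, by simp, by simpa [T] using hx⟩
  have hmono : Monotone S := fun M N hMN x hx => by
    rw [hmem] at hx ⊢
    obtain ⟨j, hj, hx⟩ := hx
    exact ⟨j, by omega, hx⟩
  have hstep : ∀ N, μ.real (S (N + 1)) ≤ μ.real (S N) + 2 * μ.real B := fun N => by
    have hsub : S (N + 1) ⊆ S N ∪ (T (N + 1) ∪ T (-(N + 1))) := by
      intro x hx
      rw [hmem] at hx
      obtain ⟨j, hj, hx⟩ := hx
      by_cases h1 : j = N + 1
      · exact Or.inr (Or.inl (h1 ▸ hx))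
      · by_cases h2 : j = -(N + 1)
        · exact Or.inr (Or.inr (h2 ▸ hx))
        · exact Or.inl ((hmem N x).2 ⟨j, by omega, hx⟩)
    have h1 := measureReal_mono (μ := μ) hsub
    have h2 := measureReal_union_le (μ := μ) (S N) (T (N + 1) ∪ T (-(N + 1)))
    have h3 := measureReal_union_le (μ := μ) (T (N + 1)) (T (-(N + 1)))
    rw [hT, hT] at h3
    linarith
  have hinv : ∀ N, μ.real (symmDiff ((fun x => a • x) '' S N) (S N)) ≤ 2 * μ.real B := fun N => by
    have hsub : symmDiff ((fun x => a • x) '' S N) (S N) ⊆ T (N + 1) ∪ T (-N) := by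
      have himg : (fun x => a • x) '' S N = ⋃ j ∈ Set.Icc (-N : ℤ) N, T (j + 1) := by
        simp only [S, Set.image_iUnion, haT]
      rintro x (⟨hx, hx'⟩ | ⟨hx, hx'⟩)
      · rw [himg] at hx
        obtain ⟨j, hj, hx⟩ := Set.mem_iUnion₂.1 hx
        by_cases h1 : j = N
        · exact Or.inl (h1 ▸ hx)
        · exact absurd ((hmem N x).2 ⟨j + 1, by have := hj.1; have := hj.2; omega, hx⟩) hx'
      · rw [himg] at hx'
        obtain ⟨j, hj, hx⟩ := (hmem N x).1 hx
        by_cases h1 : j = -N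
        · exact Or.inr (h1 ▸ hx)
        · exact absurd (Set.mem_iUnion₂.2
            ⟨j - 1, ⟨by omega, by omega⟩, by rwa [sub_add_cancel]⟩) hx'
    have h1 := measureReal_mono (μ := μ) hsub
    have h3 := measureReal_union_le (μ := μ) (T (N + 1)) (T (-N))
    rw [hT, hT] at h3
    linarith
  -- the union of all translates is invariant, hence conull
  have hU : μ (⋃ N, S N) = 1 := by
    have hUm : MeasurableSet (⋃ N, S N) := MeasurableSet.iUnion hSm
    have hUeq : ⋃ N, S N = ⋃ g : G, (fun x => g • x) '' B := by
      ext x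
      simp only [Set.mem_iUnion]
      constructor
      · rintro ⟨N, hx⟩
        obtain ⟨j, _, hx⟩ := (hmem N x).1 hx
        exact ⟨_, hx⟩
      · rintro ⟨g, hx⟩
        obtain ⟨j, rfl⟩ := Subgroup.mem_zpowers_iff.1 (ha g)
        exact ⟨j.natAbs, (hmem _ x).2 ⟨j, by omega, hx⟩⟩
    have hconst := aeconst_of_forall_preimage_smul_ae_eq G (μ := μ) hUm.nullMeasurableSet
      fun g => by
        refine Eq.eventuallyEq (show (fun x => g • x) ⁻¹' (⋃ N, S N) = ⋃ N, S N from ?_)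
        rw [hUeq]
        ext x
        simp only [Set.mem_preimage, Set.mem_iUnion]
        constructor
        · rintro ⟨h, y, hy, hyx⟩
          exact ⟨g⁻¹ * h, y, hy, (mul_smul g⁻¹ h y).trans (inv_smul_eq_iff.2 hyx)⟩
        · rintro ⟨h, y, hy, rfl⟩
          exact ⟨g * h, y, hy, mul_smul g h y⟩
    rw [eventuallyConst_set] at hconst
    rcases hconst with h | h
    · exact (prob_compl_eq_zero_iff hUm).1 h
    · have h0 : μ (⋃ N, S N) = 0 := by
        rw [measure_eq_zero_iff_ae_notMem]
        exact h
      have h1 : μ B ≤ 0 := h0 ▸ measure_mono (hS0 ▸ Set.subset_iUnion S 0)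
      rw [measureReal_def, nonpos_iff_eq_zero.1 h1] at hB0
      simp at hB0
  have hlim : Tendsto (fun N => μ.real (S N)) atTop (𝓝 1) := by
    have h1 := tendsto_measure_iUnion_atTop (μ := μ) hmono
    rw [hU] at h1
    exact (ENNReal.tendsto_toReal ENNReal.one_ne_top).comp h1
  have hex : ∃ N, 1 / 2 ≤ μ.real (S N) :=
    ((hlim.eventually_const_lt (by norm_num : (1 / 2 : ℝ) < 1)).mono fun _ h => h.le).exists
  classical
  obtain ⟨N, hN⟩ : ∃ N, Nat.find hex = N + 1 := by
    refine Nat.exists_eq_succ_of_ne_zero fun h0 => ?_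
    have h1 := Nat.find_spec hex
    rw [h0, hS0] at h1
    linarith
  have h1 := Nat.find_spec hex
  have h2 := Nat.find_min hex (m := N) (by omega)
  rw [hN] at h1
  exact ⟨S (N + 1), hSm _, hinv _, h1, by linarith [hstep N]⟩

/-- An ergodic action of a cyclic group is not strongly ergodic if there are sets of arbitrarily
small positive measure. -/
theorem not_isStronglyErgodic_of_zpowers (ha : ∀ g : G, g ∈ Subgroup.zpowers a)
    (hsmall : ∀ ε : ℝ, 0 < ε → ∃ B : Set X, MeasurableSet B ∧ 0 < μ.real B ∧ μ.real B < ε) :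
    ¬ IsStronglyErgodic G μ := by
  intro hse
  have hseq : ∀ i : ℕ, ∃ S, MeasurableSet S ∧
      μ.real (symmDiff ((fun x => a • x) '' S) S) ≤ 2 * (1 / ((i : ℝ) + 1)) ∧
      1 / 2 ≤ μ.real S ∧ μ.real S ≤ 3 / 4 := fun i => by
    obtain ⟨B, hB, hB0, hB1⟩ := hsmall (min (1 / ((i : ℝ) + 1)) (1 / 8)) (by positivity)
    obtain ⟨S, hS, h1, h2⟩ := exists_almost_invariant_of_zpowers ha hB hB0
      (hB1.trans_le (min_le_right _ _))
    exact ⟨S, hS, h1.trans (by linarith [hB1.trans_le (min_le_left _ _)]), h2⟩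
  choose S hS hS1 hS2 hS3 using hseq
  have hmem : a ∈ asymptoticStabilizer G μ hS := by
    have hlim : Tendsto (fun i : ℕ => 2 * (1 / ((i : ℝ) + 1))) atTop (𝓝 0) := by
      simpa using (tendsto_one_div_add_atTop_nhds_zero_nat (𝕜 := ℝ)).const_mul 2
    exact squeeze_zero (fun _ => measureReal_nonneg) hS1 hlim
  have h := hse S hS fun g => (Subgroup.zpowers_le.2 hmem) (ha g)
  have h1 : (1 / 8 : ℝ) ≤ 0 := ge_of_tendsto h (Eventually.of_forall fun i => by
    nlinarith [hS2 i, hS3 i])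
  norm_num at h1

end Cyclic

section Example

variable {k : ℕ} {A : Matrix.SpecialLinearGroup (Fin k) ℤ}

/-- If the powers of `A` had a finite orbit on `ℤ^k \ {0}`, then a power of `A` would have the
eigenvalue `1`, hence `A` an eigenvalue that is a root of unity. -/
theorem infinite_orbits_zpowers
    (hA : ∀ z : ℂ, Module.End.HasEigenvalue (Matrix.toLin' (A.1.map (Int.cast : ℤ → ℂ))) z →
      ∀ m : ℕ, 0 < m → z ^ m ≠ 1) (x : Fin k → ℤ) (hx : x ≠ 0) :
    {y : Fin k → ℤ | ∃ B ∈ Subgroup.zpowers A, B.1 *ᵥ x = y}.Infinite := by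
  intro hfin
  have hmaps : Set.MapsTo (fun m : ℕ => (A ^ m).1 *ᵥ x) Set.univ
      {y : Fin k → ℤ | ∃ B ∈ Subgroup.zpowers A, B.1 *ᵥ x = y} := fun m _ =>
    ⟨A ^ m, Subgroup.npow_mem_zpowers A m, rfl⟩
  obtain ⟨p, _, q, _, hpq, heq⟩ := Set.infinite_univ.exists_lt_map_eq_of_mapsTo hmaps hfin
  obtain ⟨d, rfl⟩ := Nat.exists_eq_add_of_lt hpq
  have hfix : (A ^ (d + 1)).1 *ᵥ x = x := by
    have h1 := congrArg (fun y => ((A ^ p)⁻¹).1 *ᵥ y) heq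
    simp only [Matrix.mulVec_mulVec] at h1
    rw [← Matrix.SpecialLinearGroup.coe_mul, ← Matrix.SpecialLinearGroup.coe_mul, add_assoc,
      pow_add, inv_mul_cancel, inv_mul_cancel_left, Matrix.SpecialLinearGroup.coe_one,
      Matrix.one_mulVec] at h1
    exact h1.symm
  set f := Matrix.toLin' (A.1.map (Int.cast : ℤ → ℂ)) with hf
  set v : Fin k → ℂ := fun i => (x i : ℂ) with hv
  have hv0 : v ≠ 0 := fun h0 => hx (funext fun i => by
    have := congrFun h0 i
    simpa [hv] using this)
  have hfv : (f ^ (d + 1)) v = v := by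
    have hpow : A.1.map (Int.cast : ℤ → ℂ) ^ (d + 1) =
        (A ^ (d + 1)).1.map (Int.cast : ℤ → ℂ) := by
      rw [Matrix.SpecialLinearGroup.coe_pow]
      exact (map_pow (Int.castRingHom ℂ).mapMatrix A.1 (d + 1)).symm
    rw [hf, ← Matrix.toLin'_pow, hpow, Matrix.toLin'_apply]
    funext i
    have h1 := RingHom.map_mulVec (Int.castRingHom ℂ) (A ^ (d + 1)).1 x i
    rw [hfix] at h1
    exact h1.symm
  have hev : Module.End.HasEigenvalue (f ^ (d + 1)) 1 :=
    Module.End.hasEigenvalue_of_hasEigenvector (x := v)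
      ⟨Module.End.mem_eigenspace_iff.2 (by rw [hfv, one_smul]), hv0⟩
  have : Nontrivial (Fin k → ℂ) := ⟨v, 0, hv0⟩
  rw [Module.End.hasEigenvalue_iff_mem_spectrum, spectrum.map_pow_of_pos _ d.succ_pos] at hev
  obtain ⟨z, hz, hz1⟩ := hev
  exact hA z (Module.End.hasEigenvalue_iff_mem_spectrum.2 hz) (d + 1) d.succ_pos hz1

theorem exists_small_measurableSet_torus {ι : Type*} [Fintype ι] [Nonempty ι] (ε : ℝ)
    (hε : 0 < ε) : ∃ B : Set (UnitAddTorus ι), MeasurableSet B ∧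
      0 < (torusMeasure ι).real B ∧ (torusMeasure ι).real B < ε := by
  obtain ⟨i⟩ := ‹Nonempty ι›
  have h0 : torusMeasure ι {0} = 0 := by
    have : NullSingletonClass (torusMeasure ι) := Measure.pi_nullSingletonClass'
    exact measure_singleton 0
  obtain ⟨U, h0U, hU, hUε⟩ := Set.exists_isOpen_lt_of_lt (μ := torusMeasure ι) {0}
    (ENNReal.ofReal ε) (by rw [h0]; exact ENNReal.ofReal_pos.2 hε)
  refine ⟨U, hU.measurableSet, ?_, ?_⟩
  · exact ENNReal.toReal_pos (hU.measure_pos _ ⟨0, h0U rfl⟩).ne' (measure_ne_top _ _)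
  · exact (ENNReal.lt_ofReal_iff_toReal_lt (measure_ne_top _ _)).1 hUε

theorem not_isStronglyErgodic_zpowers (hk : 2 ≤ k)
    (hA : ∀ z : ℂ, Module.End.HasEigenvalue (Matrix.toLin' (A.1.map (Int.cast : ℤ → ℂ))) z →
      ∀ m : ℕ, 0 < m → z ^ m ≠ 1) :
    ¬ IsStronglyErgodic (Subgroup.zpowers A) (torusMeasure (Fin k)) := by
  have herg : ErgodicSMul (Subgroup.zpowers A) (UnitAddTorus (Fin k)) (torusMeasure (Fin k)) := by
    rw [ergodicSMul_torus_iff (ρ := (Subgroup.zpowers A).subtype) fun _ _ => rfl]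
    intro v hv
    refine (infinite_orbits_zpowers hA v hv).mono ?_
    rintro _ ⟨B, hB, rfl⟩
    exact ⟨⟨B, hB⟩, rfl⟩
  have : Nonempty (Fin k) := ⟨⟨0, by omega⟩⟩
  refine not_isStronglyErgodic_of_zpowers (a := ⟨A, Subgroup.mem_zpowers A⟩) (fun g => ?_)
    exists_small_measurableSet_torus
  obtain ⟨m, hm⟩ := Subgroup.mem_zpowers_iff.1 g.2
  exact Subgroup.mem_zpowers_iff.2 ⟨m, Subtype.ext hm⟩

end Example

end RigidActions

end

theorem theorem1 (k n : ℕ) (hn : 2 ≤ n)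
    (Λ : Subgroup (Matrix.SpecialLinearGroup (Fin k) ℤ)) :
    -- (1) relative property (T) and rigidity
    (HasRelativePropertyT.{u, 0} ((groupH₁ k n).subgroupOf (groupH₂ k n)) ∧
      HasRelativePropertyT.{u, 0} ((groupH k n).subgroupOf (groupG n Λ)) ∧
      IsRigidAction.{0, 0, u} (groupΓ n Λ) (torusMeasure (Fin k ⊕ Fin n))) ∧
    -- (2) ergodicity
    ((ErgodicSMul (groupΓ n Λ) (UnitAddTorus (Fin k ⊕ Fin n)) (torusMeasure (Fin k ⊕ Fin n)) ↔
        ∀ x : Fin k → ℤ, x ≠ 0 → {y : Fin k → ℤ | ∃ A ∈ Λ, A.1 *ᵥ x = y}.Infinite) ∧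
      (1 ≤ k → Λ = ⊥ →
        IsRigidAction.{0, 0, u} (groupΓ n Λ) (torusMeasure (Fin k ⊕ Fin n)) ∧
        ¬ ErgodicSMul (groupΓ n Λ) (UnitAddTorus (Fin k ⊕ Fin n))
          (torusMeasure (Fin k ⊕ Fin n)))) ∧
    -- (3) strong ergodicity
    (IsStronglyErgodic (groupΓ n Λ) (torusMeasure (Fin k ⊕ Fin n)) ↔
      IsStronglyErgodic Λ (torusMeasure (Fin k))) ∧
    -- (4) essential freeness
    IsEssentiallyFree (groupΓ n Λ) (torusMeasure (Fin k ⊕ Fin n)) ∧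
    -- the concrete examples
    (2 ≤ k → ∀ A : Matrix.SpecialLinearGroup (Fin k) ℤ,
      (∀ z : ℂ, Module.End.HasEigenvalue (Matrix.toLin' (A.1.map (Int.cast : ℤ → ℂ))) z →
        ∀ m : ℕ, 0 < m → z ^ m ≠ 1) →
      Λ = Subgroup.zpowers A →
        IsRigidAction.{0, 0, u} (groupΓ n Λ) (torusMeasure (Fin k ⊕ Fin n)) ∧
        IsEssentiallyFree (groupΓ n Λ) (torusMeasure (Fin k ⊕ Fin n)) ∧
        IsProbabilityMeasure (torusMeasure (Fin k ⊕ Fin n)) ∧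
        (∀ g : groupΓ n Λ, MeasurePreserving
          (fun x : UnitAddTorus (Fin k ⊕ Fin n) => g • x)
          (torusMeasure (Fin k ⊕ Fin n)) (torusMeasure (Fin k ⊕ Fin n))) ∧
        ErgodicSMul (groupΓ n Λ) (UnitAddTorus (Fin k ⊕ Fin n))
          (torusMeasure (Fin k ⊕ Fin n)) ∧
        ¬ IsStronglyErgodic (groupΓ n Λ) (torusMeasure (Fin k ⊕ Fin n))) := by
  refine ⟨⟨hasRelativePropertyT_groupH₁ k hn, hasRelativePropertyT_groupH hn Λ,
    isRigidAction_torus hn Λ⟩, ⟨ergodicSMul_groupΓ_iff hn, fun hk hΛ =>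
      ⟨isRigidAction_torus hn Λ, not_ergodicSMul_of_eq_bot hn hk hΛ⟩⟩,
    isStronglyErgodic_groupΓ_iff hn, isEssentiallyFree_groupΓ, ?_⟩
  rintro hk A hA rfl
  exact ⟨isRigidAction_torus hn _, isEssentiallyFree_groupΓ, inferInstance,
    fun g => measurePreserving_smul g _,
    (ergodicSMul_groupΓ_iff hn).2 (infinite_orbits_zpowers hA),
    fun h => not_isStronglyErgodic_zpowers hk hA ((isStronglyErgodic_groupΓ_iff hn).1 h)⟩
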